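/- Let $(M,g,J)$ be a connected Kähler manifold of real dimension $4$, where $g$ is allowed to have arbitrary signature: $g$ is a smooth pseudo-Riemannian metric and $J$ an almost complex structure which is hermitian, $g(JX,JY)=g(X,Y)$, and parallel for the Levi-Civita connection of $g$. Write a comma for the covariant derivative with respect to $g$, $J_{jk}=g_{j\alpha}J^{\alpha}{}_{k}$, and $\bar\lambda_i=J^{\alpha}{}_{i}\lambda_\alpha$ for a $1$-form $\lambda_i$. Consider the linear system $$a_{ij,k}=\lambda_i g_{jk}+\lambda_j g_{ik}-\bar\lambda_i J_{jk}-\bar\lambda_j J_{ik}\qquad(*)$$ for a smooth symmetric hermitian $(0,2)$-tensor field $a_{ij}$ and a smooth $1$-form $\lambda_i$ on $M$. Assume that the degree of mobility of $g$, that is, the dimension of the real vector space of all solutions $(a_{ij},\lambda_i)$ of $(*)$ on $M$, is at least $3$. Then there is a constant $B\in\mathbb R$ such that $g$ has constant holomorphic sectional curvature $-4B$, i.e. $g(R(X,JX)JX,X)=-4B\,g(X,X)^2$ for every tangent vector $X$ with $g(X,X)\neq0$, where $R(X,Y)=\nabla_X\nabla_Y-\nabla_Y\nabla_X-\nabla_{[X,Y]}$,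 and $B$ is the coefficient in $$\lambda_{i,j}=\mu g_{ij}+Ba_{ij}\qquad(**)$$ in the following sense: for every solution $(a_{ij},\lambda_i)$ of $(*)$ there is a function $\mu$ on $M$ such that $(**)$ holds on all of $M$; and if $a_{ij}$ is not a multiple of $g_{ij}$ at a point $p$, and $\lambda_{i,j}=\mu' g_{ij}+B' a_{ij}$ holds at $p$ for some real numbers $\mu'$ and $B'$, then $B'=B$. In particular, the coefficient $B$ is a constant and is the same for all solutions. -/

import Mathlib

open scoped Manifold ContDiff

noncomputable section

namespace KahlerMobility

section TensorFields

/-- Covector fields `λ_i` (smoothness is a separate predicate). -/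
abbrev CovectorField (m : ℕ) (M : Type*) [TopologicalSpace M]
    [ChartedSpace (EuclideanSpace ℝ (Fin m)) M] : Type _ :=
  ∀ p : M, TangentSpace (𝓡 m) p →ₗ[ℝ] ℝ

/-- Fields of bilinear forms, i.e. `(0,2)`-tensor fields `a_{ij}`. -/
abbrev BilinField (m : ℕ) (M : Type*) [TopologicalSpace M]
    [ChartedSpace (EuclideanSpace ℝ (Fin m)) M] : Type _ :=
  ∀ p : M, TangentSpace (𝓡 m) p →ₗ[ℝ] TangentSpace (𝓡 m) p →ₗ[ℝ] ℝ

/-- Fields of endomorphisms of the tangent spaces, i.e. `(1,1)`-tensor fields `J^i_j`. -/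
abbrev EndoField (m : ℕ) (M : Type*) [TopologicalSpace M]
    [ChartedSpace (EuclideanSpace ℝ (Fin m)) M] : Type _ :=
  ∀ p : M, TangentSpace (𝓡 m) p →ₗ[ℝ] TangentSpace (𝓡 m) p

variable {m : ℕ} {M : Type*} [TopologicalSpace M] [ChartedSpace (EuclideanSpace ℝ (Fin m)) M]

/-- The smooth charts of `M`: all local coordinate systems compatible with the smooth structure. -/
abbrev charts (m : ℕ) (M : Type*) [TopologicalSpace M]
    [ChartedSpace (EuclideanSpace ℝ (Fin m)) M] :
    Set (OpenPartialHomeomorph M (EuclideanSpace ℝ (Fin m))) :=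
  IsManifold.maximalAtlas (𝓡 m) ∞ M

/-- The coordinate vector `∂_i` of the chart `e`, at the point with coordinates `x`. -/
def coordVec (e : OpenPartialHomeomorph M (EuclideanSpace ℝ (Fin m)))
    (x : EuclideanSpace ℝ (Fin m)) (i : Fin m) : TangentSpace (𝓡 m) (e.symm x) :=
  mfderiv (𝓡 m) (𝓡 m) e.symm x
    (EuclideanSpace.single i (1 : ℝ) : EuclideanSpace ℝ (Fin m))

/-- The `i`-th coordinate, in the chart `e`, of a tangent vector at the point with
coordinates `x`, i.e. its pairing with `dx^i`. -/
def vecCoord (e : OpenPartialHomeomorph M (EuclideanSpace ℝ (Fin m)))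
    (x : EuclideanSpace ℝ (Fin m)) (i : Fin m) (v : TangentSpace (𝓡 m) (e.symm x)) : ℝ :=
  (EuclideanSpace.proj i : EuclideanSpace ℝ (Fin m) →L[ℝ] ℝ)
    (mfderiv (𝓡 m) (𝓡 m) e (e.symm x) v)

/-- The components `λ_i` of a covector field in the chart `e`. -/
def comp₁ (l : CovectorField m M) (e : OpenPartialHomeomorph M (EuclideanSpace ℝ (Fin m)))
    (i : Fin m) (x : EuclideanSpace ℝ (Fin m)) : ℝ :=
  l (e.symm x) (coordVec e x i)

/-- The components `a_{ij}` of a `(0,2)`-tensor field in the chart `e`. -/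
def comp₂ (a : BilinField m M) (e : OpenPartialHomeomorph M (EuclideanSpace ℝ (Fin m)))
    (i j : Fin m) (x : EuclideanSpace ℝ (Fin m)) : ℝ :=
  a (e.symm x) (coordVec e x i) (coordVec e x j)

/-- The components `J^i_j` of a `(1,1)`-tensor field in the chart `e` (`J ∂_j = J^i_j ∂_i`). -/
def compEndo (J : EndoField m M) (e : OpenPartialHomeomorph M (EuclideanSpace ℝ (Fin m)))
    (i j : Fin m) (x : EuclideanSpace ℝ (Fin m)) : ℝ :=
  vecCoord e x i (J (e.symm x) (coordVec e x j))

/-- A covector field is smooth: its components in all smooth charts are smooth. -/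
def SmoothCovector (l : CovectorField m M) : Prop :=
  ∀ e ∈ charts m M, ∀ i, ContDiffOn ℝ ∞ (comp₁ l e i) e.target

/-- A `(0,2)`-tensor field is smooth: its components in all smooth charts are smooth. -/
def SmoothBilin (a : BilinField m M) : Prop :=
  ∀ e ∈ charts m M, ∀ i j, ContDiffOn ℝ ∞ (comp₂ a e i j) e.target

/-- A `(1,1)`-tensor field is smooth: its components in all smooth charts are smooth. -/
def SmoothEndo (J : EndoField m M) : Prop :=
  ∀ e ∈ charts m M, ∀ i j, ContDiffOn ℝ ∞ (compEndo J e i j) e.target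

/-- The partial derivative `∂_k f` at `x`. -/
def pd (k : Fin m) (f : EuclideanSpace ℝ (Fin m) → ℝ) (x : EuclideanSpace ℝ (Fin m)) : ℝ :=
  fderiv ℝ f x (EuclideanSpace.single k (1 : ℝ))

/-- The inverse metric `g^{ij}` in the chart `e`. -/
def invMetric (g : BilinField m M) (e : OpenPartialHomeomorph M (EuclideanSpace ℝ (Fin m)))
    (i j : Fin m) (x : EuclideanSpace ℝ (Fin m)) : ℝ :=
  (Matrix.of fun k l => comp₂ g e k l x)⁻¹ i j

/-- The Christoffel symbols of the Levi-Civita connection,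
`Γ^k_{ij} = ½ g^{kl} (∂_i g_{jl} + ∂_j g_{il} - ∂_l g_{ij})`. -/
def christoffel (g : BilinField m M) (e : OpenPartialHomeomorph M (EuclideanSpace ℝ (Fin m)))
    (k i j : Fin m) (x : EuclideanSpace ℝ (Fin m)) : ℝ :=
  (1 / 2) * ∑ l, invMetric g e k l x *
    (pd i (comp₂ g e j l) x + pd j (comp₂ g e i l) x - pd l (comp₂ g e i j) x)

/-- The covariant derivative of a covector field: `λ_{i,j} = ∇_j λ_i = ∂_j λ_i - Γ^k_{ij} λ_k`. -/
def covDeriv₁ (g : BilinField m M) (l : CovectorField m M)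
    (e : OpenPartialHomeomorph M (EuclideanSpace ℝ (Fin m)))
    (i j : Fin m) (x : EuclideanSpace ℝ (Fin m)) : ℝ :=
  pd j (comp₁ l e i) x - ∑ k, christoffel g e k i j x * comp₁ l e k x

/-- The covariant derivative of a `(0,2)`-tensor field:
`a_{ij,k} = ∇_k a_{ij} = ∂_k a_{ij} - Γ^r_{ik} a_{rj} - Γ^r_{jk} a_{ir}`. -/
def covDeriv₂ (g a : BilinField m M)
    (e : OpenPartialHomeomorph M (EuclideanSpace ℝ (Fin m)))
    (i j k : Fin m) (x : EuclideanSpace ℝ (Fin m)) : ℝ :=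
  pd k (comp₂ a e i j) x - ∑ r, christoffel g e r i k x * comp₂ a e r j x
    - ∑ r, christoffel g e r j k x * comp₂ a e i r x

/-- The covariant derivative of a `(1,1)`-tensor field:
`J^i_{j,k} = ∇_k J^i_j = ∂_k J^i_j + Γ^i_{rk} J^r_j - Γ^r_{jk} J^i_r`. -/
def covDerivEndo (g : BilinField m M) (J : EndoField m M)
    (e : OpenPartialHomeomorph M (EuclideanSpace ℝ (Fin m)))
    (i j k : Fin m) (x : EuclideanSpace ℝ (Fin m)) : ℝ :=
  pd k (compEndo J e i j) x + ∑ r, christoffel g e i r k x * compEndo J e r j x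
    - ∑ r, christoffel g e r j k x * compEndo J e i r x

/-- The curvature tensor `R^i_{jkl}` of `g`, i.e. `R(∂_k, ∂_l) ∂_j = R^i_{jkl} ∂_i` where
`R(X, Y) = ∇_X ∇_Y - ∇_Y ∇_X - ∇_[X,Y]`. -/
def curvature (g : BilinField m M) (e : OpenPartialHomeomorph M (EuclideanSpace ℝ (Fin m)))
    (i j k l : Fin m) (x : EuclideanSpace ℝ (Fin m)) : ℝ :=
  pd k (christoffel g e i l j) x - pd l (christoffel g e i k j) x
    + ∑ r, christoffel g e i k r x * christoffel g e r l j x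
    - ∑ r, christoffel g e i l r x * christoffel g e r k j x

/-- `(g, J)` is a Kähler structure on `M`, where `g` is a pseudo-Riemannian metric of arbitrary
signature: `g` is symmetric and nondegenerate, `J` is an almost complex structure for which `g`
is hermitian, and `J` is parallel with respect to the Levi-Civita connection of `g` (so that `J`
is integrable). -/
structure IsKahler (g : BilinField m M) (J : EndoField m M) : Prop where
  smooth_metric : SmoothBilin g
  symm : ∀ p X Y, g p X Y = g p Y X
  nondegenerate : ∀ p X, (∀ Y, g p X Y = 0) → X = 0
  smooth_complex : SmoothEndo J
  sq_eq_neg : ∀ p X, J p (J p X) = -X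
  hermitian : ∀ p X Y, g p (J p X) (J p Y) = g p X Y
  parallel : ∀ e ∈ charts m M, ∀ x ∈ e.target, ∀ i j k, covDerivEndo g J e i j k x = 0

/-- The covector field `λ̄_i = J^r_i λ_r`. -/
def barCovector (J : EndoField m M) (l : CovectorField m M) : CovectorField m M :=
  fun p => (l p) ∘ₗ (J p)

/-- The Kähler form `J_{jk} = g_{jr} J^r_k`, as a `(0,2)`-tensor field. -/
def kahlerForm (g : BilinField m M) (J : EndoField m M) : BilinField m M :=
  fun p => (g p).compl₂ (J p)

/-- `(a, λ)` is a (smooth) solution, with `a` symmetric and hermitian, of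
`a_{ij,k} = λ_i g_{jk} + λ_j g_{ik} - λ̄_i J_{jk} - λ̄_j J_{ik}`. -/
structure IsSolution (g : BilinField m M) (J : EndoField m M)
    (a : BilinField m M) (l : CovectorField m M) : Prop where
  smooth_bilin : SmoothBilin a
  smooth_covector : SmoothCovector l
  symm : ∀ p X Y, a p X Y = a p Y X
  hermitian : ∀ p X Y, a p (J p X) (J p Y) = a p X Y
  equation : ∀ e ∈ charts m M, ∀ x ∈ e.target, ∀ i j k,
    covDeriv₂ g a e i j k x =
      comp₁ l e i x * comp₂ g e j k x + comp₁ l e j x * comp₂ g e i k x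
        - comp₁ (barCovector J l) e i x * comp₂ (kahlerForm g J) e j k x
        - comp₁ (barCovector J l) e j x * comp₂ (kahlerForm g J) e i k x

/-- At the point `p`, `λ_{i,j} = μ g_{ij} + B a_{ij}`. -/
def HessianEqAt (g a : BilinField m M) (l : CovectorField m M) (p : M) (μ B : ℝ) : Prop :=
  ∀ e ∈ charts m M, p ∈ e.source → ∀ i j,
    covDeriv₁ g l e i j (e p) = μ * comp₂ g e i j (e p) + B * comp₂ a e i j (e p)

/-- `g(X, X)` for the vector `X = ξ^i ∂_i`, at the point with coordinates `x`. -/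
def normSq (g : BilinField m M) (e : OpenPartialHomeomorph M (EuclideanSpace ℝ (Fin m)))
    (x : EuclideanSpace ℝ (Fin m)) (ξ : Fin m → ℝ) : ℝ :=
  ∑ i, ∑ j, comp₂ g e i j x * ξ i * ξ j

/-- The coordinates `J^i_r ξ^r` of `J X`, for the vector `X = ξ^i ∂_i`. -/
def rotate (J : EndoField m M) (e : OpenPartialHomeomorph M (EuclideanSpace ℝ (Fin m)))
    (x : EuclideanSpace ℝ (Fin m)) (ξ : Fin m → ℝ) (i : Fin m) : ℝ :=
  ∑ r, compEndo J e i r x * ξ r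

/-- The holomorphic sectional curvature `g(R(X, JX) JX, X) / g(X, X)²`, for the non-null vector
`X = ξ^i ∂_i`: the sectional curvature of the plane spanned by `X` and `JX`. -/
def holSectionalCurvature (g : BilinField m M) (J : EndoField m M)
    (e : OpenPartialHomeomorph M (EuclideanSpace ℝ (Fin m)))
    (x : EuclideanSpace ℝ (Fin m)) (ξ : Fin m → ℝ) : ℝ :=
  (∑ s, ∑ i, ∑ j, ∑ k, ∑ l, comp₂ g e s i x * ξ s *
    (curvature g e i j k l x * rotate J e x ξ j * ξ k * rotate J e x ξ l)) / normSq g e x ξ ^ 2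

/-- `g` has constant holomorphic sectional curvature `c`. -/
def HasConstHolSectionalCurvature (g : BilinField m M) (J : EndoField m M) (c : ℝ) : Prop :=
  ∀ e ∈ charts m M, ∀ x ∈ e.target, ∀ ξ : Fin m → ℝ,
    normSq g e x ξ ≠ 0 → holSectionalCurvature g J e x ξ = c

/-! The solutions form a vector space. -/

lemma pd_add {f h : EuclideanSpace ℝ (Fin m) → ℝ} {s : Set (EuclideanSpace ℝ (Fin m))}
    (hs : IsOpen s) (hf : ContDiffOn ℝ ∞ f s) (hh : ContDiffOn ℝ ∞ h s)
    {x : EuclideanSpace ℝ (Fin m)} (hx : x ∈ s) (k : Fin m) :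
    pd k (fun y => f y + h y) x = pd k f x + pd k h x := by
  have h1 : DifferentiableAt ℝ f x :=
    ((hf.contDiffAt (hs.mem_nhds hx)).differentiableAt (by simp))
  have h2 : DifferentiableAt ℝ h x :=
    ((hh.contDiffAt (hs.mem_nhds hx)).differentiableAt (by simp))
  simp only [pd]
  rw [fderiv_fun_add h1 h2]
  rfl

lemma pd_const_mul {f : EuclideanSpace ℝ (Fin m) → ℝ} {s : Set (EuclideanSpace ℝ (Fin m))}
    (hs : IsOpen s) (hf : ContDiffOn ℝ ∞ f s) {x : EuclideanSpace ℝ (Fin m)} (hx : x ∈ s)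
    (c : ℝ) (k : Fin m) : pd k (fun y => c * f y) x = c * pd k f x := by
  have h1 : DifferentiableAt ℝ f x :=
    ((hf.contDiffAt (hs.mem_nhds hx)).differentiableAt (by simp))
  simp only [pd]
  rw [fderiv_const_mul h1]
  rfl

lemma IsSolution.zero (g : BilinField m M) (J : EndoField m M) : IsSolution g J 0 0 where
  smooth_bilin _ _ _ _ := contDiffOn_const (c := (0 : ℝ))
  smooth_covector _ _ _ := contDiffOn_const (c := (0 : ℝ))
  symm _ _ _ := rfl
  hermitian _ _ _ := rfl
  equation e _ x _ i j k := by
    have h : ∀ i j, comp₂ (0 : BilinField m M) e i j = fun _ => 0 := fun _ _ => rfl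
    have h' : ∀ i, comp₁ (0 : CovectorField m M) e i = fun _ => 0 := fun _ => rfl
    have h'' : ∀ i, comp₁ (barCovector J 0) e i = fun _ => 0 := fun _ => rfl
    simp [covDeriv₂, h, h', h'', pd]

lemma IsSolution.add {g : BilinField m M} {J : EndoField m M} {a b : BilinField m M}
    {l n : CovectorField m M} (ha : IsSolution g J a l) (hb : IsSolution g J b n) :
    IsSolution g J (a + b) (l + n) where
  smooth_bilin e he i j := (ha.smooth_bilin e he i j).add (hb.smooth_bilin e he i j)
  smooth_covector e he i := (ha.smooth_covector e he i).add (hb.smooth_covector e he i)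
  symm p X Y := by simp [ha.symm p X Y, hb.symm p X Y]
  hermitian p X Y := by simp [ha.hermitian p X Y, hb.hermitian p X Y]
  equation e he x hx i j k := by
    have h : ∀ i j, comp₂ (a + b) e i j = fun y => comp₂ a e i j y + comp₂ b e i j y :=
      fun _ _ => rfl
    have h' : ∀ i, comp₁ (l + n) e i = fun y => comp₁ l e i y + comp₁ n e i y :=
      fun _ => rfl
    have h'' : ∀ i, comp₁ (barCovector J (l + n)) e i =
        fun y => comp₁ (barCovector J l) e i y + comp₁ (barCovector J n) e i y := fun _ => rfl
    have ea := ha.equation e he x hx i j k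
    have eb := hb.equation e he x hx i j k
    simp only [covDeriv₂, h, h', h''] at ea eb ⊢
    rw [pd_add e.open_target (ha.smooth_bilin e he i j) (hb.smooth_bilin e he i j) hx]
    simp only [mul_add, Finset.sum_add_distrib]
    linear_combination ea + eb

lemma IsSolution.smul {g : BilinField m M} {J : EndoField m M} {a : BilinField m M}
    {l : CovectorField m M} (c : ℝ) (ha : IsSolution g J a l) :
    IsSolution g J (c • a) (c • l) where
  smooth_bilin e he i j := contDiffOn_const.mul (ha.smooth_bilin e he i j)
  smooth_covector e he i := contDiffOn_const.mul (ha.smooth_covector e he i)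
  symm p X Y := by simp [ha.symm p X Y]
  hermitian p X Y := by simp [ha.hermitian p X Y]
  equation e he x hx i j k := by
    have h : ∀ i j, comp₂ (c • a) e i j = fun y => c * comp₂ a e i j y := fun _ _ => rfl
    have h' : ∀ i, comp₁ (c • l) e i = fun y => c * comp₁ l e i y := fun _ => rfl
    have h'' : ∀ i, comp₁ (barCovector J (c • l)) e i =
        fun y => c * comp₁ (barCovector J l) e i y := fun _ => rfl
    have ea := ha.equation e he x hx i j k
    simp only [covDeriv₂, h, h', h''] at ea ⊢
    rw [pd_const_mul e.open_target (ha.smooth_bilin e he i j) hx]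
    simp only [mul_left_comm _ c, ← Finset.mul_sum]
    linear_combination c * ea

/-- The vector space of solutions `(a, λ)`. -/
def solutionSpace (g : BilinField m M) (J : EndoField m M) :
    Submodule ℝ (BilinField m M × CovectorField m M) where
  carrier := {s | IsSolution g J s.1 s.2}
  zero_mem' := IsSolution.zero g J
  add_mem' h h' := h.add h'
  smul_mem' c _ h := h.smul c

/-- The degree of mobility of the Kähler metric `g` (with complex structure `J`): the dimension
of the space of solutions. -/
def degreeOfMobility (g : BilinField m M) (J : EndoField m M) : Cardinal :=
  Module.rank ℝ (solutionSpace g J)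

end TensorFields

end KahlerMobility

end

/-! At a point of a Kähler surface the hermitian forms modulo `g` form a space of dimension 3, and
the curvature endomorphisms `R(x, y)`, being skew and complex-linear, act on it like cross products
(up to signs that depend on the signature). The Ricci identity for `a` expresses the action of `R(x,
y)` on `a` through `L = ∇λ`. It first forces `L` to be hermitian and symmetric
(`Integrability.hessian_hermitian`, `Integrability.hessian_symm`).

Let `a₀`, `L₀` be the classes of `a`, `L` modulo `g`. Splitting the (1,1) two-forms into the Kähler
direction and the three trace-free directions `ξ`, the identity reads `W₀ × a₀ = 0` and `W ξ × a₀ =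
ξ × L₀`, where `W₀` and the symmetric matrix `W` are the corresponding blocks of the curvature. If
two solutions are independent modulo `g`, then `W₀ = 0`. The second equation makes `W` commute with
the rotations about both values of `a₀`, so `W` is a scalar `B`, and the Bianchi identity determines
the last component. The curvature is therefore that of constant holomorphic sectional curvature
`-4B`, and `L₀ = B a₀` for every solution: this is `exists_constant_curvature`.

Three analytic arguments turn this into a global statement. If `a' = f a + h g` on an open set,
differentiation gives `df = dh = 0`, so a constant combination of the solutions vanishes near a
point (`exists_vanishing_combination`). The system for `(a, λ, ∇λ)` is closed and linear of first
order, so a solution that vanishes near one point vanishes on the connected manifold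
(`IsSolution.eq_zero_of_eventually_eq_zero`). Hence three independent solutions, one of which is
`(g, 0)`, are pointwise independent on a dense open set. There the Ricci identity for `λ` yields a
Schur lemma, `dB = 0` (`fderiv_eq_zero_of_hasConstantAt`). Since `B` is a smooth function of the
curvature near every point, it is locally constant across the gaps of the dense set, hence constant,
and continuity extends both conclusions to all points. -/

noncomputable section

namespace KahlerMobility

/-! ### Pseudo-hermitian linear algebra in real dimension four -/

section Pointwise

variable {V : Type*} [NormedAddCommGroup V] [NormedSpace ℝ V]

/-- A nondegenerate symmetric form `g` which is hermitian for the complex structure `J`. -/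
structure PseudoHermitian (g : V →L[ℝ] V →L[ℝ] ℝ) (J : V →L[ℝ] V) : Prop where
  symm : ∀ u v, g u v = g v u
  nondegenerate : ∀ u, (∀ v, g u v = 0) → u = 0
  sq_eq_neg : ∀ u, J (J u) = -u
  hermitian : ∀ u v, g (J u) (J v) = g u v

/-- `e₁, J e₁, e₂, J e₂` is an orthogonal basis of non-null vectors. -/
structure AdaptedFrame (g : V →L[ℝ] V →L[ℝ] ℝ) (J : V →L[ℝ] V) (e₁ e₂ : V) : Prop where
  ne₁ : g e₁ e₁ ≠ 0
  ne₂ : g e₂ e₂ ≠ 0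
  orth : g e₁ e₂ = 0
  orth' : g e₁ (J e₂) = 0
  expand : ∀ v, v = (g v e₁ / g e₁ e₁) • e₁ + (g v (J e₁) / g e₁ e₁) • J e₁ +
    ((g v e₂ / g e₂ e₂) • e₂ + (g v (J e₂) / g e₂ e₂) • J e₂)

/-- The symmetries of a curvature tensor `R(z, w)u` of a Kähler metric at a point. -/
structure CurvatureLike (g : V →L[ℝ] V →L[ℝ] ℝ) (J : V →L[ℝ] V)
    (R : V →L[ℝ] V →L[ℝ] V →L[ℝ] V) : Prop where
  skew : ∀ z w u, R z w u = -R w z u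
  bianchi : ∀ z w u, R z w u + R w u z + R u z w = 0
  metric : ∀ z w u v, g (R z w u) v = -g u (R z w v)
  commute : ∀ z w u, R z w (J u) = J (R z w u)

/-- The integrability condition of the mobility equation at a point: the Ricci identity for `a`,
where `L z u` is the covariant derivative of `λ` in the direction `z`, evaluated on `u`. -/
structure Integrability (g : V →L[ℝ] V →L[ℝ] ℝ) (J : V →L[ℝ] V)
    (R : V →L[ℝ] V →L[ℝ] V →L[ℝ] V) (a L : V →L[ℝ] V →L[ℝ] ℝ) : Prop where
  symm : ∀ u v, a u v = a v u
  hermitian : ∀ u v, a (J u) (J v) = a u v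
  ricci : ∀ x y z w, a (R x y z) w + a z (R x y w) +
    (L x z * g w y + L x w * g z y - L x (J z) * g w (J y) - L x (J w) * g z (J y)) -
    (L y z * g w x + L y w * g z x - L y (J z) * g w (J x) - L y (J w) * g z (J x)) = 0

/-- The tensor `R(z, w)u` of a Kähler metric of constant holomorphic sectional curvature `-4B`
divided by `-B`. -/
def modelCurvature (g : V →L[ℝ] V →L[ℝ] ℝ) (J : V →L[ℝ] V) (z w u : V) : V :=
  g w u • z - g z u • w + g (J w) u • J z - g (J z) u • J w + (2 * g z (J w)) • J u

namespace PseudoHermitian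

variable {g : V →L[ℝ] V →L[ℝ] ℝ} {J : V →L[ℝ] V}

lemma apply_J_left (h : PseudoHermitian g J) (u v : V) : g (J u) v = -g u (J v) := by
  have := h.hermitian u (J v)
  rw [h.sq_eq_neg, map_neg] at this
  linarith

lemma apply_J_self (h : PseudoHermitian g J) (u : V) : g u (J u) = 0 := by
  have h1 := h.apply_J_left u u
  rw [h.symm (J u) u] at h1
  linarith

lemma exists_adaptedFrame (h : PseudoHermitian g J) (hV : Module.finrank ℝ V = 4) :
    ∃ e₁ e₂, AdaptedFrame g J e₁ e₂ := by
  have polar : ∀ u v : V, 2 * g u v = g (u + v) (u + v) - g u u - g v v := fun u v => by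
    simp only [map_add, add_apply, h.symm v u]; ring
  have : Nontrivial V := Module.nontrivial_of_finrank_pos (R := ℝ) (by omega)
  -- In arbitrary signature a non-null vector has to be found: if all vectors were null,
  -- polarization would give `g = 0`.
  obtain ⟨e₁, h₁⟩ : ∃ e₁, g e₁ e₁ ≠ 0 := by
    by_contra! hc
    obtain ⟨u, hu⟩ := exists_ne (0 : V)
    refine hu (h.nondegenerate u fun v => ?_)
    have := polar u v
    simp only [hc] at this
    linarith
  have hJ₁ : g (J e₁) (J e₁) = g e₁ e₁ := h.hermitian _ _
  have o1 : g e₁ (J e₁) = 0 := h.apply_J_self e₁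
  have o1' : g (J e₁) e₁ = 0 := by rw [h.symm, o1]
  -- projection to the orthogonal complement of `e₁, J e₁`
  let π : V → V := fun v => v - (g v e₁ / g e₁ e₁) • e₁ - (g v (J e₁) / g e₁ e₁) • J e₁
  have π₁ : ∀ v, g (π v) e₁ = 0 := fun v => by
    simp only [π, map_sub, map_smul, sub_apply, smul_apply,
      smul_eq_mul, o1']
    field_simp; ring
  have π₂ : ∀ v, g (π v) (J e₁) = 0 := fun v => by
    simp only [π, map_sub, map_smul, sub_apply, smul_apply,
      smul_eq_mul, o1, hJ₁]
    field_simp; ring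
  have hπ : ∀ u v, g u e₁ = 0 → g u (J e₁) = 0 → g u v = g u (π v) := fun u v a b => by
    simp only [π, map_sub, map_smul, smul_eq_mul, a, b]; ring
  -- If all projections were null, polarization and nondegeneracy would give `π = 0`, and the two
  -- vectors `e₁`, `J e₁` would span a space of dimension 4.
  obtain ⟨v₀, h₂⟩ : ∃ v, g (π v) (π v) ≠ 0 := by
    by_contra! hc
    have hadd : ∀ u v, π u + π v = π (u + v) := fun u v => by
      simp only [π, map_add, add_apply, add_div, add_smul]; abel
    have h0 : ∀ u, π u = 0 := fun u => h.nondegenerate _ fun v => by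
      rw [hπ _ v (π₁ u) (π₂ u)]
      have := polar (π u) (π v)
      rw [hadd, hc, hc, hc] at this
      linarith
    have hspan : (⊤ : Submodule ℝ V) ≤ Submodule.span ℝ (Set.range ![e₁, J e₁]) := by
      intro v _
      rw [Submodule.mem_span_range_iff_exists_fun]
      refine ⟨![g v e₁ / g e₁ e₁, g v (J e₁) / g e₁ e₁], ?_⟩
      have := h0 v
      simp only [π, sub_sub, sub_eq_zero] at this
      simpa [Fin.sum_univ_two] using this.symm
    have := finrank_range_le_card (R := ℝ) ![e₁, J e₁]
    rw [Set.finrank, top_le_iff.mp hspan, finrank_top, hV, Fintype.card_fin] at this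
    omega
  set e₂ := π v₀ with he₂
  have p1 : g e₂ e₁ = 0 := π₁ v₀
  have p2 : g e₂ (J e₁) = 0 := π₂ v₀
  have p3 : g (J e₂) e₁ = 0 := by rw [h.apply_J_left, p2, neg_zero]
  have p4 : g (J e₂) (J e₁) = 0 := by rw [h.hermitian, p1]
  have o2 : g e₂ (J e₂) = 0 := h.apply_J_self e₂
  have o2' : g (J e₂) e₂ = 0 := by rw [h.symm, o2]
  have hJ₂ : g (J e₂) (J e₂) = g e₂ e₂ := h.hermitian _ _
  have q1 : g e₁ e₂ = 0 := by rw [h.symm, p1]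
  have q2 : g (J e₁) e₂ = 0 := by rw [h.symm, p2]
  have q3 : g e₁ (J e₂) = 0 := by rw [h.symm, p3]
  have q4 : g (J e₁) (J e₂) = 0 := by rw [h.symm, p4]
  have hli : LinearIndependent ℝ ![e₁, J e₁, e₂, J e₂] := by
    rw [Fintype.linearIndependent_iff]
    intro c hc
    simp only [Fin.sum_univ_four, Matrix.cons_val] at hc
    have hg : ∀ v, g (c 0 • e₁ + c 1 • J e₁ + c 2 • e₂ + c 3 • J e₂) v = 0 := fun v => by
      rw [hc]; simp
    have k1 := hg e₁
    have k2 := hg (J e₁)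
    have k3 := hg e₂
    have k4 := hg (J e₂)
    simp only [map_add, map_smul, add_apply, smul_apply,
      smul_eq_mul, p1, p2, p3, p4, q1, q2, q3, q4, o1, o1', o2, o2', hJ₁, hJ₂, mul_zero, add_zero,
      zero_add, mul_eq_zero, h₁, h₂, or_false] at k1 k2 k3 k4
    intro i
    fin_cases i <;> assumption
  refine ⟨e₁, e₂, h₁, h₂, q1, q3, fun v => ?_⟩
  have hsp := hli.span_eq_top_of_card_eq_finrank (by simp [hV])
  have hv : v ∈ Submodule.span ℝ (Set.range ![e₁, J e₁, e₂, J e₂]) := hsp ▸ Submodule.mem_top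
  rw [Submodule.mem_span_range_iff_exists_fun] at hv
  obtain ⟨c, rfl⟩ := hv
  simp only [Fin.sum_univ_four, Matrix.cons_val, map_add, map_smul,
    add_apply, smul_apply,
    smul_eq_mul, p1, p2, p3, p4, q1, q2, q3, q4, o1, o1', o2, o2', hJ₁, hJ₂, mul_zero, add_zero,
    zero_add, mul_div_cancel_right₀ _ h₁, mul_div_cancel_right₀ _ h₂]
  abel

end PseudoHermitian

namespace AdaptedFrame

variable {g : V →L[ℝ] V →L[ℝ] ℝ} {J : V →L[ℝ] V} {e₁ e₂ : V}

/-- Invariance under `J` gives `b(Ju, v) = -b(u, Jv)` and `b(u, Ju) = 0`, so four real numbers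
determine a hermitian form in complex dimension two. Linearity in the second slot comes from the
symmetry. -/
lemma eq_zero_of_symm (F : AdaptedFrame g J e₁ e₂) (h : PseudoHermitian g J) {b : V → V → ℝ}
    (hadd : ∀ u u' v, b (u + u') v = b u v + b u' v)
    (hsmul : ∀ (c : ℝ) u v, b (c • u) v = c * b u v)
    (hs : ∀ u v, b u v = b v u) (hJ : ∀ u v, b (J u) (J v) = b u v)
    (h11 : b e₁ e₁ = 0) (h22 : b e₂ e₂ = 0) (h12 : b e₁ e₂ = 0) (h12' : b e₁ (J e₂) = 0)
    (u v : V) : b u v = 0 := by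
  have hJ' : ∀ u v, b (J u) v = -b u (J v) := fun u v => by
    have := hJ u (J v)
    rw [h.sq_eq_neg, hs, ← neg_one_smul ℝ v, hsmul, hs] at this
    linarith
  have hself : ∀ u, b u (J u) = 0 := fun u => by
    have := hJ' u u
    rw [hs] at this
    linarith
  have key : ∀ v, b e₁ v = 0 → b (J e₁) v = 0 → b e₂ v = 0 → b (J e₂) v = 0 → ∀ u, b u v = 0 := by
    intro v a1 a2 a3 a4 u
    rw [F.expand u]
    simp only [hadd, hsmul, a1, a2, a3, a4]
    ring
  have k1 : ∀ u, b u e₁ = 0 := key e₁ h11 (by rw [hs, hself]) (by rw [hs, h12])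
    (by rw [hs, h12'])
  have k2 : ∀ u, b u e₂ = 0 := key e₂ h12 (by rw [hJ', h12', neg_zero]) h22 (by rw [hs, hself])
  have k3 : ∀ u, b u (J e₁) = 0 := fun u => by
    have := hJ' u e₁
    rw [k1] at this
    linarith
  have k4 : ∀ u, b u (J e₂) = 0 := fun u => by
    have := hJ' u e₂
    rw [k2] at this
    linarith
  refine key v ?_ ?_ ?_ ?_ u
  · rw [hs, k1]
  · rw [hs, k3]
  · rw [hs, k2]
  · rw [hs, k4]

/-- `b(·, J·)` is symmetric and hermitian, which reduces this to the symmetric case. -/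
lemma eq_zero_of_skew (F : AdaptedFrame g J e₁ e₂) (h : PseudoHermitian g J) {b : V → V → ℝ}
    (hadd : ∀ u u' v, b (u + u') v = b u v + b u' v)
    (hsmul : ∀ (c : ℝ) u v, b (c • u) v = c * b u v)
    (hs : ∀ u v, b u v = -b v u) (hJ : ∀ u v, b (J u) (J v) = b u v)
    (h11 : b e₁ (J e₁) = 0) (h22 : b e₂ (J e₂) = 0) (h12 : b e₁ e₂ = 0) (h12' : b e₁ (J e₂) = 0)
    (u v : V) : b u v = 0 := by
  have hneg : ∀ u v, b u (-v) = -b u v := fun u v => by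
    rw [hs, ← neg_one_smul ℝ v, hsmul, hs v u]; ring
  have key : ∀ u v, b u (J v) = 0 := F.eq_zero_of_symm h (b := fun u v => b u (J v))
    (fun _ _ _ => hadd _ _ _) (fun _ _ _ => hsmul _ _ _)
    (fun u v => by
      have := hJ u (J v)
      rw [h.sq_eq_neg, hneg, hs] at this
      linarith)
    (fun u v => hJ u (J v)) h11 h22 h12' (by rw [h.sq_eq_neg, hneg, h12, neg_zero])
  have := key u (-J v)
  rwa [map_neg, h.sq_eq_neg, neg_neg] at this

end AdaptedFrame

end Pointwise

/-! ### Symmetries of the curvature; the Hessian is hermitian -/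

section Pointwise

variable {V : Type*} [NormedAddCommGroup V] [NormedSpace ℝ V]
variable {g : V →L[ℝ] V →L[ℝ] ℝ} {J : V →L[ℝ] V} {e₁ e₂ : V}
  {R : V →L[ℝ] V →L[ℝ] V →L[ℝ] V} {a L : V →L[ℝ] V →L[ℝ] ℝ}

namespace CurvatureLike

/-- The classical octahedron argument: combine the four cyclic sums given by the Bianchi identity,
using skewness in each of the two pairs. -/
lemma pair_symm (hR : CurvatureLike g J R) (h : PseudoHermitian g J) (z w u v : V) :
    g (R z w u) v = g (R u v z) w := by
  have s : ∀ z w u v, g (R z w u) v = -g (R w z u) v := fun z w u v => by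
    rw [hR.skew]; simp
  have t : ∀ z w u v, g (R z w u) v = -g (R z w v) u := fun z w u v => by
    rw [hR.metric, h.symm]
  have b : ∀ z w u v, g (R z w u) v + g (R w u z) v + g (R u z w) v = 0 := fun z w u v => by
    have := congrArg (fun x => g x v) (hR.bianchi z w u)
    simpa using this
  linarith [b z w u v, b w u v z, b u v z w, b v z w u, t z w u v, t w u z v, t u z w v, t u v w z,
    t w v u z, t v u z w, s w u v z, s v w u z, t v z u w, s z u v w, t u z v w, s z v w u,
    t v w z u, s w z v u, s z w v u, t w z v u, s u v w z, s w u z v, s u z w v, s v z u w,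
    s z v u w, t z v u w, s v u z w]

/-- Commutation with `J` is invariance in the last pair of arguments; pair symmetry carries it over
to the first pair. -/
lemma J_invariant (hR : CurvatureLike g J R) (h : PseudoHermitian g J) (z w u : V) :
    R (J z) (J w) u = R z w u := by
  rw [← sub_eq_zero]
  refine h.nondegenerate _ fun v => ?_
  rw [map_sub, sub_apply, hR.pair_symm h, hR.pair_symm h z, hR.commute, h.hermitian, sub_self]

end CurvatureLike

namespace AdaptedFrame

lemma orth_symm (F : AdaptedFrame g J e₁ e₂) (h : PseudoHermitian g J) : g e₂ e₁ = 0 := by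
  rw [h.symm, F.orth]

lemma orth_J (F : AdaptedFrame g J e₁ e₂) (h : PseudoHermitian g J) : g e₂ (J e₁) = 0 := by
  rw [h.symm, h.apply_J_left, F.orth', neg_zero]

end AdaptedFrame

namespace Integrability

/-- Since `R(Jx, Jy) = R(x, y)`, subtracting the Ricci identities at `(Jx, Jy)` and `(x, y)` removes
the curvature. What remains is a linear system for the anti-hermitian part `M` of `L`, which has
only the zero solution. -/
lemma hessian_hermitian (hI : Integrability g J R a L) (hR : CurvatureLike g J R)
    (h : PseudoHermitian g J) (F : AdaptedFrame g J e₁ e₂) (u v : V) :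
    L (J u) (J v) = L u v := by
  obtain ⟨M, hMdef⟩ : ∃ M : V → V → ℝ, ∀ u v, M u v = L u v - L (J u) (J v) :=
    ⟨_, fun _ _ => rfl⟩
  have hMJ : ∀ u v, M (J u) (J v) = -M u v := fun u v => by
    rw [hMdef, hMdef, h.sq_eq_neg, h.sq_eq_neg]; simp
  have hMl : ∀ u v, M (J u) v = M u (J v) := fun u v => by
    rw [hMdef, hMdef, h.sq_eq_neg, h.sq_eq_neg]; simp; ring
  have hM : ∀ x y z w, M x z * g w y + M x w * g z y - M x (J z) * g w (J y)
      - M x (J w) * g z (J y) - (M y z * g w x + M y w * g z x - M y (J z) * g w (J x)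
      - M y (J w) * g z (J x)) = 0 := fun x y z w => by
    have r1 := hI.ricci x y z w
    have r2 := hI.ricci (J x) (J y) z w
    rw [hR.J_invariant h, hR.J_invariant h] at r2
    simp only [h.sq_eq_neg, map_neg] at r2
    simp only [hMdef, h.sq_eq_neg, map_neg]
    linear_combination r1 - r2
  have o1 := F.orth_symm h
  have o2 := F.orth_J h
  -- Replacing `e₂` by `J e₂` changes the sign of the `e₂` term, because `M` is anti-hermitian. Each
  -- pair of equations thus separates into its two unknowns.
  have A1 := hM e₁ e₂ e₁ e₂
  have A2 := hM e₁ (J e₂) e₁ (J e₂)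
  have A3 := hM e₁ e₂ (J e₁) e₂
  have A4 := hM e₁ (J e₂) (J e₁) (J e₂)
  have hneg : ∀ u v, M u (-v) = -M u v := fun u v => by simp [hMdef]; ring
  simp only [h.apply_J_left, h.sq_eq_neg, map_neg, F.orth, F.orth', o1, o2, h.apply_J_self, hMl,
    neg_zero, mul_zero, hneg] at A1 A2 A3 A4
  have B1 : M e₁ e₁ = 0 := by
    have : M e₁ e₁ * g e₂ e₂ = 0 := by linarith
    simpa [F.ne₂] using this
  have B2 : M e₂ e₂ = 0 := by
    have : M e₂ e₂ * g e₁ e₁ = 0 := by linarith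
    simpa [F.ne₁] using this
  have B3 : M e₁ (J e₁) = 0 := by
    have : M e₁ (J e₁) * g e₂ e₂ = 0 := by linarith
    simpa [F.ne₂] using this
  have B4 : M e₂ (J e₂) = 0 := by
    have : M e₂ (J e₂) * g e₁ e₁ = 0 := by linarith
    simpa [F.ne₁] using this
  -- Once `M e e` and `M e (J e)` vanish, the instance `hM x e e e` kills the whole columns of `e`
  -- and `J e`.
  have C : ∀ e, g e e ≠ 0 → M e e = 0 → M e (J e) = 0 → ∀ x, M x e = 0 ∧ M x (J e) = 0 := by
    intro e he h1 h2
    have k : ∀ x, M x e = 0 := fun x => by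
      have := hM x e e e
      simp only [h1, h2, h.apply_J_self] at this
      have : M x e * g e e = 0 := by linarith
      simpa [he] using this
    exact fun x => ⟨k x, by rw [← hMl, k]⟩
  have hadd : ∀ u v v', M u (v + v') = M u v + M u v' := fun u v v' => by simp [hMdef]; ring
  have hsmul : ∀ (c : ℝ) u v, M u (c • v) = c * M u v := fun c u v => by simp [hMdef]; ring
  have : M u v = 0 := by
    rw [F.expand v]
    simp only [hadd, hsmul, (C e₁ F.ne₁ B1 B3 u).1, (C e₁ F.ne₁ B1 B3 u).2,
      (C e₂ F.ne₂ B2 B4 u).1, (C e₂ F.ne₂ B2 B4 u).2]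
    ring
  rw [hMdef] at this
  linarith

end Integrability

end Pointwise

/-! ### The integrability condition in an adapted frame -/

section Pointwise

variable {V : Type*} [NormedAddCommGroup V] [NormedSpace ℝ V]
variable {g : V →L[ℝ] V →L[ℝ] ℝ} {J : V →L[ℝ] V} {e₁ e₂ : V}
  {R : V →L[ℝ] V →L[ℝ] V →L[ℝ] V} {a L : V →L[ℝ] V →L[ℝ] ℝ}

namespace AdaptedFrame

section Action

variable (F : AdaptedFrame g J e₁ e₂) (h : PseudoHermitian g J) {P : V →L[ℝ] V}
  (hP : ∀ u v, g (P u) v = -g u (P v)) (hPJ : ∀ u, P (J u) = J (P u))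
  (hs : ∀ u v, a u v = a v u) (hJ : ∀ u v, a (J u) (J v) = a u v)

include F h hP hPJ hs hJ

/-- The derivation by a skew complex-linear `P` of a symmetric hermitian form `a`, in components
with respect to an adapted frame. -/
lemma derivation_components :
    a (P e₁) e₁ * g e₂ e₂ = g (P e₁) e₂ * a e₁ e₂ + g (P e₁) (J e₂) * a e₁ (J e₂) ∧
    a (P e₂) e₂ * g e₁ e₁ = -(g (P e₁) e₂ * a e₁ e₂ + g (P e₁) (J e₂) * a e₁ (J e₂)) ∧
    a (P e₁) e₂ + a e₁ (P e₂) =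
      -(a e₁ (J e₂) * (g (P e₁) (J e₁) / g e₁ e₁ - g (P e₂) (J e₂) / g e₂ e₂) +
        g (P e₁) e₂ * (a e₁ e₁ / g e₁ e₁ - a e₂ e₂ / g e₂ e₂)) ∧
    a (P e₁) (J e₂) + a e₁ (P (J e₂)) =
      -(g (P e₁) (J e₂) * (a e₁ e₁ / g e₁ e₁ - a e₂ e₂ / g e₂ e₂) -
        a e₁ e₂ * (g (P e₁) (J e₁) / g e₁ e₁ - g (P e₂) (J e₂) / g e₂ e₂)) := by
  have ha : ∀ u v, a (J u) v = -a u (J v) := fun u v => by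
    have := hJ u (J v)
    rw [h.sq_eq_neg, map_neg] at this
    linarith
  have haJ : ∀ u, a u (J u) = 0 := fun u => by
    have := ha u u
    rw [hs] at this
    linarith
  have n1 := F.ne₁
  have n2 := F.ne₂
  have p1 : g (P e₁) e₁ = 0 := by
    have := hP e₁ e₁
    rw [h.symm e₁] at this
    linarith
  have p2 : g (P e₂) e₂ = 0 := by
    have := hP e₂ e₂
    rw [h.symm e₂] at this
    linarith
  have p3 : g (P e₂) e₁ = -g (P e₁) e₂ := by rw [hP, h.symm]
  have p4 : g (P e₂) (J e₁) = g (P e₁) (J e₂) := by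
    rw [hP, hPJ, h.symm, h.apply_J_left, neg_neg]
  have f1 : P e₁ = (g (P e₁) (J e₁) / g e₁ e₁) • J e₁ +
      ((g (P e₁) e₂ / g e₂ e₂) • e₂ + (g (P e₁) (J e₂) / g e₂ e₂) • J e₂) := by
    conv_lhs => rw [F.expand (P e₁), p1]
    simp
  have f2 : P e₂ = (-g (P e₁) e₂ / g e₁ e₁) • e₁ + (g (P e₁) (J e₂) / g e₁ e₁) • J e₁ +
      (g (P e₂) (J e₂) / g e₂ e₂) • J e₂ := by
    conv_lhs => rw [F.expand (P e₂), p2, p3, p4]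
    simp
  obtain ⟨A, hA⟩ : ∃ A, A = g (P e₁) (J e₁) := ⟨_, rfl⟩
  obtain ⟨B, hB⟩ : ∃ B, B = g (P e₁) e₂ := ⟨_, rfl⟩
  obtain ⟨C, hC⟩ : ∃ C, C = g (P e₁) (J e₂) := ⟨_, rfl⟩
  obtain ⟨D, hD⟩ : ∃ D, D = g (P e₂) (J e₂) := ⟨_, rfl⟩
  rw [← hA, ← hB, ← hC] at f1
  rw [← hB, ← hC, ← hD] at f2
  rw [← hA, ← hB, ← hC, ← hD, hPJ, f1, f2]
  have s21 : a e₂ e₁ = a e₁ e₂ := hs _ _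
  have s21' : a e₂ (J e₁) = -a e₁ (J e₂) := by rw [hs, ha]
  simp only [map_add, map_smul, add_apply, smul_apply, smul_eq_mul, ha, haJ, h.sq_eq_neg, s21,
    s21', map_neg]
  refine ⟨?_, ?_, ?_, ?_⟩ <;> field_simp <;> ring

end Action

end AdaptedFrame

/-- The six equations for the components of a curvature tensor that a solution gives. -/
lemma Integrability.components (hI : Integrability g J R a L) (hR : CurvatureLike g J R)
    (h : PseudoHermitian g J) (F : AdaptedFrame g J e₁ e₂) (x y : V) :
    2 * (g (R x y e₁) e₂ * a e₁ e₂ + g (R x y e₁) (J e₂) * a e₁ (J e₂)) / g e₂ e₂ +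
      2 * (L x e₁ * g e₁ y - L x (J e₁) * g e₁ (J y) -
        (L y e₁ * g e₁ x - L y (J e₁) * g e₁ (J x))) = 0 ∧
    -2 * (g (R x y e₁) e₂ * a e₁ e₂ + g (R x y e₁) (J e₂) * a e₁ (J e₂)) / g e₁ e₁ +
      2 * (L x e₂ * g e₂ y - L x (J e₂) * g e₂ (J y) -
        (L y e₂ * g e₂ x - L y (J e₂) * g e₂ (J x))) = 0 ∧
    -(a e₁ (J e₂) * (g (R x y e₁) (J e₁) / g e₁ e₁ - g (R x y e₂) (J e₂) / g e₂ e₂) +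
        g (R x y e₁) e₂ * (a e₁ e₁ / g e₁ e₁ - a e₂ e₂ / g e₂ e₂)) +
      (L x e₁ * g e₂ y + L x e₂ * g e₁ y - L x (J e₁) * g e₂ (J y) - L x (J e₂) * g e₁ (J y)) -
      (L y e₁ * g e₂ x + L y e₂ * g e₁ x - L y (J e₁) * g e₂ (J x) - L y (J e₂) * g e₁ (J x)) = 0 ∧
    -(g (R x y e₁) (J e₂) * (a e₁ e₁ / g e₁ e₁ - a e₂ e₂ / g e₂ e₂) -
        a e₁ e₂ * (g (R x y e₁) (J e₁) / g e₁ e₁ - g (R x y e₂) (J e₂) / g e₂ e₂)) +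
      (L x e₁ * g (J e₂) y + L x (J e₂) * g e₁ y - L x (J e₁) * g e₂ y + L x e₂ * g e₁ (J y)) -
      (L y e₁ * g (J e₂) x + L y (J e₂) * g e₁ x - L y (J e₁) * g e₂ x + L y e₂ * g e₁ (J x))
      = 0 := by
  obtain ⟨d1, d2, d3, d4⟩ := F.derivation_components h (hR.metric x y) (hR.commute x y)
    hI.symm hI.hermitian
  have r1 := hI.ricci x y e₁ e₁
  have r2 := hI.ricci x y e₂ e₂
  have r3 := hI.ricci x y e₁ e₂
  have r4 := hI.ricci x y e₁ (J e₂)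
  rw [hI.symm e₁ (R x y e₁)] at r1
  rw [hI.symm e₂ (R x y e₂)] at r2
  simp only [h.hermitian, h.sq_eq_neg, map_neg] at r4
  rw [d3] at r3
  rw [d4] at r4
  rw [← eq_div_iff F.ne₂] at d1
  rw [← eq_div_iff F.ne₁] at d2
  rw [d1] at r1
  rw [d2] at r2
  refine ⟨?_, ?_, ?_, ?_⟩
  · linear_combination r1
  · linear_combination r2
  · linear_combination r3
  · linear_combination r4

/-- A skew endomorphism acts trivially on the trace, so the `g`-trace of the Ricci identity contains
no curvature. It is an equation for the skew part of `L` alone. -/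
lemma Integrability.hessian_symm (hI : Integrability g J R a L) (hR : CurvatureLike g J R)
    (h : PseudoHermitian g J) (F : AdaptedFrame g J e₁ e₂) (u v : V) : L u v = L v u := by
  have hL := hI.hessian_hermitian hR h F
  have hL' : ∀ u v, L (J u) v = -L u (J v) := fun u v => by
    have := hL u (J v)
    rw [h.sq_eq_neg, map_neg] at this
    linarith
  have o1 := F.orth_symm h
  have o2 := F.orth_J h
  -- The trace of the Ricci identity over the frame, with the denominators `g e₁ e₁` and `g e₂ e₂`
  -- cleared.
  have tr : ∀ x y, (L x e₁ * g e₁ y - L x (J e₁) * g e₁ (J y) -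
        (L y e₁ * g e₁ x - L y (J e₁) * g e₁ (J x))) * g e₂ e₂ +
      (L x e₂ * g e₂ y - L x (J e₂) * g e₂ (J y) -
        (L y e₂ * g e₂ x - L y (J e₂) * g e₂ (J x))) * g e₁ e₁ = 0 := fun x y => by
    obtain ⟨c1, c2, -, -⟩ := hI.components hR h F x y
    have n1 := F.ne₁
    have n2 := F.ne₂
    field_simp at c1 c2
    linear_combination c1 / 2 + c2 / 2
  have t1 := tr e₁ (J e₁)
  have t2 := tr e₂ (J e₂)
  have t3 := tr e₁ e₂
  have t4 := tr e₁ (J e₂)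
  simp only [hL', h.sq_eq_neg, map_neg, F.orth, F.orth', o1, o2, h.apply_J_self,
    neg_zero, mul_zero] at t1 t2 t3 t4
  have n : ∀ {t : ℝ}, t * (g e₁ e₁ * g e₂ e₂) = 0 → t = 0 := fun {t} ht => by
    simpa [F.ne₁, F.ne₂] using ht
  have := F.eq_zero_of_skew h (b := fun u v => L u v - L v u) (by intros; simp; ring)
    (by intros; simp; ring) (by intros; ring) (by intro u v; simp only [hL])
    (by apply n; simp only [hL']; linear_combination t1)
    (by apply n; simp only [hL']; linear_combination t2)
    (by apply n; linear_combination t3)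
    (by apply n; simp only [hL']; linear_combination t4) u v
  linarith

end Pointwise

/-! ### Trace-free hermitian forms as vectors in three-space -/

section Pointwise

variable {V : Type*} [NormedAddCommGroup V] [NormedSpace ℝ V]
variable {g : V →L[ℝ] V →L[ℝ] ℝ} {J : V →L[ℝ] V} {e₁ e₂ : V}
  {R : V →L[ℝ] V →L[ℝ] V →L[ℝ] V} {a L a' L' : V →L[ℝ] V →L[ℝ] ℝ}

lemma linearIndependent_triple_iff {W : Type*} [AddCommGroup W] [Module ℝ W] {x y z : W} :
    LinearIndependent ℝ ![x, y, z] ↔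
      ∀ c₀ c₁ c₂ : ℝ, c₀ • x + c₁ • y + c₂ • z = 0 → c₀ = 0 ∧ c₁ = 0 ∧ c₂ = 0 := by
  rw [Fintype.linearIndependent_iff]
  constructor
  · intro h c₀ c₁ c₂ hc
    have := h ![c₀, c₁, c₂] (by simpa [Fin.sum_univ_three] using hc)
    exact ⟨by simpa using this 0, by simpa using this 1, by simpa using this 2⟩
  · intro h c hc
    obtain ⟨h0, h1, h2⟩ := h (c 0) (c 1) (c 2) (by simpa [Fin.sum_univ_three] using hc)
    intro i
    fin_cases i <;> assumption

/-- The equations say that `(d, w, -z)` has zero cross product with `(u, r, s)` and with `(u', r',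
s')`. By `hm` these two vectors are independent, so no nonzero vector is parallel to both. -/
lemma eq_zero_of_cross_eq_zero {u r s u' r' s' z w d : ℝ}
    (hm : ¬(u * r' - u' * r = 0 ∧ u * s' - u' * s = 0 ∧ r * s' - r' * s = 0))
    (h1 : z * r + w * s = 0) (h2 : s * d + z * u = 0) (h3 : w * u - r * d = 0)
    (h1' : z * r' + w * s' = 0) (h2' : s' * d + z * u' = 0) (h3' : w * u' - r' * d = 0) :
    z = 0 ∧ w = 0 ∧ d = 0 := by
  have k : ∀ {m t : ℝ}, m ≠ 0 → t * m = 0 → t = 0 := fun hm ht =>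
    (mul_eq_zero.mp ht).resolve_right hm
  by_cases m1 : u * r' - u' * r = 0
  · by_cases m2 : u * s' - u' * s = 0
    · have m3 : r * s' - r' * s ≠ 0 := fun m3 => hm ⟨m1, m2, m3⟩
      have hz : z = 0 := k m3 (by linear_combination s' * h1 - s * h1')
      have hw : w = 0 := k m3 (by linear_combination r * h1' - r' * h1)
      refine ⟨hz, hw, k m3 ?_⟩
      subst hz hw
      linear_combination r * h2' - r' * h2
    · have hz : z = 0 := k m2 (by linear_combination s' * h2 - s * h2')
      have hd : d = 0 := k m2 (by linear_combination u * h2' - u' * h2)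
      refine ⟨hz, k m2 ?_, hd⟩
      subst hz hd
      linear_combination u * h1' - u' * h1
  · have hw : w = 0 := k m1 (by linear_combination r' * h3 - r * h3')
    have hd : d = 0 := k m1 (by linear_combination u' * h3 - u * h3')
    refine ⟨k m1 ?_, hw, hd⟩
    subst hw hd
    linear_combination u * h1' - u' * h1

/-- A symmetric `3 × 3` matrix which commutes with two independent rotations is scalar. -/
lemma scalar_of_commuting_rotations {u r s u' r' s' z w c A D : ℝ}
    (hm : ¬(u * r' - u' * r = 0 ∧ u * s' - u' * s = 0 ∧ r * s' - r' * s = 0)) {ε : ℝ}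
    (h2 : c * u - r * z = 0) (h3 : s * w + c * u = 0) (h4 : A * u + s * z + r * w = 0)
    (h5 : s * (D + 4 * A) + ε * z * u - 4 * c * r = 0) (h6 : r * D - ε * w * u - 4 * c * s = 0)
    (h2' : c * u' - r' * z = 0) (h3' : s' * w + c * u' = 0) (h4' : A * u' + s' * z + r' * w = 0)
    (h5' : s' * (D + 4 * A) + ε * z * u' - 4 * c * r' = 0)
    (h6' : r' * D - ε * w * u' - 4 * c * s' = 0) :
    z = 0 ∧ w = 0 ∧ c = 0 ∧ A = 0 ∧ D = 0 := by
  have k : ∀ {m t : ℝ}, m ≠ 0 → t * m = 0 → t = 0 := fun hm ht =>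
    (mul_eq_zero.mp ht).resolve_right hm
  by_cases m1 : u * r' - u' * r = 0
  · by_cases m2 : u * s' - u' * s = 0
    · have m3 : r * s' - r' * s ≠ 0 := fun m3 => hm ⟨m1, m2, m3⟩
      have hz : z = 0 := k m3 (by linear_combination s' * (h3 - h2) - s * (h3' - h2'))
      have hw : w = 0 := k m3 (by linear_combination r * (h3' - h2') - r' * (h3 - h2))
      subst hz hw
      have hc : c = 0 := by
        have : c * 4 = 0 := k m3 (by linear_combination r' * h6 - r * h6')
        linarith
      subst hc
      have hD : D = 0 := k m3 (by linear_combination s' * h6 - s * h6')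
      subst hD
      have hA : 4 * A = 0 := k m3 (by linear_combination r * h5' - r' * h5)
      exact ⟨rfl, rfl, rfl, by linarith, rfl⟩
    · have hc : c = 0 := k m2 (by linear_combination s' * h3 - s * h3')
      have hw : w = 0 := k m2 (by linear_combination u * h3' - u' * h3)
      subst hc hw
      have hA : A = 0 := k m2 (by linear_combination s' * h4 - s * h4')
      have hz : z = 0 := k m2 (by linear_combination u * h4' - u' * h4)
      subst hA hz
      exact ⟨rfl, rfl, rfl, rfl, k m2 (by linear_combination u * h5' - u' * h5)⟩
  · have hc : c = 0 := k m1 (by linear_combination r' * h2 - r * h2')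
    have hz : z = 0 := k m1 (by linear_combination u' * h2 - u * h2')
    subst hc hz
    have hA : A = 0 := k m1 (by linear_combination r' * h4 - r * h4')
    have hw : w = 0 := k m1 (by linear_combination u * h4' - u' * h4)
    subst hA hw
    exact ⟨rfl, rfl, rfl, rfl, k m1 (by linear_combination u * h6' - u' * h6)⟩

namespace AdaptedFrame

/-- The three numbers assumed to vanish are coordinates on the hermitian forms modulo `g`; the
fourth component of `a` is absorbed by the factor of `g`. -/
lemma eq_smul_metric (F : AdaptedFrame g J e₁ e₂) (h : PseudoHermitian g J)
    (hs : ∀ u v, a u v = a v u) (hJ : ∀ u v, a (J u) (J v) = a u v)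
    (h0 : a e₁ e₁ / g e₁ e₁ - a e₂ e₂ / g e₂ e₂ = 0) (h12 : a e₁ e₂ = 0)
    (h12' : a e₁ (J e₂) = 0) : a = (a e₁ e₁ / g e₁ e₁) • g := by
  have n1 := F.ne₁
  have n2 := F.ne₂
  ext u v
  have := F.eq_zero_of_symm h (b := fun u v => a u v - a e₁ e₁ / g e₁ e₁ * g u v)
    (by intros; simp; ring) (by intros; simp; ring)
    (by intro u v; simp only [hs u v, h.symm u v]) (by intro u v; simp only [hJ, h.hermitian])
    (by field_simp; ring) (by field_simp at h0 ⊢; linear_combination -h0)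
    (by simp [h12, F.orth]) (by simp [h12', F.orth']) u v
  simp only [smul_apply, smul_eq_mul]
  linarith

lemma components_ne_zero (F : AdaptedFrame g J e₁ e₂) (h : PseudoHermitian g J)
    (hs : ∀ u v, a u v = a v u) (hJ : ∀ u v, a (J u) (J v) = a u v) (ha : ∀ c : ℝ, a ≠ c • g) :
    ¬(a e₁ e₁ / g e₁ e₁ - a e₂ e₂ / g e₂ e₂ = 0 ∧ a e₁ e₂ = 0 ∧ a e₁ (J e₂) = 0) :=
  fun ⟨h0, h1, h2⟩ => ha _ (F.eq_smul_metric h hs hJ h0 h1 h2)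

/-- Independence of `g, a, a'` means that the coordinate vectors of `a` and `a'` modulo `g` are
independent in `ℝ³`. This is recorded through 2 × 2 minors, the form in which linear systems are
solved below. -/
lemma minors_ne_zero (F : AdaptedFrame g J e₁ e₂) (h : PseudoHermitian g J)
    (hs : ∀ u v, a u v = a v u) (hJ : ∀ u v, a (J u) (J v) = a u v)
    (hs' : ∀ u v, a' u v = a' v u) (hJ' : ∀ u v, a' (J u) (J v) = a' u v)
    (hli : LinearIndependent ℝ ![g, a, a']) {u r s u' r' s' : ℝ}
    (hu : u = a e₁ e₁ / g e₁ e₁ - a e₂ e₂ / g e₂ e₂) (hr : r = a e₁ e₂) (hs1 : s = a e₁ (J e₂))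
    (hu' : u' = a' e₁ e₁ / g e₁ e₁ - a' e₂ e₂ / g e₂ e₂) (hr' : r' = a' e₁ e₂)
    (hs1' : s' = a' e₁ (J e₂)) :
    ¬(u * r' - u' * r = 0 ∧ u * s' - u' * s = 0 ∧ r * s' - r' * s = 0) := by
  rintro ⟨m1, m2, m3⟩
  have key : ∀ c c' : ℝ, c * u + c' * u' = 0 → c * r + c' * r' = 0 → c * s + c' * s' = 0 →
      c = 0 ∧ c' = 0 := by
    intro c c' k1 k2 k3
    have := F.eq_smul_metric (a := c • a + c' • a') h (by intro u v; simp [hs u v, hs' u v])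
      (by intro u v; simp [hJ u v, hJ' u v])
      (by simp only [add_apply, smul_apply, smul_eq_mul]; rw [hu, hu'] at k1; linear_combination k1)
      (by simp only [add_apply, smul_apply, smul_eq_mul]; rw [← hr, ← hr', k2])
      (by simp only [add_apply, smul_apply, smul_eq_mul]; rw [← hs1, ← hs1', k3])
    obtain ⟨κ, hκ⟩ : ∃ κ : ℝ, c • a + c' • a' = κ • g := ⟨_, this⟩
    have h3 := (linearIndependent_triple_iff (W := V →L[ℝ] V →L[ℝ] ℝ)).mp hli (-κ) c c'
    refine (h3 ?_).2
    ext u v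
    have := congrArg (fun b => b u v) hκ
    simp only [add_apply, smul_apply, smul_eq_mul] at this ⊢
    simp only [zero_apply]
    linarith
  -- When all minors vanish, a nonzero coordinate of `a` yields a relation, with the coordinates of
  -- `a'` and `a` in the same place as coefficients. If all coordinates of `a` vanish, `a` itself is
  -- the relation.
  by_cases h1 : u = 0
  · by_cases h2 : r = 0
    · by_cases h3 : s = 0
      · have := key 1 0 (by simp [h1]) (by simp [h2]) (by simp [h3])
        simp at this
      · have := key s' (-s) (by linear_combination m2) (by linear_combination m3) (by ring)
        exact h3 (by linarith [this.2])
    · have := key r' (-r) (by linear_combination m1) (by ring) (by linear_combination -m3)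
      exact h2 (by linarith [this.2])
  · have := key u' (-u) (by ring) (by linear_combination -m1) (by linear_combination -m2)
    exact h1 (by linarith [this.2])

end AdaptedFrame

end Pointwise

/-! ### Two independent solutions determine the curvature at a point -/

section Pointwise

variable {V : Type*} [NormedAddCommGroup V] [NormedSpace ℝ V]
variable {g : V →L[ℝ] V →L[ℝ] ℝ} {J : V →L[ℝ] V} {e₁ e₂ : V}
  {R : V →L[ℝ] V →L[ℝ] V →L[ℝ] V} {a L a' L' : V →L[ℝ] V →L[ℝ] ℝ}

/-- The components of a curvature tensor in an adapted frame `e₁, e₂`, normalised so that the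
components of a tensor of constant holomorphic sectional curvature `-4B` are multiples of `B`. -/
lemma Integrability.frame_equations (hI : Integrability g J R a L) (hR : CurvatureLike g J R)
    (h : PseudoHermitian g J) (F : AdaptedFrame g J e₁ e₂)
    {g₁ g₂ u r s S T U xα xβ yα yβ zα zβ zγ wα wβ wγ wδ : ℝ}
    (hg₁ : g₁ = g e₁ e₁) (hg₂ : g₂ = g e₂ e₂)
    (hu : u = a e₁ e₁ / g₁ - a e₂ e₂ / g₂) (hr : r = a e₁ e₂) (hs : s = a e₁ (J e₂))
    (hU : U = L e₁ e₁ / g₁ - L e₂ e₂ / g₂) (hT : T = L e₁ e₂) (hS : S = L e₁ (J e₂))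
    (hxα : xα = g (R e₁ (J e₁) e₁) (J e₁)) (hyα : yα = g (R e₁ (J e₁) e₂) (J e₂))
    (hzα : zα = g (R e₁ (J e₁) e₁) e₂) (hwα : wα = g (R e₁ (J e₁) e₁) (J e₂))
    (hxβ : xβ = g (R e₂ (J e₂) e₁) (J e₁)) (hyβ : yβ = g (R e₂ (J e₂) e₂) (J e₂))
    (hzβ : zβ = g (R e₂ (J e₂) e₁) e₂) (hwβ : wβ = g (R e₂ (J e₂) e₁) (J e₂))
    (hzγ : zγ = g (R e₁ e₂ e₁) e₂) (hwγ : wγ = g (R e₁ e₂ e₁) (J e₂))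
    (hwδ : wδ = g (R e₁ (J e₂) e₁) (J e₂)) :
    (zα * r + wα * s = 0 ∧ s * (xα / g₁ - yα / g₂) + zα * u = 2 * S * g₁ ∧
      wα * u - r * (xα / g₁ - yα / g₂) = -2 * T * g₁) ∧
    (zβ * r + wβ * s = 0 ∧ s * (xβ / g₁ - yβ / g₂) + zβ * u = -2 * S * g₂ ∧
      wβ * u - r * (xβ / g₁ - yβ / g₂) = 2 * T * g₂) ∧
    (zγ * r + wγ * s = T * (g₁ * g₂) ∧ s * (zα / g₁ - zβ / g₂) + zγ * u = U * (g₁ * g₂) ∧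
      wγ * u - r * (zα / g₁ - zβ / g₂) = 0) ∧
    (wγ * r + wδ * s = S * (g₁ * g₂) ∧ s * (wα / g₁ - wβ / g₂) + wγ * u = 0 ∧
      wδ * u - r * (wα / g₁ - wβ / g₂) = U * (g₁ * g₂)) := by
  have hL := hI.hessian_hermitian hR h F
  have hLs := hI.hessian_symm hR h F
  have hL' : ∀ u v, L (J u) v = -L u (J v) := fun u v => by
    have := hL u (J v)
    rw [h.sq_eq_neg, map_neg] at this
    linarith
  have hLJ : ∀ u, L u (J u) = 0 := fun u => by
    have := hL' u u
    rw [hLs] at this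
    linarith
  have o1 := F.orth_symm h
  have o2 := F.orth_J h
  have s1 : L e₂ e₁ = L e₁ e₂ := hLs _ _
  have s2 : L e₂ (J e₁) = -L e₁ (J e₂) := by rw [hLs, hL']
  have n1 : g₁ ≠ 0 := hg₁ ▸ F.ne₁
  have n2 : g₂ ≠ 0 := hg₂ ▸ F.ne₂
  obtain ⟨A1, -, A3, A4⟩ := hI.components hR h F e₁ (J e₁)
  obtain ⟨-, B1, B3, B4⟩ := hI.components hR h F e₂ (J e₂)
  obtain ⟨C1, -, C3, C4⟩ := hI.components hR h F e₁ e₂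
  obtain ⟨D1, -, D3, D4⟩ := hI.components hR h F e₁ (J e₂)
  rw [hR.pair_symm h e₁ e₂ e₁ (J e₁), hR.pair_symm h e₁ e₂ e₂ (J e₂)] at C3 C4
  rw [hR.pair_symm h e₁ (J e₂) e₁ (J e₁), hR.pair_symm h e₁ (J e₂) e₂ (J e₂)] at D3 D4
  rw [hR.pair_symm h e₁ (J e₂) e₁ e₂] at D1 D3
  simp only [hL', hLJ, h.apply_J_left, h.sq_eq_neg, map_neg, F.orth, F.orth', o1, o2,
    h.apply_J_self, neg_zero, mul_zero, s1, s2, neg_neg]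
    at A1 A3 A4 B1 B3 B4 C1 C3 C4 D1 D3 D4
  simp only [← hg₁, ← hg₂, ← hr, ← hs, ← hT, ← hS, ← hxα, ← hxβ, ← hyα, ← hyβ, ← hzα, ← hzβ,
    ← hzγ, ← hwα, ← hwβ, ← hwγ, ← hwδ, ← hu] at A1 A3 A4 B1 B3 B4 C1 C3 C4 D1 D3 D4
  have hU' : U * (g₁ * g₂) = L e₁ e₁ * g₂ - L e₂ e₂ * g₁ := by rw [hU]; field_simp
  rw [hU']
  refine ⟨⟨?_, ?_, ?_⟩, ⟨?_, ?_, ?_⟩, ⟨?_, ?_, ?_⟩, ?_, ?_, ?_⟩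
  · field_simp at A1; linear_combination A1 / 2
  · linear_combination -A3
  · linear_combination -A4
  · field_simp at B1; linear_combination -B1 / 2
  · linear_combination -B3
  · linear_combination -B4
  · field_simp at C1; linear_combination C1 / 2
  · linear_combination -C3
  · linear_combination -C4
  · field_simp at D1; linear_combination D1 / 2
  · linear_combination -D3
  · linear_combination -D4

/-- The indices α, β, γ, δ stand for the two-forms of the pairs `(e₁, Je₁)`, `(e₂, Je₂)`, `(e₁,
e₂)`, `(e₁, Je₂)`, and the letters x, y, z, w for the same pairs in the other two slots of the
curvature. Combinations of the equations that eliminate `S, T, U` leave conditions on the curvature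
alone, one set for each solution. -/
lemma scalar_curvature_components
    {g₁ g₂ xα yα yβ zα zβ zγ wα wβ wγ wδ u r s S T U u' r' s' S' T' U' : ℝ}
    (n1 : g₁ ≠ 0) (n2 : g₂ ≠ 0)
    (hm : ¬(u * r' - u' * r = 0 ∧ u * s' - u' * s = 0 ∧ r * s' - r' * s = 0))
    (hb : yα = zγ + wδ)
    (eqs : (zα * r + wα * s = 0 ∧ s * (xα / g₁ - yα / g₂) + zα * u = 2 * S * g₁ ∧
      wα * u - r * (xα / g₁ - yα / g₂) = -2 * T * g₁) ∧
    (zβ * r + wβ * s = 0 ∧ s * (yα / g₁ - yβ / g₂) + zβ * u = -2 * S * g₂ ∧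
      wβ * u - r * (yα / g₁ - yβ / g₂) = 2 * T * g₂) ∧
    (zγ * r + wγ * s = T * (g₁ * g₂) ∧ s * (zα / g₁ - zβ / g₂) + zγ * u = U * (g₁ * g₂) ∧
      wγ * u - r * (zα / g₁ - zβ / g₂) = 0) ∧
    (wγ * r + wδ * s = S * (g₁ * g₂) ∧ s * (wα / g₁ - wβ / g₂) + wγ * u = 0 ∧
      wδ * u - r * (wα / g₁ - wβ / g₂) = U * (g₁ * g₂)))
    (eqs' : (zα * r' + wα * s' = 0 ∧ s' * (xα / g₁ - yα / g₂) + zα * u' = 2 * S' * g₁ ∧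
      wα * u' - r' * (xα / g₁ - yα / g₂) = -2 * T' * g₁) ∧
    (zβ * r' + wβ * s' = 0 ∧ s' * (yα / g₁ - yβ / g₂) + zβ * u' = -2 * S' * g₂ ∧
      wβ * u' - r' * (yα / g₁ - yβ / g₂) = 2 * T' * g₂) ∧
    (zγ * r' + wγ * s' = T' * (g₁ * g₂) ∧ s' * (zα / g₁ - zβ / g₂) + zγ * u' = U' * (g₁ * g₂) ∧
      wγ * u' - r' * (zα / g₁ - zβ / g₂) = 0) ∧
    (wγ * r' + wδ * s' = S' * (g₁ * g₂) ∧ s' * (wα / g₁ - wβ / g₂) + wγ * u' = 0 ∧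
      wδ * u' - r' * (wα / g₁ - wβ / g₂) = U' * (g₁ * g₂))) :
    ∃ B, xα = 4 * B * g₁ ^ 2 ∧ yα = 2 * B * (g₁ * g₂) ∧ zα = 0 ∧ wα = 0 ∧ yβ = 4 * B * g₂ ^ 2 ∧
      zβ = 0 ∧ wβ = 0 ∧ zγ = B * (g₁ * g₂) ∧ wγ = 0 ∧ wδ = B * (g₁ * g₂) := by
  have div₁ : ∀ {t q : ℝ}, t = q * g₁ → t / g₁ = q := fun ht => by rw [ht]; field_simp
  have div₂ : ∀ {t q : ℝ}, t = q * g₂ → t / g₂ = q := fun ht => by rw [ht]; field_simp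
  obtain ⟨⟨A1, A2, A3⟩, ⟨B1, B2, B3⟩, ⟨C1, C2, C3⟩, D1, D2, D3⟩ := eqs
  obtain ⟨⟨A1', A2', A3'⟩, ⟨B1', B2', B3'⟩, ⟨C1', C2', C3'⟩, D1', D2', D3'⟩ := eqs'
  -- The combination `g₂ α + g₁ β` is the Kähler direction, in which the Hessian terms cancel. The
  -- block mixing trace and trace-free parts is therefore parallel to both solutions and vanishes.
  obtain ⟨p1, p2, p3⟩ := eq_zero_of_cross_eq_zero (z := g₂ * zα + g₁ * zβ)
    (w := g₂ * wα + g₁ * wβ) (d := g₂ * (xα / g₁ - yα / g₂) + g₁ * (yα / g₁ - yβ / g₂)) hm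
    (by linear_combination g₂ * A1 + g₁ * B1) (by linear_combination g₂ * A2 + g₁ * B2)
    (by linear_combination g₂ * A3 + g₁ * B3) (by linear_combination g₂ * A1' + g₁ * B1')
    (by linear_combination g₂ * A2' + g₁ * B2') (by linear_combination g₂ * A3' + g₁ * B3')
  -- The difference of α and β together with γ, δ are the trace-free directions. Eliminating `U`,
  -- `S` and `T` between equations that contain the same one of them says that the curvature block
  -- commutes with the rotation of the solution. The unknowns are its off-diagonal entries and the
  -- differences of its diagonal entries.
  obtain ⟨q1, q2, q3, q4, q5⟩ := scalar_of_commuting_rotations (z := zα / g₁ - zβ / g₂)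
    (w := wα / g₁ - wβ / g₂) (c := wγ) (A := zγ - wδ) (ε := g₁ * g₂)
    (D := g₁ * g₂ * ((xα / g₁ - yα / g₂) / g₁ - (yα / g₁ - yβ / g₂) / g₂) - 4 * zγ) hm
    (by linear_combination C3) (by linear_combination D2) (by linear_combination C2 - D3)
    (by linear_combination g₁ * g₂ * (div₁ A2 - div₂ B2) - 4 * D1)
    (by linear_combination -g₁ * g₂ * (div₁ A3 - div₂ B3) - 4 * C1)
    (by linear_combination C3') (by linear_combination D2') (by linear_combination C2' - D3')
    (by linear_combination g₁ * g₂ * (div₁ A2' - div₂ B2') - 4 * D1')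
    (by linear_combination -g₁ * g₂ * (div₁ A3' - div₂ B3') - 4 * C1')
  have hz : zα = 0 := by
    field_simp at q1
    have : zα * g₂ = 0 := by linear_combination p1 / 2 + q1 / 2
    simpa [n2] using this
  have hw : wα = 0 := by
    field_simp at q2
    have : wα * g₂ = 0 := by linear_combination p2 / 2 + q2 / 2
    simpa [n2] using this
  subst hz hw
  have hz : zβ = 0 := by simpa [n1] using p1
  have hw : wβ = 0 := by simpa [n1] using p2
  have hwδ : wδ = zγ := by linarith
  subst hz hw hwδ
  obtain ⟨X, rfl⟩ : ∃ X, xα = X * g₁ ^ 2 := ⟨xα / g₁ ^ 2, by field_simp⟩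
  obtain ⟨Y, rfl⟩ : ∃ Y, yβ = Y * g₂ ^ 2 := ⟨yβ / g₂ ^ 2, by field_simp⟩
  obtain ⟨B, rfl⟩ : ∃ B, wδ = B * (g₁ * g₂) := ⟨wδ / (g₁ * g₂), by field_simp⟩
  have hXY : X * (g₁ * g₂) = Y * (g₁ * g₂) := by
    field_simp at p3
    linear_combination p3
  obtain rfl : X = Y := mul_right_cancel₀ (mul_ne_zero n1 n2) hXY
  -- The Bianchi relation `hb` enters here: it ties the trace component to the scalar of the
  -- trace-free block.
  have hX : X * (g₁ * g₂) = 4 * B * (g₁ * g₂) := by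
    subst hb
    field_simp at q5
    linear_combination q5 / 2
  obtain rfl : X = 4 * B := mul_right_cancel₀ (mul_ne_zero n1 n2) hX
  exact ⟨B, rfl, by rw [hb]; ring, rfl, rfl, rfl, rfl, rfl, rfl, q3, rfl⟩

lemma modelCurvature_apply (z w u v : V) :
    g (modelCurvature g J z w u) v = g w u * g z v - g z u * g w v + g (J w) u * g (J z) v -
      g (J z) u * g (J w) v + 2 * g z (J w) * g (J u) v := by
  simp [modelCurvature]

/-- The difference from the model is skew and `J`-invariant in each pair of slots, so
`eq_zero_of_skew` applies once to each pair. The sixteen components left reduce to the ten given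
ones by pair symmetry. -/
lemma CurvatureLike.eq_model (hR : CurvatureLike g J R) (h : PseudoHermitian g J)
    (F : AdaptedFrame g J e₁ e₂) {B : ℝ}
    (hxα : g (R e₁ (J e₁) e₁) (J e₁) = 4 * B * g e₁ e₁ ^ 2)
    (hyα : g (R e₁ (J e₁) e₂) (J e₂) = 2 * B * (g e₁ e₁ * g e₂ e₂))
    (hzα : g (R e₁ (J e₁) e₁) e₂ = 0) (hwα : g (R e₁ (J e₁) e₁) (J e₂) = 0)
    (hyβ : g (R e₂ (J e₂) e₂) (J e₂) = 4 * B * g e₂ e₂ ^ 2)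
    (hzβ : g (R e₂ (J e₂) e₁) e₂ = 0) (hwβ : g (R e₂ (J e₂) e₁) (J e₂) = 0)
    (hzγ : g (R e₁ e₂ e₁) e₂ = B * (g e₁ e₁ * g e₂ e₂)) (hwγ : g (R e₁ e₂ e₁) (J e₂) = 0)
    (hwδ : g (R e₁ (J e₂) e₁) (J e₂) = B * (g e₁ e₁ * g e₂ e₂)) (x y u : V) :
    R x y u = -B • modelCurvature g J x y u := by
  have o1 := F.orth_symm h
  have o2 := F.orth_J h
  have hJs : ∀ u v, g (J u) v = -g (J v) u := fun u v => by
    rw [h.apply_J_left, h.symm u]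
  obtain ⟨D, hD⟩ : ∃ D : V → V → V → V → ℝ, ∀ x y u v,
    D x y u v = g (R x y u) v + B * g (modelCurvature g J x y u) v := ⟨_, fun _ _ _ _ => rfl⟩
  have inner : ∀ x y, D x y e₁ (J e₁) = 0 → D x y e₂ (J e₂) = 0 → D x y e₁ e₂ = 0 →
      D x y e₁ (J e₂) = 0 → ∀ u v, D x y u v = 0 := fun x y =>
    F.eq_zero_of_skew h (b := fun u v => D x y u v)
      (by intros; simp [hD, modelCurvature_apply]; ring)
      (by intros; simp [hD, modelCurvature_apply]; ring)
      (by intro u v; simp only [hD, modelCurvature_apply]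
          rw [hR.metric, h.symm u, hJs u v]; ring)
      (by intro u v; simp only [hD, modelCurvature_apply, hR.commute, h.hermitian,
            h.apply_J_left, h.sq_eq_neg, map_neg, neg_apply]; ring)
  have outer : ∀ u v, D e₁ (J e₁) u v = 0 → D e₂ (J e₂) u v = 0 → D e₁ e₂ u v = 0 →
      D e₁ (J e₂) u v = 0 → ∀ x y, D x y u v = 0 := fun u v =>
    F.eq_zero_of_skew h (b := fun x y => D x y u v)
      (by intros; simp [hD, modelCurvature_apply]; ring)
      (by intros; simp [hD, modelCurvature_apply]; ring)
      (by intro x y; simp only [hD, modelCurvature_apply]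
          rw [hR.skew, h.symm x (J y), hJs y x, h.symm (J x) y]; simp; ring)
      (by
        intro x y
        simp only [hD, modelCurvature_apply, hR.J_invariant h, h.apply_J_left, h.sq_eq_neg,
          map_neg, neg_apply]
        ring)
  have hzero : ∀ v, D x y u v = 0 := fun v => by
    refine outer u v (inner _ _ ?_ ?_ ?_ ?_ u v) (inner _ _ ?_ ?_ ?_ ?_ u v)
      (inner _ _ ?_ ?_ ?_ ?_ u v) (inner _ _ ?_ ?_ ?_ ?_ u v) x y
    all_goals
      rw [hD, modelCurvature_apply]
      try rw [hR.pair_symm h e₁ e₂ e₁ (J e₁)]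
      try rw [hR.pair_symm h e₁ e₂ e₂ (J e₂)]
      try rw [hR.pair_symm h e₁ (J e₂) e₁ (J e₁)]
      try rw [hR.pair_symm h e₁ (J e₂) e₂ (J e₂)]
      try rw [hR.pair_symm h e₁ (J e₂) e₁ e₂]
      try rw [hR.pair_symm h e₂ (J e₂) e₁ (J e₁)]
      simp only [h.apply_J_left, h.sq_eq_neg, map_neg, F.orth, F.orth', o1, o2,
        h.apply_J_self, neg_apply, hxα, hyα, hzα, hwα, hyβ, hzβ, hwβ, hzγ, hwγ, hwδ]
      ring
  rw [← sub_eq_zero]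
  refine h.nondegenerate _ fun v => ?_
  have := hzero v
  rw [hD] at this
  rw [map_sub, map_smul]
  simp only [sub_apply, smul_apply, smul_eq_mul]
  linarith

/-- If a Kähler surface has two solutions which are independent modulo the metric at a point, then
at this point the curvature is that of constant holomorphic sectional curvature, and its value
determines the hessian of every solution modulo the metric. -/
theorem exists_constant_curvature (hI : Integrability g J R a L) (hI' : Integrability g J R a' L')
    (hR : CurvatureLike g J R) (h : PseudoHermitian g J) (hV : Module.finrank ℝ V = 4)
    (hli : LinearIndependent ℝ ![g, a, a']) :
    ∃ B : ℝ, (∀ x y u, R x y u = -B • modelCurvature g J x y u) ∧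
      ∀ b N : V →L[ℝ] V →L[ℝ] ℝ, Integrability g J R b N → ∃ μ : ℝ, N = μ • g + B • b := by
  obtain ⟨e₁, e₂, F⟩ := h.exists_adaptedFrame hV
  have eqs := fun (b N : V →L[ℝ] V →L[ℝ] ℝ) (hb : Integrability g J R b N) =>
    hb.frame_equations hR h F rfl rfl rfl rfl rfl rfl rfl rfl rfl rfl rfl rfl rfl rfl rfl rfl rfl
      rfl rfl
  have hm := F.minors_ne_zero h hI.symm hI.hermitian hI'.symm hI'.hermitian hli rfl rfl rfl rfl
    rfl rfl
  have n1 := F.ne₁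
  have n2 := F.ne₂
  -- The Bianchi identity for `e₁, J e₁, e₂`, the one relation between the frame components that is
  -- not a symmetry within or between the pairs.
  have bianchi : g (R e₁ (J e₁) e₂) (J e₂) = g (R e₁ e₂ e₁) e₂ + g (R e₁ (J e₂) e₁) (J e₂) := by
    have := congrArg (fun x => g x (J e₂)) (hR.bianchi e₁ (J e₁) e₂)
    simp only [map_add, add_apply, map_zero, zero_apply] at this
    have k1 : R (J e₁) e₂ e₁ = -R e₁ (J e₂) e₁ := by
      rw [← hR.J_invariant h (J e₁) e₂, h.sq_eq_neg]
      simp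
    have k2 : R e₂ e₁ (J e₁) = -J (R e₁ e₂ e₁) := by rw [hR.skew, hR.commute]
    rw [k1, k2] at this
    simp only [map_neg, neg_apply, h.hermitian] at this
    linarith
  have hxβ : g (R e₂ (J e₂) e₁) (J e₁) = g (R e₁ (J e₁) e₂) (J e₂) := hR.pair_symm h _ _ _ _
  rw [hxβ] at eqs
  obtain ⟨B, k1, k2, k3, k4, k5, k6, k7, k8, k9, k10⟩ :=
    scalar_curvature_components n1 n2 hm bianchi
    (eqs a L hI) (eqs a' L' hI')
  refine ⟨B, hR.eq_model h F k1 k2 k3 k4 k5 k6 k7 k8 k9 k10, fun b N hb => ?_⟩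
  obtain ⟨-, -, ⟨C1, C2, -⟩, D1, -, -⟩ := eqs b N hb
  have n12 := mul_ne_zero n1 n2
  rw [k3, k6, k8] at C2
  rw [k8, k9] at C1
  rw [k9, k10] at D1
  -- With the curvature known, the frame equations of `b` say that the coordinates of `N` modulo `g`
  -- are `B` times those of `b`.
  have := F.eq_smul_metric (a := N - B • b) h
    (by intro u v; simp [hb.symm u v, hb.hessian_symm hR h F u v])
    (by intro u v; simp [hb.hermitian u v, hb.hessian_hermitian hR h F u v])
    (by simp only [sub_apply, smul_apply, smul_eq_mul]
        refine mul_right_cancel₀ n12 ?_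
        linear_combination -C2)
    (by simp only [sub_apply, smul_apply, smul_eq_mul]
        refine mul_right_cancel₀ n12 ?_
        linear_combination -C1)
    (by simp only [sub_apply, smul_apply, smul_eq_mul]
        refine mul_right_cancel₀ n12 ?_
        linear_combination -D1)
  obtain ⟨μ, hμ⟩ : ∃ μ : ℝ, N - B • b = μ • g := ⟨_, this⟩
  refine ⟨μ, ?_⟩
  ext u v
  have := congrArg (fun c => c u v) hμ
  simp only [sub_apply, add_apply, smul_apply] at this ⊢
  linarith

end Pointwise

/-! ### Algebra of the mobility tensor and of Schur's lemma -/

section Pointwise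

variable {V : Type*} [NormedAddCommGroup V] [NormedSpace ℝ V]
variable {g : V →L[ℝ] V →L[ℝ] ℝ} {J : V →L[ℝ] V} {e₁ e₂ : V} {a : V →L[ℝ] V →L[ℝ] ℝ}

/-- The right-hand side of the mobility equation: `mobilityTensor g J l u v w` is the covariant
derivative of `a` in the direction `w`, evaluated on `u` and `v`. -/
def mobilityTensor (g : V →L[ℝ] V →L[ℝ] ℝ) (J : V →L[ℝ] V) (l : V →L[ℝ] ℝ) (u v w : V) : ℝ :=
  l u * g v w + l v * g u w - l (J u) * g v (J w) - l (J v) * g u (J w)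

namespace AdaptedFrame

lemma linearForm_eq_zero (F : AdaptedFrame g J e₁ e₂) {l : V →L[ℝ] ℝ} (h1 : l e₁ = 0)
    (h1' : l (J e₁) = 0) (h2 : l e₂ = 0) (h2' : l (J e₂) = 0) : l = 0 := by
  ext v
  rw [F.expand v]
  simp [h1, h1', h2, h2']

/-- On `(e₁, e₁, w)` with `w` in the complex line of `e₂` the mobility tensor vanishes, while the
right-hand side is `η w` times a nonzero number; symmetrically for `e₂`. With `η = 0` the diagonal
entries then give `l = 0`. It serves to show that a solution proportional to `g` is a constant
multiple of it. -/
lemma eq_zero_of_mobilityTensor_eq_smul (F : AdaptedFrame g J e₁ e₂) (h : PseudoHermitian g J)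
    {l η : V →L[ℝ] ℝ} (hl : ∀ u v w, mobilityTensor g J l u v w = η w * g u v) :
    l = 0 ∧ η = 0 := by
  have o1 := F.orth_symm h
  have o2 := F.orth_J h
  have n1 := F.ne₁
  have n2 := F.ne₂
  have key : ∀ u v w, _ := hl
  simp only [mobilityTensor] at key
  have A1 := key e₁ e₁ e₂
  have A2 := key e₁ e₁ (J e₂)
  have A3 := key e₂ e₂ e₁
  have A4 := key e₂ e₂ (J e₁)
  have B1 := key e₁ e₁ e₁
  have B2 := key e₁ e₁ (J e₁)
  have B3 := key e₂ e₂ e₂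
  have B4 := key e₂ e₂ (J e₂)
  simp only [h.sq_eq_neg, map_neg, F.orth, F.orth', o1, o2, h.apply_J_self]
    at A1 A2 A3 A4 B1 B2 B3 B4
  have k : ∀ {t m : ℝ}, m ≠ 0 → t * m = 0 → t = 0 := fun hm ht =>
    (mul_eq_zero.mp ht).resolve_right hm
  have η1 : η e₂ = 0 := k n1 (by linarith)
  have η2 : η (J e₂) = 0 := k n1 (by linarith)
  have η3 : η e₁ = 0 := k n2 (by linarith)
  have η4 : η (J e₁) = 0 := k n2 (by linarith)
  rw [η3] at B1
  rw [η4] at B2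
  rw [η1] at B3
  rw [η2] at B4
  exact ⟨F.linearForm_eq_zero (k n1 (by linarith)) (k n1 (by linarith)) (k n2 (by linarith))
    (k n2 (by linarith)), F.linearForm_eq_zero η3 η4 η1 η2⟩

/-- The mobility tensor in a fixed direction `w` is too special to be a combination of `a` and `g`
for all `w`. With `a = f g'`-type ambiguity excluded by `ha`, the functions in `a' = f a + h g` must
have zero differentials. -/
lemma eq_zero_of_mobilityTensor_eq (F : AdaptedFrame g J e₁ e₂) (h : PseudoHermitian g J)
    (hs : ∀ u v, a u v = a v u) (hJ : ∀ u v, a (J u) (J v) = a u v) (ha : ∀ c : ℝ, a ≠ c • g)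
    {l φ η : V →L[ℝ] ℝ} (hl : ∀ u v w, mobilityTensor g J l u v w = φ w * a u v + η w * g u v) :
    l = 0 ∧ φ = 0 ∧ η = 0 := by
  suffices hφ : φ = 0 by
    have := F.eq_zero_of_mobilityTensor_eq_smul h (l := l) (η := η)
      (fun u v w => by rw [hl, hφ]; simp)
    exact ⟨this.1, hφ, this.2⟩
  have o1 := F.orth_symm h
  have o2 := F.orth_J h
  have n1 := F.ne₁
  have n2 := F.ne₂
  have k : ∀ {t m : ℝ}, m ≠ 0 → t * m = 0 → t = 0 := fun hm ht =>
    (mul_eq_zero.mp ht).resolve_right hm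
  have hr : ∀ w, φ w * a e₁ e₂ = mobilityTensor g J l e₁ e₂ w := fun w => by
    rw [hl, F.orth]; ring
  have hs' : ∀ w, φ w * a e₁ (J e₂) = mobilityTensor g J l e₁ (J e₂) w := fun w => by
    rw [hl, F.orth']; ring
  have hp : ∀ w, φ w * (a e₁ e₁ / g e₁ e₁ - a e₂ e₂ / g e₂ e₂) =
      mobilityTensor g J l e₁ e₁ w / g e₁ e₁ - mobilityTensor g J l e₂ e₂ w / g e₂ e₂ := fun w => by
    rw [hl, hl]; field_simp; ring
  simp only [mobilityTensor] at hr hs' hp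
  have hne := F.components_ne_zero h hs hJ ha
  obtain ⟨u, hu⟩ : ∃ u, u = a e₁ e₁ / g e₁ e₁ - a e₂ e₂ / g e₂ e₂ := ⟨_, rfl⟩
  obtain ⟨r, hr0⟩ : ∃ r, r = a e₁ e₂ := ⟨_, rfl⟩
  obtain ⟨s, hs0⟩ : ∃ s, s = a e₁ (J e₂) := ⟨_, rfl⟩
  rw [← hu, ← hr0, ← hs0] at hne
  rw [← hu] at hp
  rw [← hr0] at hr
  rw [← hs0] at hs'
  have R1 := hr e₁
  have R2 := hr (J e₁)
  have R3 := hr e₂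
  have R4 := hr (J e₂)
  have S1 := hs' e₁
  have S2 := hs' (J e₁)
  have S3 := hs' e₂
  have S4 := hs' (J e₂)
  simp only [h.sq_eq_neg, map_neg, F.orth, F.orth', o1, o2, h.apply_J_self, h.apply_J_left]
    at R1 R2 R3 R4 S1 S2 S3 S4
  by_cases hrs : r = 0 ∧ s = 0
  · obtain ⟨rfl, rfl⟩ := hrs
    have hu0 : u ≠ 0 := fun hu0 => hne ⟨hu0, rfl, rfl⟩
    have l1 : l e₁ = 0 := k n2 (by linarith)
    have l2 : l (J e₁) = 0 := k n2 (by linarith)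
    have l3 : l e₂ = 0 := k n1 (by linarith)
    have l4 : l (J e₂) = 0 := k n1 (by linarith)
    have hl0 : l = 0 := F.linearForm_eq_zero l1 l2 l3 l4
    ext w
    have := hp w
    simp only [hl0, zero_apply, zero_mul, add_zero, sub_zero, zero_div] at this
    exact k hu0 this
  -- The off-diagonal equations for `w` and `J w` contain the same values of `l`. The combinations
  -- below cancel them and leave `φ w (r² + s²) = 0`.
  · have hpos : r ^ 2 + s ^ 2 ≠ 0 := fun h0 =>
      hrs ⟨by nlinarith [sq_nonneg r, sq_nonneg s], by nlinarith [sq_nonneg r, sq_nonneg s]⟩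
    refine F.linearForm_eq_zero (k hpos ?_) (k hpos ?_) (k hpos ?_) (k hpos ?_)
    · linear_combination r * R1 + s * S1 - s * R2 + r * S2
    · linear_combination r * R2 + s * S2 + s * R1 - r * S1
    · linear_combination r * R3 + s * S3 + s * R4 - r * S4
    · linear_combination r * R4 + s * S4 - s * R3 + r * S3

/-- The algebraic part of Schur's lemma. -/
lemma eq_zero_of_wedge_eq_zero (F : AdaptedFrame g J e₁ e₂) (h : PseudoHermitian g J)
    (hs : ∀ u v, a u v = a v u) (hJ : ∀ u v, a (J u) (J v) = a u v) (ha : ∀ c : ℝ, a ≠ c • g)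
    {τ b : V →L[ℝ] ℝ} (hw : ∀ z w u, τ z * g w u - τ w * g z u + b z * a w u - b w * a z u = 0) :
    b = 0 := by
  have o1 := F.orth_symm h
  have o2 := F.orth_J h
  have n1 := F.ne₁
  have n2 := F.ne₂
  have k : ∀ {t m : ℝ}, m ≠ 0 → t * m = 0 → t = 0 := fun hm ht =>
    (mul_eq_zero.mp ht).resolve_right hm
  have a' : ∀ u v, a (J u) v = -a u (J v) := fun u v => by
    have := hJ u (J v)
    rw [h.sq_eq_neg, map_neg] at this
    linarith
  have aJ : ∀ u, a u (J u) = 0 := fun u => by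
    have := a' u u
    rw [hs] at this
    linarith
  have s1 : a e₂ e₁ = a e₁ e₂ := hs _ _
  have s2 : a e₂ (J e₁) = -a e₁ (J e₂) := by rw [hs, a']
  have hne := F.components_ne_zero h hs hJ ha
  -- In `A1` to `A4` the last vector is orthogonal to the complex line of the first two, so `τ`
  -- drops out. They suffice when `a` has an off-diagonal entry; otherwise `τ` is eliminated between
  -- the equations `B` and `C`.
  have A1 := hw e₁ (J e₁) e₂
  have A2 := hw e₁ (J e₁) (J e₂)
  have A3 := hw e₂ (J e₂) e₁
  have A4 := hw e₂ (J e₂) (J e₁)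
  have B1 := hw e₁ e₂ e₁
  have B2 := hw e₁ e₂ e₂
  have B3 := hw (J e₁) e₂ e₂
  have B4 := hw e₁ (J e₂) e₁
  have C1 := hw e₂ (J e₂) e₂
  have C2 := hw e₂ (J e₂) (J e₂)
  have C3 := hw e₁ (J e₁) e₁
  have C4 := hw e₁ (J e₁) (J e₁)
  simp only [h.sq_eq_neg, map_neg, F.orth, F.orth', o1, o2, h.apply_J_self, h.apply_J_left, a', aJ,
    s1, s2, neg_neg] at A1 A2 A3 A4 B1 B2 B3 B4 C1 C2 C3 C4
  obtain ⟨r, hr0⟩ : ∃ r, r = a e₁ e₂ := ⟨_, rfl⟩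
  obtain ⟨s, hs0⟩ : ∃ s, s = a e₁ (J e₂) := ⟨_, rfl⟩
  simp only [← hr0, ← hs0] at A1 A2 A3 A4 B1 B2 B3 B4 C1 C2 C3 C4 hne
  by_cases hrs : r = 0 ∧ s = 0
  · obtain ⟨rfl, rfl⟩ := hrs
    have hu0 : a e₁ e₁ * g e₂ e₂ - a e₂ e₂ * g e₁ e₁ ≠ 0 := fun hu0 =>
      hne ⟨by field_simp; linarith, rfl, rfl⟩
    refine F.linearForm_eq_zero (k hu0 ?_) (k hu0 ?_) (k hu0 ?_) (k hu0 ?_)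
    · linear_combination g e₂ e₂ * C4 - g e₁ e₁ * B2
    · linear_combination -(g e₂ e₂) * C3 - g e₁ e₁ * B3
    · linear_combination -(g e₂ e₂) * B1 - g e₁ e₁ * C2
    · linear_combination -(g e₂ e₂) * B4 + g e₁ e₁ * C1
  · have hpos : r ^ 2 + s ^ 2 ≠ 0 := fun h0 =>
      hrs ⟨by nlinarith [sq_nonneg r, sq_nonneg s], by nlinarith [sq_nonneg r, sq_nonneg s]⟩
    refine F.linearForm_eq_zero (k hpos ?_) (k hpos ?_) (k hpos ?_) (k hpos ?_)
    · linear_combination r * A2 - s * A1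
    · linear_combination -s * A2 - r * A1
    · linear_combination s * A3 + r * A4
    · linear_combination s * A4 - r * A3

end AdaptedFrame

end Pointwise

/-! ### Covariant derivatives, curvature and Ricci identities in coordinates -/

section Local

set_option maxSynthPendingDepth 3

open ContinuousLinearMap Topology

variable {E : Type*} [NormedAddCommGroup E] [NormedSpace ℝ E]

/-- The curvature `R(z, w)u` of the connection `∇_z u = ∂_z u + Γ(z, u)`. -/
def curvatureForm (Γ : E → E →L[ℝ] E →L[ℝ] E) (x : E) : E →L[ℝ] E →L[ℝ] E →L[ℝ] E :=
  fderiv ℝ Γ x + (compL ℝ E E E).bilinearComp (Γ x) (Γ x) -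
    (fderiv ℝ Γ x + (compL ℝ E E E).bilinearComp (Γ x) (Γ x)).flip

lemma curvatureForm_apply (Γ : E → E →L[ℝ] E →L[ℝ] E) (x z w u : E) :
    curvatureForm Γ x z w u = fderiv ℝ Γ x z w u - fderiv ℝ Γ x w z u +
      Γ x z (Γ x w u) - Γ x w (Γ x z u) := by
  simp only [curvatureForm, sub_apply, add_apply, flip_apply, bilinearComp_apply, compL_apply,
    coe_comp, Function.comp_apply]
  abel

/-- The covariant derivative of a covector field `l`: `hessianForm Γ l x w u` is the derivative in
the direction `w`, evaluated on `u`. -/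
def hessianForm (Γ : E → E →L[ℝ] E →L[ℝ] E) (l : E → E →L[ℝ] ℝ) (x : E) : E →L[ℝ] E →L[ℝ] ℝ :=
  fderiv ℝ l x - (compL ℝ E E ℝ (l x)).comp (Γ x)

lemma hessianForm_apply (Γ : E → E →L[ℝ] E →L[ℝ] E) (l : E → E →L[ℝ] ℝ) (x w u : E) :
    hessianForm Γ l x w u = fderiv ℝ l x w u - l x (Γ x w u) := by
  simp [hessianForm]

/-- The covariant derivative of a field of bilinear forms: `covDerivForm Γ b x w u v` is the
derivative in the direction `w`, evaluated on `u` and `v`. -/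
def covDerivForm (Γ : E → E →L[ℝ] E →L[ℝ] E) (b : E → E →L[ℝ] E →L[ℝ] ℝ) (x w u v : E) : ℝ :=
  fderiv ℝ b x w u v - b x (Γ x w u) v - b x u (Γ x w v)

/-- A Kähler structure in coordinates, with the connection form `Γ` of its metric. -/
structure LocalKahler (S : Set E) (G : E → E →L[ℝ] E →L[ℝ] ℝ) (J : E → E →L[ℝ] E)
    (Γ : E → E →L[ℝ] E →L[ℝ] E) : Prop where
  isOpen : IsOpen S
  smooth_metric : ContDiffOn ℝ ∞ G S
  smooth_complex : ContDiffOn ℝ ∞ J S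
  smooth_connection : ContDiffOn ℝ ∞ Γ S
  hermitian : ∀ x ∈ S, PseudoHermitian (G x) (J x)
  torsion_free : ∀ x ∈ S, ∀ u v, Γ x u v = Γ x v u
  metric : ∀ x ∈ S, ∀ w u v, covDerivForm Γ G x w u v = 0
  parallel : ∀ x ∈ S, ∀ w u, fderiv ℝ J x w u = J x (Γ x w u) - Γ x w (J x u)

/-- A solution of the mobility equation in coordinates. -/
structure LocalSolution (S : Set E) (G : E → E →L[ℝ] E →L[ℝ] ℝ) (J : E → E →L[ℝ] E)
    (Γ : E → E →L[ℝ] E →L[ℝ] E) (a : E → E →L[ℝ] E →L[ℝ] ℝ) (l : E → E →L[ℝ] ℝ) : Prop where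
  smooth_form : ContDiffOn ℝ ∞ a S
  smooth_covector : ContDiffOn ℝ ∞ l S
  symm : ∀ x ∈ S, ∀ u v, a x u v = a x v u
  hermitian : ∀ x ∈ S, ∀ u v, a x (J x u) (J x v) = a x u v
  equation : ∀ x ∈ S, ∀ w u v,
    covDerivForm Γ a x w u v = mobilityTensor (G x) (J x) (l x) u v w

section Calculus

variable {F : Type*} [NormedAddCommGroup F] [NormedSpace ℝ F] {S : Set E} {f : E → F} {x : E}

lemma fderiv_fderiv_symm (hS : IsOpen S) (hf : ContDiffOn ℝ ∞ f S) (hx : x ∈ S) (z w : E) :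
    fderiv ℝ (fderiv ℝ f) x z w = fderiv ℝ (fderiv ℝ f) x w z :=
  ((hf.contDiffAt (hS.mem_nhds hx)).isSymmSndFDerivAt
    (by simpa using ENat.LEInfty.out)) z w

lemma contDiffOn_fderiv (hS : IsOpen S) (hf : ContDiffOn ℝ ∞ f S) :
    ContDiffOn ℝ ∞ (fderiv ℝ f) S :=
  hf.fderiv_of_isOpen hS (by simp)

lemma differentiableAt_of_smooth (hS : IsOpen S) (hf : ContDiffOn ℝ ∞ f S) (hx : x ∈ S) :
    DifferentiableAt ℝ f x :=
  (hf.contDiffAt (hS.mem_nhds hx)).differentiableAt (by simp)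

end Calculus

variable {S : Set E} {G a : E → E →L[ℝ] E →L[ℝ] ℝ} {J : E → E →L[ℝ] E}
  {Γ : E → E →L[ℝ] E →L[ℝ] E} {l : E → E →L[ℝ] ℝ} {x : E}

lemma contDiffOn_hessianForm (hS : IsOpen S) (hΓ : ContDiffOn ℝ ∞ Γ S)
    (hl : ContDiffOn ℝ ∞ l S) : ContDiffOn ℝ ∞ (hessianForm Γ l) S := by
  have := contDiffOn_fderiv hS hl
  have h2 : ContDiffOn ℝ ∞ (fun x => compL ℝ E E ℝ (l x)) S :=
    (compL ℝ E E ℝ).contDiff.comp_contDiffOn hl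
  exact this.sub (h2.clm_comp hΓ)

lemma contDiffOn_curvatureForm (hS : IsOpen S) (hΓ : ContDiffOn ℝ ∞ Γ S) :
    ContDiffOn ℝ ∞ (curvatureForm Γ) S := by
  have h1 : ContDiffOn ℝ ∞ (fun x => fderiv ℝ Γ x +
      (compL ℝ E E E).bilinearComp (Γ x) (Γ x)) S := by
    refine (contDiffOn_fderiv hS hΓ).add ?_
    have h2 : ContDiffOn ℝ ∞ (fun x => (compL ℝ E E E).comp (Γ x)) S :=
      contDiffOn_const.clm_comp hΓ
    have h3 : ContDiffOn ℝ ∞ (fun x => ((compL ℝ E E E).comp (Γ x)).flip) S :=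
      (flipₗᵢ ℝ E (E →L[ℝ] E) (E →L[ℝ] E)).contDiff.comp_contDiffOn h2
    have h4 := h3.clm_comp hΓ
    exact (flipₗᵢ ℝ E E (E →L[ℝ] E)).contDiff.comp_contDiffOn h4
  exact h1.sub ((flipₗᵢ ℝ E E (E →L[ℝ] E)).contDiff.comp_contDiffOn h1)

/-- The definition of the Hessian, differentiated once and solved for the second derivative of `l`.
Symmetry of the latter in `z, w` is what produces the Ricci identity. -/
lemma hessian_fderiv_identity (hS : IsOpen S) (hΓ : ContDiffOn ℝ ∞ Γ S)
    (hl : ContDiffOn ℝ ∞ l S) (hx : x ∈ S) (z w u : E) :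
    fderiv ℝ (fderiv ℝ l) x z w u = fderiv ℝ l x z (Γ x w u) + l x (fderiv ℝ Γ x z w u) +
      fderiv ℝ (hessianForm Γ l) x z w u := by
  have dΓ := differentiableAt_of_smooth hS hΓ hx
  have dl := differentiableAt_of_smooth hS hl hx
  have ddl := differentiableAt_of_smooth hS (contDiffOn_fderiv hS hl) hx
  have e : hessianForm Γ l = fun y => fderiv ℝ l y - (compL ℝ E E ℝ (l y)).comp (Γ y) := rfl
  have e2 : fderiv ℝ (fun y => hessianForm Γ l y w u) x z =
      fderiv ℝ (hessianForm Γ l) x z w u := by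
    have := differentiableAt_of_smooth hS (contDiffOn_hessianForm hS hΓ hl) hx
    rw [fderiv_clm_apply (by fun_prop) (by fun_prop),
          fderiv_clm_apply (by fun_prop) (by fun_prop)]
    simp
  rw [← e2]
  simp only [hessianForm_apply]
  rw [fderiv_fun_sub (by fun_prop) (by fun_prop), fderiv_clm_apply (by fun_prop) (by fun_prop),
    fderiv_clm_apply (by fun_prop) (by fun_prop), fderiv_clm_apply (by fun_prop) (by fun_prop),
    fderiv_clm_apply (by fun_prop) (by fun_prop),
          fderiv_clm_apply (by fun_prop) (by fun_prop)]
  simp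
  ring

/-- The Ricci identity for covector fields. -/
lemma ricci_covector (hS : IsOpen S) (hΓ : ContDiffOn ℝ ∞ Γ S) (hl : ContDiffOn ℝ ∞ l S)
    (ht : ∀ u v, Γ x u v = Γ x v u) (hx : x ∈ S) (z w u : E) :
    l x (curvatureForm Γ x z w u) + covDerivForm Γ (hessianForm Γ l) x z w u -
      covDerivForm Γ (hessianForm Γ l) x w z u = 0 := by
  have h1 := hessian_fderiv_identity hS hΓ hl hx z w u
  have h2 := hessian_fderiv_identity hS hΓ hl hx w z u
  rw [fderiv_fderiv_symm hS hl hx] at h1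
  have h3 := hessianForm_apply Γ l x z (Γ x w u)
  have h4 := hessianForm_apply Γ l x w (Γ x z u)
  simp only [covDerivForm, curvatureForm_apply, map_add, map_sub, ht w z]
  linear_combination h2 - h1 + h3 - h4

/-- The covariant derivative enters as a prescribed function `T`, so that the same computation
covers the parallel metric (`T = 0`) and the mobility equation. -/
lemma form_fderiv_identity {b : E → E →L[ℝ] E →L[ℝ] ℝ} {T : E → ℝ} {w u v : E}
    (hS : IsOpen S) (hΓ : ContDiffOn ℝ ∞ Γ S) (hb : ContDiffOn ℝ ∞ b S) (hx : x ∈ S)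
    (hT : ∀ y ∈ S, covDerivForm Γ b y w u v = T y) (z : E) :
    fderiv ℝ (fderiv ℝ b) x z w u v =
      fderiv ℝ b x z (Γ x w u) v + b x (fderiv ℝ Γ x z w u) v +
      (fderiv ℝ b x z u (Γ x w v) + b x u (fderiv ℝ Γ x z w v)) + fderiv ℝ T x z := by
  have dΓ := differentiableAt_of_smooth hS hΓ hx
  have db := differentiableAt_of_smooth hS hb hx
  have ddb := differentiableAt_of_smooth hS (contDiffOn_fderiv hS hb) hx
  have hT' : T =ᶠ[𝓝 x] fun y => covDerivForm Γ b y w u v := by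
    filter_upwards [hS.mem_nhds hx] with y hy using (hT y hy).symm
  rw [hT'.fderiv_eq]
  simp only [covDerivForm]
  rw [fderiv_fun_sub (by fun_prop) (by fun_prop), fderiv_fun_sub (by fun_prop) (by fun_prop)]
  have k1 : fderiv ℝ (fun y => fderiv ℝ b y w u v) x z = fderiv ℝ (fderiv ℝ b) x z w u v := by
    rw [fderiv_clm_apply (by fun_prop) (by fun_prop), fderiv_clm_apply (by fun_prop) (by fun_prop),
      fderiv_clm_apply (by fun_prop) (by fun_prop)]
    simp
  have k0 : ∀ u, fderiv ℝ (fun y => Γ y w u) x z = fderiv ℝ Γ x z w u := fun u => by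
    rw [fderiv_clm_apply (by fun_prop) (by fun_prop),
          fderiv_clm_apply (by fun_prop) (by fun_prop)]
    simp
  have k2 : fderiv ℝ (fun y => b y (Γ y w u) v) x z =
      fderiv ℝ b x z (Γ x w u) v + b x (fderiv ℝ Γ x z w u) v := by
    rw [fderiv_clm_apply (by fun_prop) (by fun_prop),
          fderiv_clm_apply (by fun_prop) (by fun_prop)]
    simp [k0]
    ring
  have k3 : fderiv ℝ (fun y => b y u (Γ y w v)) x z =
      fderiv ℝ b x z u (Γ x w v) + b x u (fderiv ℝ Γ x z w v) := by
    have k4 : fderiv ℝ (fun y => b y u) x z = fderiv ℝ b x z u := by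
      rw [fderiv_clm_apply (by fun_prop) (by fun_prop)]
      simp
    rw [fderiv_clm_apply (by fun_prop) (by fun_prop)]
    simp only [add_apply, coe_comp, Function.comp_apply, flip_apply, k0, k4]
    ring
  simp only [sub_apply, k1, k2, k3]
  ring

/-- The Ricci identity for fields of bilinear forms, with covariant derivative `T`. -/
lemma ricci_form {b : E → E →L[ℝ] E →L[ℝ] ℝ} {T : E → E → E → E → ℝ}
    (hS : IsOpen S) (hΓ : ContDiffOn ℝ ∞ Γ S) (hb : ContDiffOn ℝ ∞ b S) (hx : x ∈ S)
    (hT : ∀ y ∈ S, ∀ w u v, covDerivForm Γ b y w u v = T u v w y) (z w u v : E) :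
    b x (curvatureForm Γ x z w u) v + b x u (curvatureForm Γ x z w v) +
      (fderiv ℝ (T u v w) x z - T (Γ x z u) v w x - T u (Γ x z v) w x) -
      (fderiv ℝ (T u v z) x w - T (Γ x w u) v z x - T u (Γ x w v) z x) = 0 := by
  have h1 := form_fderiv_identity hS hΓ hb hx (fun y hy => hT y hy w u v) z
  have h2 := form_fderiv_identity hS hΓ hb hx (fun y hy => hT y hy z u v) w
  rw [fderiv_fderiv_symm hS hb hx] at h1
  have a1 := hT x hx z (Γ x w u) v
  have a2 := hT x hx w (Γ x z u) v
  have a3 := hT x hx z u (Γ x w v)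
  have a4 := hT x hx w u (Γ x z v)
  simp only [covDerivForm] at a1 a2 a3 a4
  simp only [curvatureForm_apply, map_add, map_sub, add_apply, sub_apply]
  linear_combination h2 - h1 - a1 + a2 - a3 + a4

end Local

/-! ### Kähler curvature and the closed system for a solution -/

section Local

open ContinuousLinearMap Topology

set_option maxSynthPendingDepth 3

variable {E : Type*} [NormedAddCommGroup E] [NormedSpace ℝ E]
variable {S : Set E} {G a : E → E →L[ℝ] E →L[ℝ] ℝ} {J : E → E →L[ℝ] E}
  {Γ : E → E →L[ℝ] E →L[ℝ] E} {l : E → E →L[ℝ] ℝ} {x : E}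

namespace LocalKahler

/-- Differentiate the equation `∇J = 0` once more and use the symmetry of the second derivative of
`J`. -/
lemma curvatureForm_commute (K : LocalKahler S G J Γ) (hx : x ∈ S) (z w u : E) :
    curvatureForm Γ x z w (J x u) = J x (curvatureForm Γ x z w u) := by
  have dΓ := differentiableAt_of_smooth K.isOpen K.smooth_connection hx
  have dJ := differentiableAt_of_smooth K.isOpen K.smooth_complex hx
  have ddJ := differentiableAt_of_smooth K.isOpen (contDiffOn_fderiv K.isOpen K.smooth_complex) hx
  have key : ∀ z w, fderiv ℝ (fderiv ℝ J) x z w u = fderiv ℝ J x z (Γ x w u) +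
      J x (fderiv ℝ Γ x z w u) - (fderiv ℝ Γ x z w (J x u) + Γ x w (fderiv ℝ J x z u)) := by
    intro z w
    have e : (fun y => fderiv ℝ J y w u) =ᶠ[𝓝 x] fun y => J y (Γ y w u) - Γ y w (J y u) := by
      filter_upwards [K.isOpen.mem_nhds hx] with y hy using K.parallel y hy w u
    have dw : HasFDerivAt (fun y => Γ y w) ((fderiv ℝ Γ x).flip w) x := by
      have := dΓ.hasFDerivAt.clm_apply (hasFDerivAt_const w x)
      simpa using this
    have dwu : HasFDerivAt (fun y => Γ y w u) (((fderiv ℝ Γ x).flip w).flip u) x := by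
      have := dw.clm_apply (hasFDerivAt_const u x)
      simpa using this
    have dJu : HasFDerivAt (fun y => J y u) ((fderiv ℝ J x).flip u) x := by
      have := dJ.hasFDerivAt.clm_apply (hasFDerivAt_const u x)
      simpa using this
    have k3 : fderiv ℝ (fun y => fderiv ℝ J y w u) x z = fderiv ℝ (fderiv ℝ J) x z w u := by
      rw [fderiv_clm_apply (by fun_prop) (by fun_prop),
          fderiv_clm_apply (by fun_prop) (by fun_prop)]
      simp
    rw [← k3, e.fderiv_eq, ((dJ.hasFDerivAt.clm_apply dwu).fun_sub (dw.clm_apply dJu)).fderiv]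
    simp only [sub_apply, add_apply, coe_comp, Function.comp_apply, flip_apply]
    abel
  have h1 := key z w
  have h2 := key w z
  rw [fderiv_fderiv_symm K.isOpen K.smooth_complex hx, h2] at h1
  simp only [K.parallel x hx, map_sub] at h1
  simp only [curvatureForm_apply, map_sub, map_add]
  rw [← sub_eq_zero] at h1 ⊢
  rw [← h1]
  abel

lemma curvatureLike (K : LocalKahler S G J Γ) (hx : x ∈ S) :
    CurvatureLike (G x) (J x) (curvatureForm Γ x) where
  skew z w u := by simp only [curvatureForm_apply]; abel
  bianchi z w u := by
    have dΓ := differentiableAt_of_smooth K.isOpen K.smooth_connection hx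
    have hs : ∀ z w u, fderiv ℝ Γ x z w u = fderiv ℝ Γ x z u w := by
      intro z w u
      have e : (fun y => Γ y w u) =ᶠ[𝓝 x] fun y => Γ y u w := by
        filter_upwards [K.isOpen.mem_nhds hx] with y hy using K.torsion_free y hy w u
      have k0 : ∀ w u, fderiv ℝ (fun y => Γ y w u) x z = fderiv ℝ Γ x z w u := fun w u => by
        rw [fderiv_clm_apply (by fun_prop) (by fun_prop),
          fderiv_clm_apply (by fun_prop) (by fun_prop)]
        simp
      rw [← k0, ← k0, e.fderiv_eq]
    have ht := K.torsion_free x hx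
    simp only [curvatureForm_apply]
    rw [hs u w z, hs z u w, hs w z u, ht u w, ht z u, ht w z]
    abel
  metric z w u v := by
    have := ricci_form (T := fun _ _ _ _ => 0) K.isOpen K.smooth_connection K.smooth_metric hx
      (fun y hy w u v => K.metric y hy w u v) z w u v
    simp only [fderiv_fun_const, Pi.zero_apply, zero_apply] at this
    linarith
  commute z w u := K.curvatureForm_commute hx z w u

/-- `g` and `J` are parallel, so the covariant derivative of the mobility tensor of `l` is the
mobility tensor of `∇l`. The three terms with `Γ` are the connection terms of its arguments. -/
lemma fderiv_mobilityTensor (K : LocalKahler S G J Γ) (hl : ContDiffOn ℝ ∞ l S) (hx : x ∈ S)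
    (z u v w : E) :
    fderiv ℝ (fun y => mobilityTensor (G y) (J y) (l y) u v w) x z =
      mobilityTensor (G x) (J x) (l x) (Γ x z u) v w +
      mobilityTensor (G x) (J x) (l x) u (Γ x z v) w +
      mobilityTensor (G x) (J x) (l x) u v (Γ x z w) +
      mobilityTensor (G x) (J x) (hessianForm Γ l x z) u v w := by
  have dl := differentiableAt_of_smooth K.isOpen hl hx
  have dG := differentiableAt_of_smooth K.isOpen K.smooth_metric hx
  have dJ := differentiableAt_of_smooth K.isOpen K.smooth_complex hx
  have kl : ∀ u, HasFDerivAt (fun y => l y u) ((fderiv ℝ l x).flip u) x := fun u => by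
    have := dl.hasFDerivAt.clm_apply (hasFDerivAt_const u x)
    simpa using this
  have kG : ∀ u v, HasFDerivAt (fun y => G y u v) (((fderiv ℝ G x).flip u).flip v) x :=
    fun u v => by
    have := (dG.hasFDerivAt.clm_apply (hasFDerivAt_const u x)).clm_apply (hasFDerivAt_const v x)
    simpa using this
  have kJ : ∀ u, HasFDerivAt (fun y => J y u) ((fderiv ℝ J x).flip u) x := fun u => by
    have := dJ.hasFDerivAt.clm_apply (hasFDerivAt_const u x)
    simpa using this
  have klJ : ∀ u, HasFDerivAt (fun y => l y (J y u)) _ x := fun u =>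
    dl.hasFDerivAt.clm_apply (kJ u)
  have kGJ : ∀ u v, HasFDerivAt (fun y => G y u (J y v)) _ x := fun u v =>
    (dG.hasFDerivAt.clm_apply (hasFDerivAt_const u x)).clm_apply (kJ v)
  have total := (((kl u).mul (kG v w)).add ((kl v).mul (kG u w))).sub ((klJ u).mul (kGJ v w))
    |>.sub ((klJ v).mul (kGJ u w))
  have e : (fun y => mobilityTensor (G y) (J y) (l y) u v w) =
      fun y => l y u * G y v w + l y v * G y u w - l y (J y u) * G y v (J y w) -
        l y (J y v) * G y u (J y w) := rfl
  rw [e]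
  have t := congrArg (fun A => A z) total.fderiv
  refine Eq.trans t ?_
  have eG : ∀ z u v, fderiv ℝ G x z u v = G x (Γ x z u) v + G x u (Γ x z v) := fun z u v => by
    have := K.metric x hx z u v
    rw [covDerivForm] at this
    linarith
  have el : ∀ z u, fderiv ℝ l x z u = hessianForm Γ l x z u + l x (Γ x z u) := fun z u => by
    rw [hessianForm_apply]; ring
  simp only [add_apply, sub_apply, smul_apply, smul_eq_mul, coe_comp, Function.comp_apply,
    flip_apply, zero_apply, map_zero, zero_add, eG, el, K.parallel x hx, map_sub,
    mobilityTensor]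
  ring

end LocalKahler

namespace LocalSolution

lemma integrability (s : LocalSolution S G J Γ a l) (K : LocalKahler S G J Γ) (hx : x ∈ S) :
    Integrability (G x) (J x) (curvatureForm Γ x) (a x) (hessianForm Γ l x) where
  symm := s.symm x hx
  hermitian := s.hermitian x hx
  ricci z w u v := by
    have := ricci_form (T := fun u v w y => mobilityTensor (G y) (J y) (l y) u v w) K.isOpen
      K.smooth_connection s.smooth_form hx (fun y hy w u v => s.equation y hy w u v) z w u v
    rw [K.fderiv_mobilityTensor s.smooth_covector hx, K.fderiv_mobilityTensor s.smooth_covector hx,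
      K.torsion_free x hx z w] at this
    simp only [mobilityTensor] at this
    linear_combination this

variable (hE : Module.finrank ℝ E = 4)
include hE

lemma hessian_symm (s : LocalSolution S G J Γ a l) (K : LocalKahler S G J Γ) (hx : x ∈ S)
    (u v : E) : hessianForm Γ l x u v = hessianForm Γ l x v u := by
  obtain ⟨e₁, e₂, F⟩ := (K.hermitian x hx).exists_adaptedFrame hE
  exact (s.integrability K hx).hessian_symm (K.curvatureLike hx) (K.hermitian x hx) F u v

lemma hessian_hermitian (s : LocalSolution S G J Γ a l) (K : LocalKahler S G J Γ) (hx : x ∈ S)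
    (u v : E) : hessianForm Γ l x (J x u) (J x v) = hessianForm Γ l x u v := by
  obtain ⟨e₁, e₂, F⟩ := (K.hermitian x hx).exists_adaptedFrame hE
  exact (s.integrability K hx).hessian_hermitian (K.curvatureLike hx) (K.hermitian x hx) F u v

lemma covDeriv_hessian_symm (s : LocalSolution S G J Γ a l) (K : LocalKahler S G J Γ)
    (hx : x ∈ S) (w u v : E) :
    covDerivForm Γ (hessianForm Γ l) x w u v = covDerivForm Γ (hessianForm Γ l) x w v u := by
  have dL := differentiableAt_of_smooth K.isOpen
    (contDiffOn_hessianForm K.isOpen K.smooth_connection s.smooth_covector) hx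
  have k : ∀ u v, fderiv ℝ (fun y => hessianForm Γ l y u v) x w =
      fderiv ℝ (hessianForm Γ l) x w u v := fun u v => by
    rw [fderiv_clm_apply (by fun_prop) (by fun_prop),
          fderiv_clm_apply (by fun_prop) (by fun_prop)]
    simp
  have e : (fun y => hessianForm Γ l y u v) =ᶠ[𝓝 x] fun y => hessianForm Γ l y v u := by
    filter_upwards [K.isOpen.mem_nhds hx] with y hy using s.hessian_symm hE K hy u v
  rw [covDerivForm, covDerivForm, ← k, ← k, e.fderiv_eq, s.hessian_symm hE K hx _ v,
    s.hessian_symm hE K hx u]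
  ring

lemma covDeriv_hessian_hermitian (s : LocalSolution S G J Γ a l) (K : LocalKahler S G J Γ)
    (hx : x ∈ S) (w u v : E) :
    covDerivForm Γ (hessianForm Γ l) x w (J x u) (J x v) =
      covDerivForm Γ (hessianForm Γ l) x w u v := by
  have dL := differentiableAt_of_smooth K.isOpen
    (contDiffOn_hessianForm K.isOpen K.smooth_connection s.smooth_covector) hx
  have dJ := differentiableAt_of_smooth K.isOpen K.smooth_complex hx
  have kJ : ∀ u, HasFDerivAt (fun y => J y u) ((fderiv ℝ J x).flip u) x := fun u => by
    have := dJ.hasFDerivAt.clm_apply (hasFDerivAt_const u x)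
    simpa using this
  have k : ∀ u v, fderiv ℝ (fun y => hessianForm Γ l y u v) x w =
      fderiv ℝ (hessianForm Γ l) x w u v := fun u v => by
    rw [fderiv_clm_apply (by fun_prop) (by fun_prop),
          fderiv_clm_apply (by fun_prop) (by fun_prop)]
    simp
  have e : (fun y => hessianForm Γ l y u v) =ᶠ[𝓝 x]
      fun y => hessianForm Γ l y (J y u) (J y v) := by
    filter_upwards [K.isOpen.mem_nhds hx] with y hy using (s.hessian_hermitian hE K hy u v).symm
  have h1 := k u v
  rw [e.fderiv_eq, ((dL.hasFDerivAt.clm_apply (kJ u)).clm_apply (kJ v)).fderiv] at h1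
  simp only [add_apply, coe_comp, Function.comp_apply, flip_apply, K.parallel x hx, map_sub,
    sub_apply, s.hessian_hermitian hE K hx] at h1
  rw [covDerivForm, covDerivForm]
  linear_combination h1

/-- The system for `(a, λ, ∇λ)` is closed. -/
lemma covDeriv_hessian (s : LocalSolution S G J Γ a l) (K : LocalKahler S G J Γ)
    (hx : x ∈ S) (w u v : E) :
    2 * covDerivForm Γ (hessianForm Γ l) x w u v =
      l x (curvatureForm Γ x v w u) + l x (curvatureForm Γ x (J x w) v (J x u)) +
      l x (curvatureForm Γ x u w v) + l x (curvatureForm Γ x (J x w) u (J x v)) := by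
  have r := ricci_covector K.isOpen K.smooth_connection s.smooth_covector (K.torsion_free x hx) hx
  have hs := s.covDeriv_hessian_symm hE K hx
  have hh := s.covDeriv_hessian_hermitian hE K hx
  have hsq := (K.hermitian x hx).sq_eq_neg
  obtain ⟨N, hN⟩ : ∃ N : E → E → E → ℝ, ∀ w u v,
    N w u v = covDerivForm Γ (hessianForm Γ l) x w u v := ⟨_, fun _ _ _ => rfl⟩
  have hneg : ∀ w u v, N w (-u) v = -N w u v := fun w u v => by
    simp [hN, covDerivForm]; ring
  simp only [← hN] at r hs hh ⊢
  -- In the sum of the Ricci identities `r1` to `r4`, invariance under `J` and symmetry of `N w`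
  -- cancel every derivative of the Hessian except two equal copies of `N w u v`.
  have h1 := hh (J x w) (J x u) v
  rw [hsq, hneg] at h1
  have r1 := r (J x w) v (J x u)
  have r2 := r v w u
  have r3 := r (J x w) u (J x v)
  have r4 := r u w v
  have t1 := hs (J x w) (J x u) v
  have t2 := hh v w u
  have t3 := hs w v u
  have t4 := hh u w v
  linear_combination -r1 - r2 - r3 - r4 - h1 - t1 - t2 - t3 - t4

end LocalSolution

end Local

/-! ### Unique continuation in a chart -/

section Local

open ContinuousLinearMap Topology

set_option maxSynthPendingDepth 3

variable {E : Type*} [NormedAddCommGroup E] [NormedSpace ℝ E]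
variable {S : Set E} {G a a' : E → E →L[ℝ] E →L[ℝ] ℝ} {J : E → E →L[ℝ] E}
  {Γ : E → E →L[ℝ] E →L[ℝ] E} {l l' : E → E →L[ℝ] ℝ} {x : E}

/-- Grönwall's inequality along the segment from `y` to `z`, which stays in the convex set. -/
lemma eq_zero_of_norm_fderiv_le {F : Type*} [NormedAddCommGroup F] [NormedSpace ℝ F] {f : E → F}
    {s : Set E} {C : ℝ} (hs : Convex ℝ s) (hf : ∀ x ∈ s, DifferentiableAt ℝ f x)
    (hC : ∀ x ∈ s, ‖fderiv ℝ f x‖ ≤ C * ‖f x‖) {y z : E} (hy : y ∈ s) (hz : z ∈ s)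
    (h0 : f y = 0) : f z = 0 := by
  have hmem : ∀ t ∈ Set.Icc (0 : ℝ) 1, AffineMap.lineMap y z t ∈ s := fun t ht =>
    hs.lineMap_mem hy hz ht
  have hd : ∀ t ∈ Set.Icc (0 : ℝ) 1,
      HasDerivAt (fun t : ℝ => f (AffineMap.lineMap y z t))
        (fderiv ℝ f (AffineMap.lineMap y z t) (z - y)) t := fun t ht =>
    ((hf _ (hmem t ht)).hasFDerivAt).comp_hasDerivAt t AffineMap.hasDerivAt_lineMap
  have := eq_zero_of_abs_deriv_le_mul_abs_self_of_eq_zero_right (K := C * ‖z - y‖)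
    (f := fun t : ℝ => f (AffineMap.lineMap y z t)) (a := 0) (b := 1)
    (fun t ht => (hd t ht).continuousAt.continuousWithinAt)
    (fun t ht => (hd t (Set.Ico_subset_Icc_self ht)).hasDerivWithinAt) (by simpa using h0)
    (fun t ht => by
      have h1 := hC _ (hmem t (Set.Ico_subset_Icc_self ht))
      calc _ ≤ ‖fderiv ℝ f (AffineMap.lineMap y z t)‖ * ‖z - y‖ := le_opNorm _ _
        _ ≤ C * ‖f (AffineMap.lineMap y z t)‖ * ‖z - y‖ := by gcongr
        _ = _ := by ring) 1 (by simp)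
  simpa using this

lemma norm_apply₂_le {F H : Type*} [NormedAddCommGroup F] [NormedSpace ℝ F]
    [NormedAddCommGroup H] [NormedSpace ℝ H] (b : E →L[ℝ] F →L[ℝ] H) {M p q : ℝ} {u : E} {v : F}
    (hb : ‖b‖ ≤ M) (hu : ‖u‖ ≤ p) (hv : ‖v‖ ≤ q) : ‖b u v‖ ≤ M * p * q := by
  have hM := (norm_nonneg b).trans hb
  have hp := (norm_nonneg u).trans hu
  exact (b.le_opNorm₂ u v).trans (by gcongr)

lemma norm_apply_le {F H : Type*} [NormedAddCommGroup F] [NormedSpace ℝ F]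
    [NormedAddCommGroup H] [NormedSpace ℝ H] (b : F →L[ℝ] H) {M p : ℝ} {u : F}
    (hb : ‖b‖ ≤ M) (hu : ‖u‖ ≤ p) : ‖b u‖ ≤ M * p := by
  have hM := (norm_nonneg b).trans hb
  exact (b.le_opNorm u).trans (by gcongr)

lemma norm_fderiv_form_le {b : E → E →L[ℝ] E →L[ℝ] ℝ} {M U C : ℝ} (hΓ : ‖Γ x‖ ≤ M)
    (hb : ‖b x‖ ≤ U) (hC : 0 ≤ C)
    (hT : ∀ w u v, |covDerivForm Γ b x w u v| ≤ C * ‖w‖ * ‖u‖ * ‖v‖) :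
    ‖fderiv ℝ b x‖ ≤ 2 * M * U + C := by
  have hM := (norm_nonneg _).trans hΓ
  have hU := (norm_nonneg _).trans hb
  refine opNorm_le_bound _ (by positivity) fun w => ?_
  refine opNorm_le_bound₂ _ (by positivity) fun u v => ?_
  have h1 := norm_apply₂_le (b x) hb (norm_apply₂_le (Γ x) hΓ (le_refl ‖w‖) (le_refl ‖u‖))
    (le_refl ‖v‖)
  have h2 := norm_apply₂_le (b x) hb (le_refl ‖u‖)
    (norm_apply₂_le (Γ x) hΓ (le_refl ‖w‖) (le_refl ‖v‖))
  have h3 := hT w u v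
  have e : fderiv ℝ b x w u v =
      covDerivForm Γ b x w u v + b x (Γ x w u) v + b x u (Γ x w v) := by
    rw [covDerivForm]; ring
  rw [e]
  refine (norm_add₃_le).trans ?_
  rw [← Real.norm_eq_abs] at h3
  linarith

lemma abs_mobilityTensor_le {g : E →L[ℝ] E →L[ℝ] ℝ} {j : E →L[ℝ] E} {f : E →L[ℝ] ℝ} {M U : ℝ}
    (hg : ‖g‖ ≤ M) (hj : ‖j‖ ≤ M) (hf : ‖f‖ ≤ U) (w u v : E) :
    |mobilityTensor g j f u v w| ≤ (2 * M + 2 * M ^ 3) * U * ‖w‖ * ‖u‖ * ‖v‖ := by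
  have hM := (norm_nonneg _).trans hg
  have hU := (norm_nonneg _).trans hf
  have k1 : ∀ u v, |f u * g v w| ≤ U * ‖u‖ * (M * ‖v‖ * ‖w‖) := fun u v => by
    rw [abs_mul]
    have h1 := norm_apply_le f hf (le_refl ‖u‖)
    have h2 := norm_apply₂_le g hg (le_refl ‖v‖) (le_refl ‖w‖)
    rw [Real.norm_eq_abs] at h1 h2
    gcongr
  have k2 : ∀ u v, |f (j u) * g v (j w)| ≤ U * (M * ‖u‖) * (M * ‖v‖ * (M * ‖w‖)) := fun u v => by
    rw [abs_mul]
    have h1 := norm_apply_le f hf (norm_apply_le j hj (le_refl ‖u‖))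
    have h2 := norm_apply₂_le g hg (le_refl ‖v‖) (norm_apply_le j hj (le_refl ‖w‖))
    rw [Real.norm_eq_abs] at h1 h2
    gcongr
  rw [mobilityTensor]
  have t1 := abs_sub (f u * g v w + f v * g u w - f (j u) * g v (j w)) (f (j v) * g u (j w))
  have t2 := abs_sub (f u * g v w + f v * g u w) (f (j u) * g v (j w))
  have t3 := abs_add_le (f u * g v w) (f v * g u w)
  have := k1 u v
  have := k1 v u
  have := k2 u v
  have := k2 v u
  linarith

/-- Unique continuation for solutions of the mobility equation. -/
lemma LocalKahler.exists_ball_unique_continuation (K : LocalKahler S G J Γ)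
    (hE : Module.finrank ℝ E = 4) {x₀ : E} (hx₀ : x₀ ∈ S) :
    ∃ r > 0, Metric.ball x₀ r ⊆ S ∧ ∀ a l, LocalSolution S G J Γ a l → ∀ y ∈ Metric.ball x₀ r,
      (∀ᶠ z in 𝓝 y, a z = 0 ∧ l z = 0) → ∀ z ∈ Metric.ball x₀ r, a z = 0 ∧ l z = 0 := by
  have bound : ∀ {F : Type _} [NormedAddCommGroup F] [NormedSpace ℝ F] {f : E → F},
      ContDiffOn ℝ ∞ f S → ∀ᶠ x in 𝓝 x₀, ‖f x‖ ≤ ‖f x₀‖ + 1 := fun {F} _ _ {f} hf => by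
    have : ContinuousAt f x₀ := hf.continuousOn.continuousAt (K.isOpen.mem_nhds hx₀)
    filter_upwards [this.norm.eventually_lt_const (lt_add_one ‖f x₀‖)] with x hx using hx.le
  obtain ⟨M, hMG, hMJ, hMΓ, hMR⟩ : ∃ M, ‖G x₀‖ + 1 ≤ M ∧ ‖J x₀‖ + 1 ≤ M ∧ ‖Γ x₀‖ + 1 ≤ M ∧
      ‖curvatureForm Γ x₀‖ + 1 ≤ M :=
    ⟨‖G x₀‖ + ‖J x₀‖ + ‖Γ x₀‖ + ‖curvatureForm Γ x₀‖ + 1, by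
      have := norm_nonneg (G x₀)
      have := norm_nonneg (J x₀)
      have := norm_nonneg (Γ x₀)
      have := norm_nonneg (curvatureForm Γ x₀)
      refine ⟨?_, ?_, ?_, ?_⟩ <;> linarith⟩
  have ev := (K.isOpen.eventually_mem hx₀).and ((bound K.smooth_metric).and
    ((bound K.smooth_complex).and ((bound K.smooth_connection).and
    (bound (contDiffOn_curvatureForm K.isOpen K.smooth_connection)))))
  obtain ⟨r, hr, hball⟩ := Metric.eventually_nhds_iff_ball.mp ev
  refine ⟨r, hr, fun x hx => (hball x hx).1, fun a l s y hy h0 z hz => ?_⟩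
  have hL := contDiffOn_hessianForm K.isOpen K.smooth_connection s.smooth_covector
  -- The unknown of the closed system. On the ball `G`, `J`, `Γ` and the curvature are bounded by
  -- `M`, so each component of the derivative is bounded by a multiple of `‖f‖`.
  let f : E → (E →L[ℝ] E →L[ℝ] ℝ) × (E →L[ℝ] ℝ) × (E →L[ℝ] E →L[ℝ] ℝ) :=
    fun x => (a x, l x, hessianForm Γ l x)
  have hf : ∀ x ∈ Metric.ball x₀ r, HasFDerivAt f ((fderiv ℝ a x).prod
      ((fderiv ℝ l x).prod (fderiv ℝ (hessianForm Γ l) x))) x := fun x hx => by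
    have hxS := (hball x hx).1
    exact (differentiableAt_of_smooth K.isOpen s.smooth_form hxS).hasFDerivAt.prodMk
      ((differentiableAt_of_smooth K.isOpen s.smooth_covector hxS).hasFDerivAt.prodMk
      (differentiableAt_of_smooth K.isOpen hL hxS).hasFDerivAt)
  have hM : 0 ≤ M := by linarith [norm_nonneg (G x₀)]
  have hfz : f z = 0 := by
    -- The factors for the three components are `4M + 2M³`, `M + 1` and `3M + M³`; the chosen
    -- constant dominates all of them.
    refine eq_zero_of_norm_fderiv_le (C := 4 * M + 2 * M ^ 3 + 1) (convex_ball x₀ r)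
      (fun x hx => (hf x hx).differentiableAt) (fun x hx => ?_) hy hz ?_
    · obtain ⟨hxS, bG, bJ, bΓ, bR⟩ := hball x hx
      replace bG := bG.trans hMG
      replace bJ := bJ.trans hMJ
      replace bΓ := bΓ.trans hMΓ
      replace bR := bR.trans hMR
      rw [(hf x hx).fderiv]
      obtain ⟨U, hU⟩ : ∃ U, U = ‖f x‖ := ⟨_, rfl⟩
      rw [← hU]
      have hU0 : 0 ≤ U := hU ▸ norm_nonneg _
      have ba : ‖a x‖ ≤ U := hU ▸ norm_fst_le (f x)
      have bl : ‖l x‖ ≤ U := hU ▸ (norm_fst_le (f x).2).trans (norm_snd_le (f x))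
      have bL : ‖hessianForm Γ l x‖ ≤ U := hU ▸ (norm_snd_le (f x).2).trans (norm_snd_le (f x))
      have c1 : ‖fderiv ℝ a x‖ ≤ 2 * M * U + (2 * M + 2 * M ^ 3) * U :=
        norm_fderiv_form_le bΓ ba (by positivity) fun w u v => by
          rw [s.equation x hxS]
          exact abs_mobilityTensor_le bG bJ bl w u v
      have c2 : ‖fderiv ℝ l x‖ ≤ (M + 1) * U := by
        refine opNorm_le_bound₂ _ (by positivity) fun w u => ?_
        have e : fderiv ℝ l x w u = hessianForm Γ l x w u + l x (Γ x w u) := by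
          rw [hessianForm_apply]; ring
        rw [e]
        have h1 := norm_apply₂_le _ bL (le_refl ‖w‖) (le_refl ‖u‖)
        have h2 := norm_apply_le _ bl (norm_apply₂_le _ bΓ (le_refl ‖w‖) (le_refl ‖u‖))
        refine (norm_add_le _ _).trans ?_
        linarith
      have c3 : ‖fderiv ℝ (hessianForm Γ l) x‖ ≤ 2 * M * U + (M + M ^ 3) * U :=
        norm_fderiv_form_le bΓ bL (by positivity) fun w u v => by
          have h := s.covDeriv_hessian hE K hxS w u v
          have k : ∀ z w u : E, ∀ p q t : ℝ, ‖z‖ ≤ p → ‖w‖ ≤ q → ‖u‖ ≤ t →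
              |l x (curvatureForm Γ x z w u)| ≤ U * (M * p * q * t) :=
              fun z w u p q t hz hw hu => by
            have hp := (norm_nonneg _).trans hz
            have hq := (norm_nonneg _).trans hw
            exact norm_apply_le _ bl (norm_apply_le _ (norm_apply₂_le _ bR hz hw) hu)
          have hJ : ∀ u, ‖J x u‖ ≤ M * ‖u‖ := fun u => norm_apply_le _ bJ le_rfl
          have t1 := abs_le.mp (k v w u _ _ _ le_rfl le_rfl le_rfl)
          have t2 := abs_le.mp (k (J x w) v (J x u) _ _ _ (hJ w) le_rfl (hJ u))
          have t3 := abs_le.mp (k u w v _ _ _ le_rfl le_rfl le_rfl)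
          have t4 := abs_le.mp (k (J x w) u (J x v) _ _ _ (hJ w) le_rfl (hJ v))
          rw [abs_le]
          constructor
          · linarith [t1.1, t2.1, t3.1, t4.1]
          · linarith [t1.2, t2.2, t3.2, t4.2]
      have hMU : 0 ≤ M * U := by positivity
      have hM3U : 0 ≤ M ^ 3 * U := by positivity
      refine opNorm_le_bound _ (by positivity) fun w => ?_
      have d1 := norm_apply_le _ c1 (le_refl ‖w‖)
      have d2 := norm_apply_le _ c2 (le_refl ‖w‖)
      have d3 := norm_apply_le _ c3 (le_refl ‖w‖)
      simp only [prod_apply, Prod.norm_def]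
      refine max_le (d1.trans ?_) (max_le (d2.trans ?_) (d3.trans ?_))
      all_goals
        refine mul_le_mul_of_nonneg_right ?_ (norm_nonneg w)
        linarith
    -- Vanishing on a neighbourhood of `y`, not only at `y`, gives the zero initial value of the
    -- Hessian component.
    · have hl0 : l =ᶠ[𝓝 y] fun _ => 0 := h0.mono fun z hz => hz.2
      have ha0 := h0.self_of_nhds
      have hd0 : fderiv ℝ l y = 0 := by rw [hl0.fderiv_eq]; simp
      have hL0 : hessianForm Γ l y = 0 := by
        ext w u
        rw [hessianForm_apply, hd0, ha0.2]
        simp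
      simp only [f, ha0.1, ha0.2, hL0]
      rfl
  exact ⟨congrArg Prod.fst hfz, congrArg (fun p => p.2.1) hfz⟩

end Local

/-! ### Solutions dependent modulo the metric on an open set -/

section Local

open ContinuousLinearMap Topology

set_option maxSynthPendingDepth 3

variable {E : Type*} [NormedAddCommGroup E] [NormedSpace ℝ E]
variable {S : Set E} {G a a' : E → E →L[ℝ] E →L[ℝ] ℝ} {J : E → E →L[ℝ] E}
  {Γ : E → E →L[ℝ] E →L[ℝ] E} {l l' : E → E →L[ℝ] ℝ} {x : E}

lemma LocalKahler.metric_solution (K : LocalKahler S G J Γ) : LocalSolution S G J Γ G 0 where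
  smooth_form := K.smooth_metric
  smooth_covector := contDiffOn_const
  symm x hx := (K.hermitian x hx).symm
  hermitian x hx := (K.hermitian x hx).hermitian
  equation x hx w u v := by simp [K.metric x hx, mobilityTensor]

lemma differentiableAt_quotient {f h : E → ℝ} (hf : DifferentiableAt ℝ f x)
    (hh : DifferentiableAt ℝ h x) (h0 : h x ≠ 0) : DifferentiableAt ℝ (fun y => f y / h y) x := by
  simp only [div_eq_mul_inv]
  exact hf.fun_mul (hh.fun_inv h0)

lemma eventually_eq_of_fderiv_eq_zero {f : E → ℝ} {x₀ : E}
    (hf : ∀ᶠ y in 𝓝 x₀, DifferentiableAt ℝ f y ∧ fderiv ℝ f y = 0) :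
    ∀ᶠ y in 𝓝 x₀, f y = f x₀ := by
  obtain ⟨r, hr, hb⟩ := Metric.eventually_nhds_iff_ball.mp hf
  filter_upwards [Metric.ball_mem_nhds x₀ hr] with y hy
  exact Metric.isOpen_ball.is_const_of_fderiv_eq_zero (convex_ball x₀ r).isPreconnected
    (fun z hz => (hb z hz).1.differentiableWithinAt) (fun z hz => (hb z hz).2) hy
    (Metric.mem_ball_self hr)

/-- The covariant derivative of `f a + h g` is `df ⊗ a + dh ⊗ g + f ∇a`, because `g` is parallel.
Both `∇a'` and `∇a` are mobility tensors, which are linear in the covector. -/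
lemma LocalSolution.mobilityTensor_of_combination (s : LocalSolution S G J Γ a l)
    (s' : LocalSolution S G J Γ a' l') (K : LocalKahler S G J Γ) (hx : x ∈ S) {f h : E → ℝ}
    (hf : DifferentiableAt ℝ f x) (hh : DifferentiableAt ℝ h x)
    (he : ∀ᶠ y in 𝓝 x, a' y = f y • a y + h y • G y) (u v w : E) :
    mobilityTensor (G x) (J x) (l' x - f x • l x) u v w =
      fderiv ℝ f x w * a x u v + fderiv ℝ h x w * G x u v := by
  have da := differentiableAt_of_smooth K.isOpen s.smooth_form hx
  have dG := differentiableAt_of_smooth K.isOpen K.smooth_metric hx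
  have he' : a' =ᶠ[𝓝 x] fun y => f y • a y + h y • G y := he
  have hd : fderiv ℝ a' x w u v = f x * fderiv ℝ a x w u v + fderiv ℝ f x w * a x u v +
      (h x * fderiv ℝ G x w u v + fderiv ℝ h x w * G x u v) := by
    rw [he'.fderiv_eq,
      ((hf.hasFDerivAt.fun_smul da.hasFDerivAt).fun_add
        (hh.hasFDerivAt.fun_smul dG.hasFDerivAt)).fderiv]
    simp [smulRight_apply]
  have e1 := s.equation x hx w u v
  have e2 := s'.equation x hx w u v
  have e3 := K.metric x hx w u v
  rw [covDerivForm] at e1 e2 e3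
  rw [hd, he.self_of_nhds] at e2
  simp only [add_apply, smul_apply, smul_eq_mul] at e2
  simp only [mobilityTensor, sub_apply, smul_apply, smul_eq_mul] at e1 e2 ⊢
  linear_combination -e2 + f x * e1 + h x * e3

variable (hE : Module.finrank ℝ E = 4)
include hE

/-- Two solutions which are dependent modulo the metric at all points of an open set have a
combination with constant coefficients that vanishes near some point. -/
lemma exists_vanishing_combination (K : LocalKahler S G J Γ) (s : LocalSolution S G J Γ a l)
    (s' : LocalSolution S G J Γ a' l') {W : Set E} (hW : IsOpen W) (hWS : W ⊆ S)
    (hne : W.Nonempty) (hdep : ∀ x ∈ W, ¬LinearIndependent ℝ ![G x, a x, a' x]) :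
    ∃ x₀ ∈ W, ∃ c₀ c₁ c₂ : ℝ, ¬(c₀ = 0 ∧ c₁ = 0 ∧ c₂ = 0) ∧
      ∀ᶠ y in 𝓝 x₀, c₀ • G y + c₁ • a y + c₂ • a' y = 0 ∧ c₁ • l y + c₂ • l' y = 0 := by
  have exG : ∀ x ∈ S, ∃ u v, G x u v ≠ 0 := fun x hx => by
    obtain ⟨e₁, e₂, F⟩ := (K.hermitian x hx).exists_adaptedFrame hE
    exact ⟨e₁, e₁, F.ne₁⟩
  have cont : ∀ {b : E → E →L[ℝ] E →L[ℝ] ℝ}, ContDiffOn ℝ ∞ b S → ∀ u v, ∀ x ∈ S,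
      DifferentiableAt ℝ (fun y => b y u v) x := fun hb u v x hx => by
    have := differentiableAt_of_smooth K.isOpen hb hx
    fun_prop
  -- If `a = h g` on all of `W`, then `h` is locally constant and `a - h(x₀) g` is the vanishing
  -- combination; `a'` plays no role.
  by_cases hcase : ∀ x ∈ W, ∃ c : ℝ, a x = c • G x
  · obtain ⟨x₀, hx₀⟩ := hne
    obtain ⟨u, v, huv⟩ := exG x₀ (hWS hx₀)
    let h : E → ℝ := fun y => a y u v / G y u v
    have ev : ∀ᶠ y in 𝓝 x₀, y ∈ W ∧ G y u v ≠ 0 := (hW.eventually_mem hx₀).and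
      ((cont K.smooth_metric u v x₀ (hWS hx₀)).continuousAt.eventually_ne huv)
    have ev2 : ∀ᶠ y in 𝓝 x₀, a y = (0 : ℝ) • G y + h y • G y := by
      filter_upwards [ev] with y hy
      obtain ⟨c, hc⟩ := hcase y hy.1
      have : h y = c := by
        simp only [h, hc, smul_apply, smul_eq_mul]
        field_simp [hy.2]
      rw [this, zero_smul, zero_add, hc]
    have key : ∀ᶠ y in 𝓝 x₀, (DifferentiableAt ℝ h y ∧ fderiv ℝ h y = 0) ∧ l y = 0 := by
      filter_upwards [ev, ev2.eventually_nhds] with y hy hy2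
      have hyS := hWS hy.1
      have hd : DifferentiableAt ℝ h y :=
        differentiableAt_quotient (cont s.smooth_form u v y hyS)
          (cont K.smooth_metric u v y hyS) hy.2
      obtain ⟨e₁, e₂, F⟩ := (K.hermitian y hyS).exists_adaptedFrame hE
      -- The metric, with covector zero, takes the role of the first solution here, and `a` that of
      -- the second.
      have := K.metric_solution.mobilityTensor_of_combination s K hyS (f := fun _ => 0) (h := h)
        (differentiableAt_const _) hd hy2
      obtain ⟨h1, h2⟩ := F.eq_zero_of_mobilityTensor_eq_smul (K.hermitian y hyS)
        (l := l y) (η := fderiv ℝ h y) (fun u v w => by simpa using this u v w)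
      exact ⟨⟨hd, h2⟩, h1⟩
    have hconst := eventually_eq_of_fderiv_eq_zero (key.mono fun y hy => hy.1)
    refine ⟨x₀, hx₀, -h x₀, 1, 0, by simp, ?_⟩
    filter_upwards [hconst, key, ev2] with y h1 h2 h3
    rw [h2.2, h3, h1]
    simp
  · push Not at hcase
    obtain ⟨x₀, hx₀, hna⟩ := hcase
    obtain ⟨u₂, v₂, h₂⟩ := exG x₀ (hWS hx₀)
    -- Two pairs of vectors on which `a` and `G` have a nonzero determinant; it stays nonzero near
    -- `x₀`.
    obtain ⟨u₁, v₁, hΔ⟩ : ∃ u₁ v₁, a x₀ u₁ v₁ * G x₀ u₂ v₂ - a x₀ u₂ v₂ * G x₀ u₁ v₁ ≠ 0 := by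
      by_contra! hc
      refine hna (a x₀ u₂ v₂ / G x₀ u₂ v₂) ?_
      ext u v
      have := hc u v
      simp only [smul_apply, smul_eq_mul]
      field_simp
      linarith
    let Δ : E → ℝ := fun y => a y u₁ v₁ * G y u₂ v₂ - a y u₂ v₂ * G y u₁ v₁
    -- `f` and `h` are Cramer's formulas for the coefficients in `a' = f a + h G`, which shows that
    -- they are differentiable.
    let f : E → ℝ := fun y => (a' y u₁ v₁ * G y u₂ v₂ - a' y u₂ v₂ * G y u₁ v₁) / Δ y
    let h : E → ℝ := fun y => (a y u₁ v₁ * a' y u₂ v₂ - a y u₂ v₂ * a' y u₁ v₁) / Δ y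
    have dΔ : ∀ x ∈ S, DifferentiableAt ℝ Δ x := fun x hx =>
      ((cont s.smooth_form u₁ v₁ x hx).fun_mul (cont K.smooth_metric u₂ v₂ x hx)).fun_sub
        ((cont s.smooth_form u₂ v₂ x hx).fun_mul (cont K.smooth_metric u₁ v₁ x hx))
    have ev : ∀ᶠ y in 𝓝 x₀, y ∈ W ∧ Δ y ≠ 0 := (hW.eventually_mem hx₀).and
      ((dΔ x₀ (hWS hx₀)).continuousAt.eventually_ne hΔ)
    have hny : ∀ y, Δ y ≠ 0 → ∀ c : ℝ, a y ≠ c • G y := fun y hy c hc => hy <| by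
      simp only [Δ, hc, smul_apply, smul_eq_mul]; ring
    have ev2 : ∀ᶠ y in 𝓝 x₀, a' y = f y • a y + h y • G y := by
      filter_upwards [ev] with y hy
      have hdy := hdep y hy.1
      rw [linearIndependent_triple_iff (W := E →L[ℝ] E →L[ℝ] ℝ)] at hdy
      push Not at hdy
      obtain ⟨c₀, c₁, c₂, hc, hn⟩ := hdy
      have hcuv : ∀ u v, c₀ * G y u v + c₁ * a y u v + c₂ * a' y u v = 0 := fun u v => by
        have := congrArg (fun b => b u v) hc
        simpa using this
      have hc₂ : c₂ ≠ 0 := fun hc₂ => by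
        have hc₁ : c₁ = 0 := by
          by_contra hc₁
          refine hny y hy.2 (-c₀ / c₁) ?_
          ext u v
          have := hcuv u v
          simp only [smul_apply, smul_eq_mul]
          field_simp
          rw [hc₂] at this
          linarith
        obtain ⟨u, v, huv⟩ := exG y (hWS hy.1)
        have := hcuv u v
        rw [hc₁, hc₂] at this
        have hc₀ : c₀ = 0 := by simpa [huv] using this
        exact hn hc₀ hc₁ hc₂
      have ha' : ∀ u v, a' y u v = -c₁ / c₂ * a y u v + -c₀ / c₂ * G y u v := fun u v => by
        have := hcuv u v
        field_simp
        linarith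
      have hf : f y = -c₁ / c₂ := by
        simp only [f]
        rw [div_eq_iff hy.2, ha', ha']
        simp only [Δ]
        ring
      have hh : h y = -c₀ / c₂ := by
        simp only [h]
        rw [div_eq_iff hy.2, ha', ha']
        simp only [Δ]
        ring
      ext u v
      rw [ha', hf, hh]
      simp
    have key : ∀ᶠ y in 𝓝 x₀, (DifferentiableAt ℝ f y ∧ fderiv ℝ f y = 0) ∧
        (DifferentiableAt ℝ h y ∧ fderiv ℝ h y = 0) ∧ l' y - f y • l y = 0 := by
      filter_upwards [ev, ev2.eventually_nhds] with y hy hy2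
      have hyS := hWS hy.1
      have hfd : DifferentiableAt ℝ f y :=
        differentiableAt_quotient (((cont s'.smooth_form u₁ v₁ y hyS).fun_mul
          (cont K.smooth_metric u₂ v₂ y hyS)).fun_sub
        ((cont s'.smooth_form u₂ v₂ y hyS).fun_mul (cont K.smooth_metric u₁ v₁ y hyS)))
        (dΔ y hyS) hy.2
      have hhd : DifferentiableAt ℝ h y :=
        differentiableAt_quotient (((cont s.smooth_form u₁ v₁ y hyS).fun_mul
          (cont s'.smooth_form u₂ v₂ y hyS)).fun_sub
        ((cont s.smooth_form u₂ v₂ y hyS).fun_mul (cont s'.smooth_form u₁ v₁ y hyS)))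
        (dΔ y hyS) hy.2
      obtain ⟨e₁, e₂, F⟩ := (K.hermitian y hyS).exists_adaptedFrame hE
      obtain ⟨h1, h2, h3⟩ := F.eq_zero_of_mobilityTensor_eq (K.hermitian y hyS) (s.symm y hyS)
        (s.hermitian y hyS) (hny y hy.2)
        (s.mobilityTensor_of_combination s' K hyS hfd hhd hy2)
      exact ⟨⟨hfd, h2⟩, ⟨hhd, h3⟩, h1⟩
    have cf := eventually_eq_of_fderiv_eq_zero (key.mono fun y hy => hy.1)
    have ch := eventually_eq_of_fderiv_eq_zero (key.mono fun y hy => hy.2.1)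
    refine ⟨x₀, hx₀, -h x₀, -f x₀, 1, by simp, ?_⟩
    filter_upwards [cf, ch, key, ev2] with y h1 h2 h3 h4
    rw [← h1, ← h2, h4]
    constructor
    · ext u v
      simp only [add_apply, smul_apply, smul_eq_mul, zero_apply]
      ring
    · rw [one_smul, neg_smul, neg_add_eq_sub]
      exact h3.2.2

end Local

/-! ### Schur's lemma and local constancy of the curvature constant -/

section Local

open ContinuousLinearMap Topology

set_option maxSynthPendingDepth 3

variable {E : Type*} [NormedAddCommGroup E] [NormedSpace ℝ E]
variable {S : Set E} {G a a' : E → E →L[ℝ] E →L[ℝ] ℝ} {J : E → E →L[ℝ] E}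
  {Γ : E → E →L[ℝ] E →L[ℝ] E} {l l' : E → E →L[ℝ] ℝ} {x : E}

/-- At the point `x`, the curvature has constant holomorphic sectional curvature `-4B`, and
`∇λ = μ g + B a` for every solution of the integrability condition. -/
def HasConstantAt (G : E → E →L[ℝ] E →L[ℝ] ℝ) (J : E → E →L[ℝ] E)
    (Γ : E → E →L[ℝ] E →L[ℝ] E) (x : E) (B : ℝ) : Prop :=
  (∀ z w u, curvatureForm Γ x z w u = -B • modelCurvature (G x) (J x) z w u) ∧
    ∀ b N : E →L[ℝ] E →L[ℝ] ℝ, Integrability (G x) (J x) (curvatureForm Γ x) b N →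
      ∃ μ : ℝ, N = μ • G x + B • b

lemma LocalSolution.exists_hasConstantAt (s : LocalSolution S G J Γ a l)
    (s' : LocalSolution S G J Γ a' l') (K : LocalKahler S G J Γ) (hE : Module.finrank ℝ E = 4)
    (hx : x ∈ S) (hli : LinearIndependent ℝ ![G x, a x, a' x]) : ∃ B, HasConstantAt G J Γ x B :=
  exists_constant_curvature (s.integrability K hx) (s'.integrability K hx) (K.curvatureLike hx)
    (K.hermitian x hx) hE hli

lemma isOpen_independent (hS : IsOpen S) {b₀ b₁ b₂ : E → E →L[ℝ] E →L[ℝ] ℝ}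
    (h₀ : ContDiffOn ℝ ∞ b₀ S) (h₁ : ContDiffOn ℝ ∞ b₁ S) (h₂ : ContDiffOn ℝ ∞ b₂ S) :
    IsOpen {x ∈ S | LinearIndependent ℝ ![b₀ x, b₁ x, b₂ x]} := by
  have hc : ContinuousOn (fun x => ![b₀ x, b₁ x, b₂ x]) S := by
    refine continuousOn_pi.mpr fun i => ?_
    fin_cases i
    · exact h₀.continuousOn
    · exact h₁.continuousOn
    · exact h₂.continuousOn
  exact hc.isOpen_inter_preimage hS
    (isOpen_setOfPred_linearIndependent (𝕜 := ℝ) (E := E →L[ℝ] E →L[ℝ] ℝ) (ι := Fin 3))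

/-- Schur's lemma: the constant `B` does not depend on the point. -/
lemma fderiv_eq_zero_of_hasConstantAt (K : LocalKahler S G J Γ) (s : LocalSolution S G J Γ a l)
    (hE : Module.finrank ℝ E = 4) (hx : x ∈ S) (ha : ∀ c : ℝ, a x ≠ c • G x) {β : E → ℝ}
    (hβ : DifferentiableAt ℝ β x) (hc : ∀ᶠ y in 𝓝 x, HasConstantAt G J Γ y (β y)) :
    fderiv ℝ β x = 0 := by
  obtain ⟨e₁, e₂, F⟩ := (K.hermitian x hx).exists_adaptedFrame hE
  have hL := contDiffOn_hessianForm K.isOpen K.smooth_connection s.smooth_covector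
  have dL := differentiableAt_of_smooth K.isOpen hL hx
  have da := differentiableAt_of_smooth K.isOpen s.smooth_form hx
  have dG := differentiableAt_of_smooth K.isOpen K.smooth_metric hx
  -- The existence statement gives `μ` only pointwise. Evaluation on a vector that is non-null at
  -- `x` makes it a differentiable function near `x`.
  let μ : E → ℝ := fun y => (hessianForm Γ l y e₁ e₁ - β y * a y e₁ e₁) / G y e₁ e₁
  have dμ : DifferentiableAt ℝ μ x :=
    differentiableAt_quotient (by fun_prop) (by fun_prop) F.ne₁
  have ev : ∀ᶠ y in 𝓝 x, hessianForm Γ l y = μ y • G y + β y • a y := by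
    have hGne : ∀ᶠ y in 𝓝 x, G y e₁ e₁ ≠ 0 := by
      have : DifferentiableAt ℝ (fun y => G y e₁ e₁) x := by fun_prop
      exact this.continuousAt.eventually_ne F.ne₁
    filter_upwards [hc, hGne, K.isOpen.eventually_mem hx] with y hy h0 hyS
    obtain ⟨m, hm⟩ := hy.2 _ _ (s.integrability K hyS)
    have : μ y = m := by
      simp only [μ, hm, add_apply, smul_apply, smul_eq_mul]
      field_simp
      ring
    rw [this, hm]
  have hd : ∀ w u v, covDerivForm Γ (hessianForm Γ l) x w u v =
      fderiv ℝ μ x w * G x u v + fderiv ℝ β x w * a x u v +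
        β x * mobilityTensor (G x) (J x) (l x) u v w := by
    intro w u v
    have e : hessianForm Γ l =ᶠ[𝓝 x] fun y => μ y • G y + β y • a y := ev
    have e1 := s.equation x hx w u v
    have e3 := K.metric x hx w u v
    rw [covDerivForm] at e1 e3 ⊢
    rw [e.fderiv_eq, ((dμ.hasFDerivAt.fun_smul dG.hasFDerivAt).fun_add
        (hβ.hasFDerivAt.fun_smul da.hasFDerivAt)).fderiv, ev.self_of_nhds]
    simp only [add_apply, smul_apply, smul_eq_mul, smulRight_apply]
    linear_combination β x * e1 + μ x * e3
  have r := ricci_covector K.isOpen K.smooth_connection s.smooth_covector (K.torsion_free x hx) hx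
  -- The model curvature and the skew part of `β` times the mobility tensor each contribute `-β l`
  -- to the factor wedged with `g`, and their terms with `J` cancel. This accounts for `dμ - 2β l`.
  refine F.eq_zero_of_wedge_eq_zero (K.hermitian x hx) (s.symm x hx) (s.hermitian x hx) ha
    (τ := fderiv ℝ μ x - (2 * β x) • l x) fun z w u => ?_
  have := r z w u
  rw [hd, hd, hc.self_of_nhds.1] at this
  have hg := K.hermitian x hx
  have k1 : ∀ u v, G x (J x u) v = -G x u (J x v) := hg.apply_J_left
  have k2 : G x z (J x u) = -G x u (J x z) := by rw [hg.symm z, k1]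
  have k3 : G x w (J x u) = -G x u (J x w) := by rw [hg.symm w, k1]
  have k4 : G x w (J x z) = -G x z (J x w) := by rw [hg.symm w, k1]
  simp only [modelCurvature, mobilityTensor, map_add, map_sub, map_smul, smul_eq_mul, k1, k2, k3,
    k4, hg.symm u z, hg.symm u w, hg.symm w z] at this
  simp only [sub_apply, smul_apply, smul_eq_mul]
  linear_combination this

/-- The set of independent points may be disconnected near `x₀`. Therefore `B` is replaced by a
curvature expression `β` that is smooth on a whole ball; its derivative vanishes on a dense subset,
hence everywhere. -/
lemma exists_locally_constant (K : LocalKahler S G J Γ) (s : LocalSolution S G J Γ a l)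
    (s' : LocalSolution S G J Γ a' l') (hE : Module.finrank ℝ E = 4)
    (hdense : S ⊆ closure {x ∈ S | LinearIndependent ℝ ![G x, a x, a' x]}) {x₀ : E}
    (hx₀ : x₀ ∈ S) :
    ∃ B : ℝ, ∀ᶠ x in 𝓝 x₀, LinearIndependent ℝ ![G x, a x, a' x] → HasConstantAt G J Γ x B := by
  obtain ⟨e₁, e₂, F⟩ := (K.hermitian x₀ hx₀).exists_adaptedFrame hE
  have hR := contDiffOn_curvatureForm K.isOpen K.smooth_connection
  -- A quarter of the negative holomorphic sectional curvature of the plane spanned by `e₁` and `J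
  -- e₁`, with `e₁` fixed near `x₀`.
  let β : E → ℝ := fun x =>
    -(G x (curvatureForm Γ x e₁ (J x e₁) (J x e₁)) e₁) / (4 * (G x e₁ e₁) ^ 2)
  have ev : ∀ᶠ x in 𝓝 x₀, x ∈ S ∧ G x e₁ e₁ ≠ 0 := by
    have := differentiableAt_of_smooth K.isOpen K.smooth_metric hx₀
    have : DifferentiableAt ℝ (fun y => G y e₁ e₁) x₀ := by fun_prop
    exact (K.isOpen.eventually_mem hx₀).and (this.continuousAt.eventually_ne F.ne₁)
  obtain ⟨r, hr, hb⟩ := Metric.eventually_nhds_iff_ball.mp ev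
  have hβ : ContDiffOn ℝ ∞ β (Metric.ball x₀ r) := by
    have hsub : Metric.ball x₀ r ⊆ S := fun x hx => (hb x hx).1
    have c1 := hR.mono hsub
    have c2 := K.smooth_metric.mono hsub
    have c3 := K.smooth_complex.mono hsub
    refine ContDiffOn.div ?_ ?_ fun x hx => by
      have := (hb x hx).2
      positivity
    · have c4 := c3.clm_apply (contDiffOn_const (c := e₁))
      exact ((c2.clm_apply (((c1.clm_apply contDiffOn_const).clm_apply c4).clm_apply
        c4)).clm_apply contDiffOn_const).neg
    · fun_prop
  have hval : ∀ x ∈ Metric.ball x₀ r, ∀ B, HasConstantAt G J Γ x B → B = β x := by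
    intro x hx B hB
    have hg := K.hermitian x (hb x hx).1
    have h0 := (hb x hx).2
    simp only [β, hB.1]
    rw [map_smul, smul_apply, modelCurvature_apply, hg.hermitian, hg.apply_J_self]
    simp only [hg.sq_eq_neg, map_neg, neg_apply, hg.apply_J_left, hg.apply_J_self, smul_eq_mul]
    field_simp
    ring
  let W := Metric.ball x₀ r ∩ {x ∈ S | LinearIndependent ℝ ![G x, a x, a' x]}
  have hW : IsOpen W := Metric.isOpen_ball.inter
    (isOpen_independent K.isOpen K.smooth_metric s.smooth_form s'.smooth_form)
  have hconst : ∀ x ∈ W, HasConstantAt G J Γ x (β x) := fun x hx => by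
    obtain ⟨B, hB⟩ := s.exists_hasConstantAt s' K hE hx.2.1 hx.2.2
    rwa [← hval x hx.1 B hB]
  have hdW : ∀ x ∈ W, fderiv ℝ β x = 0 := fun x hx => by
    refine fderiv_eq_zero_of_hasConstantAt K s hE hx.2.1 (fun c hc => ?_)
      (differentiableAt_of_smooth Metric.isOpen_ball hβ hx.1)
      ((hW.eventually_mem hx).mono fun y hy => hconst y hy)
    have := (linearIndependent_triple_iff (W := E →L[ℝ] E →L[ℝ] ℝ)).mp hx.2.2 (-c) 1 0
      (by rw [hc]; ext u v; simp)
    exact one_ne_zero this.2.1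
  have hd : ∀ x ∈ Metric.ball x₀ r, fderiv ℝ β x = 0 := by
    intro x hx
    have hcont := (contDiffOn_fderiv Metric.isOpen_ball hβ).continuousOn
    by_contra hne
    have hopen : IsOpen (Metric.ball x₀ r ∩ fderiv ℝ β ⁻¹' {0}ᶜ) :=
      hcont.isOpen_inter_preimage Metric.isOpen_ball isOpen_compl_singleton
    obtain ⟨y, ⟨hy1, hy2⟩, hy3⟩ := mem_closure_iff.mp (hdense (hb x hx).1) _ hopen ⟨hx, hne⟩
    exact hy2 (hdW y ⟨hy1, hy3⟩)
  refine ⟨β x₀, ?_⟩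
  filter_upwards [Metric.ball_mem_nhds x₀ hr] with x hx hli
  rw [← Metric.isOpen_ball.is_const_of_fderiv_eq_zero (convex_ball x₀ r).isPreconnected
    (fun z hz => (differentiableAt_of_smooth Metric.isOpen_ball hβ hz).differentiableWithinAt)
    (fun z hz => hd z hz) hx (Metric.mem_ball_self hr)]
  exact hconst x ⟨hx, (hb x hx).1, hli⟩

end Local

/-! ### Tensor fields on the manifold read in a chart -/

section Bridge

open ContinuousLinearMap Topology

set_option maxSynthPendingDepth 3

variable {m : ℕ} {M : Type*} [TopologicalSpace M] [ChartedSpace (EuclideanSpace ℝ (Fin m)) M]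

/-- The `i`-th standard basis vector. -/
abbrev basisVec (i : Fin m) : EuclideanSpace ℝ (Fin m) := EuclideanSpace.single i (1 : ℝ)

/-- A field of bilinear forms in the chart `e`. -/
def chartForm (a : BilinField m M) (e : OpenPartialHomeomorph M (EuclideanSpace ℝ (Fin m)))
    (x : EuclideanSpace ℝ (Fin m)) :
    EuclideanSpace ℝ (Fin m) →L[ℝ] EuclideanSpace ℝ (Fin m) →L[ℝ] ℝ :=
  ∑ i, ∑ j, comp₂ a e i j x •
    (EuclideanSpace.proj i : EuclideanSpace ℝ (Fin m) →L[ℝ] ℝ).smulRight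
      (EuclideanSpace.proj j : EuclideanSpace ℝ (Fin m) →L[ℝ] ℝ)

/-- A covector field in the chart `e`. -/
def chartCovector (l : CovectorField m M) (e : OpenPartialHomeomorph M (EuclideanSpace ℝ (Fin m)))
    (x : EuclideanSpace ℝ (Fin m)) : EuclideanSpace ℝ (Fin m) →L[ℝ] ℝ :=
  ∑ i, comp₁ l e i x • (EuclideanSpace.proj i : EuclideanSpace ℝ (Fin m) →L[ℝ] ℝ)

/-- A field of endomorphisms in the chart `e`. -/
def chartEndo (J : EndoField m M) (e : OpenPartialHomeomorph M (EuclideanSpace ℝ (Fin m)))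
    (x : EuclideanSpace ℝ (Fin m)) : EuclideanSpace ℝ (Fin m) →L[ℝ] EuclideanSpace ℝ (Fin m) :=
  ∑ i, ∑ j, compEndo J e i j x •
    (EuclideanSpace.proj j : EuclideanSpace ℝ (Fin m) →L[ℝ] ℝ).smulRight (basisVec i)

/-- The Levi-Civita connection in the chart `e`. -/
def chartConnection (g : BilinField m M) (e : OpenPartialHomeomorph M (EuclideanSpace ℝ (Fin m)))
    (x : EuclideanSpace ℝ (Fin m)) : EuclideanSpace ℝ (Fin m) →L[ℝ]
      EuclideanSpace ℝ (Fin m) →L[ℝ] EuclideanSpace ℝ (Fin m) :=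
  ∑ k, ∑ i, ∑ j, christoffel g e k i j x •
    (EuclideanSpace.proj i : EuclideanSpace ℝ (Fin m) →L[ℝ] ℝ).smulRight
      ((EuclideanSpace.proj j : EuclideanSpace ℝ (Fin m) →L[ℝ] ℝ).smulRight (basisVec k))

variable {e : OpenPartialHomeomorph M (EuclideanSpace ℝ (Fin m))} {x : EuclideanSpace ℝ (Fin m)}

lemma chartForm_basisVec (a : BilinField m M) (i j : Fin m) :
    chartForm a e x (basisVec i) (basisVec j) = comp₂ a e i j x := by
  simp [chartForm, sum_apply, PiLp.single_apply]

lemma chartCovector_basisVec (l : CovectorField m M) (i : Fin m) :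
    chartCovector l e x (basisVec i) = comp₁ l e i x := by
  simp [chartCovector, sum_apply, PiLp.single_apply]

lemma chartEndo_basisVec (J : EndoField m M) (j : Fin m) :
    chartEndo J e x (basisVec j) = ∑ i, compEndo J e i j x • basisVec i := by
  simp [chartEndo, sum_apply, PiLp.single_apply]

lemma chartConnection_basisVec (g : BilinField m M) (i j : Fin m) :
    chartConnection g e x (basisVec i) (basisVec j) =
      ∑ k, christoffel g e k i j x • basisVec k := by
  simp [chartConnection, sum_apply, PiLp.single_apply]

lemma sum_smul_basisVec (ξ : Fin m → ℝ) : ∑ i, ξ i • basisVec i = WithLp.toLp 2 ξ := by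
  ext i
  simp [Pi.single_apply]

lemma eq_sum_basisVec (v : EuclideanSpace ℝ (Fin m)) : v = ∑ i, v i • basisVec i := by
  ext i
  simp [Pi.single_apply]

/-- With its two- and three-variable versions, the passage from index identities on basis vectors to
identities of multilinear maps. Linearity is a predicate on functions, so that it applies to
expressions that are not bundled maps. -/
lemma eq_zero_of_basisVec₁ {F : Type*} [AddCommGroup F] [Module ℝ F]
    {f : EuclideanSpace ℝ (Fin m) → F} (hf : IsLinearMap ℝ f) (h0 : ∀ i, f (basisVec i) = 0)
    (v : EuclideanSpace ℝ (Fin m)) : f v = 0 := by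
  rw [eq_sum_basisVec v]
  have : f (∑ i, v i • basisVec i) = hf.mk' f (∑ i, v i • basisVec i) := rfl
  rw [this, map_sum]
  exact Finset.sum_eq_zero fun i _ => by
    rw [map_smul, IsLinearMap.mk'_apply, h0, smul_zero]

lemma eq_zero_of_basisVec₂ {F : Type*} [AddCommGroup F] [Module ℝ F]
    {f : EuclideanSpace ℝ (Fin m) → EuclideanSpace ℝ (Fin m) → F}
    (hf : ∀ v, IsLinearMap ℝ (fun u => f u v)) (hf' : ∀ u, IsLinearMap ℝ (f u))
    (h0 : ∀ i j, f (basisVec i) (basisVec j) = 0) (u v : EuclideanSpace ℝ (Fin m)) : f u v = 0 :=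
  eq_zero_of_basisVec₁ (hf v) (fun i => eq_zero_of_basisVec₁ (hf' _) (h0 i) v) u

lemma eq_zero_of_basisVec₃ {F : Type*} [AddCommGroup F] [Module ℝ F]
    {f : EuclideanSpace ℝ (Fin m) → EuclideanSpace ℝ (Fin m) → EuclideanSpace ℝ (Fin m) → F}
    (hf : ∀ v w, IsLinearMap ℝ (fun u => f u v w)) (hf' : ∀ u w, IsLinearMap ℝ (fun v => f u v w))
    (hf'' : ∀ u v, IsLinearMap ℝ (f u v))
    (h0 : ∀ i j k, f (basisVec i) (basisVec j) (basisVec k) = 0)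
    (u v w : EuclideanSpace ℝ (Fin m)) : f u v w = 0 :=
  eq_zero_of_basisVec₁ (hf v w)
    (fun i => eq_zero_of_basisVec₂ (hf' _) (hf'' _) (h0 i) v w) u

/-- The derivative of the inverse of the chart. -/
def chartDeriv (e : OpenPartialHomeomorph M (EuclideanSpace ℝ (Fin m)))
    (x : EuclideanSpace ℝ (Fin m)) :
    EuclideanSpace ℝ (Fin m) →L[ℝ] TangentSpace (𝓡 m) (e.symm x) :=
  mfderiv (𝓡 m) (𝓡 m) e.symm x

/-- The derivative of the chart. -/
def chartDerivInv (e : OpenPartialHomeomorph M (EuclideanSpace ℝ (Fin m)))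
    (x : EuclideanSpace ℝ (Fin m)) :
    TangentSpace (𝓡 m) (e.symm x) →L[ℝ] EuclideanSpace ℝ (Fin m) :=
  mfderiv (𝓡 m) (𝓡 m) e (e.symm x)

lemma chartForm_apply (a : BilinField m M) (u v : EuclideanSpace ℝ (Fin m)) :
    chartForm a e x u v = a (e.symm x) (chartDeriv e x u) (chartDeriv e x v) := by
  rw [← sub_eq_zero]
  refine eq_zero_of_basisVec₂ (f := fun u v => chartForm a e x u v -
    a (e.symm x) (chartDeriv e x u) (chartDeriv e x v)) (fun v => ⟨?_, ?_⟩) (fun u => ⟨?_, ?_⟩)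
    (fun i j => ?_) u v
  · intros; simp; ring
  · intros; simp; ring
  · intros; simp; ring
  · intros; simp; ring
  · rw [chartForm_basisVec]
    exact sub_self _

lemma chartCovector_apply (l : CovectorField m M) (u : EuclideanSpace ℝ (Fin m)) :
    chartCovector l e x u = l (e.symm x) (chartDeriv e x u) := by
  rw [← sub_eq_zero]
  refine eq_zero_of_basisVec₁ (f := fun u => chartCovector l e x u -
    l (e.symm x) (chartDeriv e x u)) ⟨?_, ?_⟩ (fun i => ?_) u
  · intros; simp; ring
  · intros; simp; ring
  · rw [chartCovector_basisVec]
    exact sub_self _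

lemma chartEndo_apply (J : EndoField m M) (u : EuclideanSpace ℝ (Fin m)) :
    chartEndo J e x u = chartDerivInv e x (J (e.symm x) (chartDeriv e x u)) := by
  rw [← sub_eq_zero]
  refine eq_zero_of_basisVec₁ (f := fun u => chartEndo J e x u -
    chartDerivInv e x (J (e.symm x) (chartDeriv e x u))) ⟨?_, ?_⟩ (fun i => ?_) u
  · intros; simp; abel
  · intros; simp [smul_sub]
  · rw [chartEndo_basisVec, sub_eq_zero]
    conv_rhs => rw [eq_sum_basisVec (chartDerivInv e x _)]
    rfl

lemma mdifferentiable_of_mem_charts (he : e ∈ charts m M) : e.MDifferentiable (𝓡 m) (𝓡 m) :=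
  ⟨fun x hx => ((contMDiffOn_of_mem_maximalAtlas he).mdifferentiableOn (by simp)) x hx,
    fun x hx => ((contMDiffOn_symm_of_mem_maximalAtlas he).mdifferentiableOn (by simp)) x hx⟩

lemma chartDerivInv_chartDeriv (he : e ∈ charts m M) (hx : x ∈ e.target)
    (u : EuclideanSpace ℝ (Fin m)) : chartDerivInv e x (chartDeriv e x u) = u :=
  congrArg (fun A : EuclideanSpace ℝ (Fin m) →L[ℝ] EuclideanSpace ℝ (Fin m) => A u)
    ((mdifferentiable_of_mem_charts he).comp_symm_deriv hx)

lemma chartDeriv_chartDerivInv (he : e ∈ charts m M) (hx : x ∈ e.target)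
    (u : TangentSpace (𝓡 m) (e.symm x)) : chartDeriv e x (chartDerivInv e x u) = u := by
  -- A left inverse gives injectivity, and equal finite dimensions then give surjectivity.
  have hinj : Function.Injective (chartDeriv e x).toLinearMap := fun u v huv => by
    rw [← chartDerivInv_chartDeriv he hx u, ← chartDerivInv_chartDeriv he hx v]
    exact congrArg _ huv
  have hsurj : Function.Surjective (chartDeriv e x).toLinearMap :=
    LinearMap.surjective_of_injective (V := EuclideanSpace ℝ (Fin m)) hinj
  obtain ⟨v, hv⟩ := hsurj u
  have hv' : chartDeriv e x v = u := hv
  rw [← hv', chartDerivInv_chartDeriv he hx]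

end Bridge

/-! ### Kähler structures and solutions in a chart -/

section BridgeStructures

open ContinuousLinearMap Topology

set_option maxSynthPendingDepth 3

variable {m : ℕ} {M : Type*} [TopologicalSpace M] [ChartedSpace (EuclideanSpace ℝ (Fin m)) M]
  {e : OpenPartialHomeomorph M (EuclideanSpace ℝ (Fin m))} {x : EuclideanSpace ℝ (Fin m)}

lemma contDiffOn_det {E : Type*} [NormedAddCommGroup E] [NormedSpace ℝ E] {S : Set E} {n : ℕ}
    {A : E → Matrix (Fin n) (Fin n) ℝ} (h : ∀ i j, ContDiffOn ℝ ∞ (fun x => A x i j) S) :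
    ContDiffOn ℝ ∞ (fun x => (A x).det) S := by
  simp only [Matrix.det_apply']
  exact ContDiffOn.sum fun σ _ => contDiffOn_const.mul (contDiffOn_prod fun i _ => h _ _)

lemma contDiffOn_matrix_inv {E : Type*} [NormedAddCommGroup E] [NormedSpace ℝ E] {S : Set E}
    {n : ℕ} {A : E → Matrix (Fin n) (Fin n) ℝ} (h : ∀ i j, ContDiffOn ℝ ∞ (fun x => A x i j) S)
    (hdet : ∀ x ∈ S, (A x).det ≠ 0) (i j : Fin n) :
    ContDiffOn ℝ ∞ (fun x => (A x)⁻¹ i j) S := by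
  simp only [Matrix.inv_def, Matrix.smul_apply, Ring.inverse_eq_inv', smul_eq_mul,
    Matrix.adjugate_apply]
  refine ((contDiffOn_det h).inv hdet).mul (contDiffOn_det fun k l => ?_)
  -- The adjugate entry is the determinant of the matrix whose row `j` is replaced by a constant
  -- basis vector; all other rows are rows of `A`.
  by_cases hk : k = j
  · subst hk
    simpa using contDiffOn_const
  · simpa [Matrix.updateRow_ne hk] using h k l

lemma contDiffOn_chartForm {a : BilinField m M} (ha : SmoothBilin a) (he : e ∈ charts m M) :
    ContDiffOn ℝ ∞ (chartForm a e) e.target :=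
  ContDiffOn.sum fun i _ => ContDiffOn.sum fun j _ => (ha e he i j).smul contDiffOn_const

lemma contDiffOn_chartCovector {l : CovectorField m M} (hl : SmoothCovector l)
    (he : e ∈ charts m M) : ContDiffOn ℝ ∞ (chartCovector l e) e.target :=
  ContDiffOn.sum fun i _ => (hl e he i).smul contDiffOn_const

lemma contDiffOn_chartEndo {J : EndoField m M} (hJ : SmoothEndo J) (he : e ∈ charts m M) :
    ContDiffOn ℝ ∞ (chartEndo J e) e.target :=
  ContDiffOn.sum fun i _ => ContDiffOn.sum fun j _ => (hJ e he i j).smul contDiffOn_const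

lemma contDiffOn_pd {f : EuclideanSpace ℝ (Fin m) → ℝ} {S : Set (EuclideanSpace ℝ (Fin m))}
    (hS : IsOpen S) (hf : ContDiffOn ℝ ∞ f S) (k : Fin m) : ContDiffOn ℝ ∞ (pd k f) S :=
  (contDiffOn_fderiv hS hf).clm_apply contDiffOn_const

variable {g : BilinField m M} {J : EndoField m M}

lemma IsKahler.pseudoHermitian (hK : IsKahler g J) (he : e ∈ charts m M) (hx : x ∈ e.target) :
    PseudoHermitian (chartForm g e x) (chartEndo J e x) where
  symm u v := by rw [chartForm_apply, chartForm_apply, hK.symm]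
  nondegenerate u hu := by
    have h : chartDeriv e x u = 0 := hK.nondegenerate _ _ fun Y => by
      have h1 := hu (chartDerivInv e x Y)
      rwa [chartForm_apply, chartDeriv_chartDerivInv he hx] at h1
    rw [← chartDerivInv_chartDeriv he hx u, h, map_zero]
  sq_eq_neg u := by
    rw [chartEndo_apply, chartEndo_apply, chartDeriv_chartDerivInv he hx, hK.sq_eq_neg, map_neg,
      chartDerivInv_chartDeriv he hx]
  hermitian u v := by
    rw [chartForm_apply, chartEndo_apply, chartEndo_apply, chartDeriv_chartDerivInv he hx,
      chartDeriv_chartDerivInv he hx, hK.hermitian, chartForm_apply]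

lemma IsKahler.det_ne_zero (hK : IsKahler g J) (he : e ∈ charts m M) (hx : x ∈ e.target) :
    (Matrix.of fun k l => comp₂ g e k l x).det ≠ 0 := by
  intro h0
  obtain ⟨ξ, hξ, h⟩ := Matrix.exists_mulVec_eq_zero_iff.mpr h0
  have hP := hK.pseudoHermitian he hx
  refine hξ ?_
  have h1 : WithLp.toLp 2 ξ = 0 := hP.nondegenerate _ fun v => by
    refine eq_zero_of_basisVec₁ (f := chartForm g e x (WithLp.toLp 2 ξ))
      ⟨by simp, by simp⟩ (fun k => ?_) v
    have h2 := congrFun h k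
    rw [hP.symm, ← sum_smul_basisVec, map_sum]
    simpa [Matrix.mulVec, dotProduct, chartForm_basisVec, mul_comm] using h2
  simpa using congrArg WithLp.ofLp h1

lemma IsKahler.sum_metric_mul_invMetric (hK : IsKahler g J) (he : e ∈ charts m M)
    (hx : x ∈ e.target) (j l : Fin m) :
    ∑ r, comp₂ g e j r x * invMetric g e r l x = if j = l then 1 else 0 := by
  have h := Matrix.mul_nonsing_inv (Matrix.of fun k l => comp₂ g e k l x)
    (isUnit_iff_ne_zero.mpr (hK.det_ne_zero he hx))
  have h1 := congrFun (congrFun h j) l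
  rwa [Matrix.mul_apply, Matrix.one_apply] at h1

lemma IsKahler.comp₂_symm (hK : IsKahler g J) (i j : Fin m) : comp₂ g e i j = comp₂ g e j i :=
  funext fun _ => hK.symm _ _ _

lemma IsKahler.christoffel_symm (hK : IsKahler g J) (k i j : Fin m) :
    christoffel g e k i j = christoffel g e k j i := by
  funext x
  simp only [christoffel, hK.comp₂_symm j i, add_comm (pd i _ _)]

lemma IsKahler.sum_christoffel_mul_metric (hK : IsKahler g J) (he : e ∈ charts m M)
    (hx : x ∈ e.target) (i k j : Fin m) : ∑ r, christoffel g e r i k x * comp₂ g e r j x =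
      (1 / 2) * (pd i (comp₂ g e k j) x + pd k (comp₂ g e i j) x - pd j (comp₂ g e i k) x) := by
  simp only [christoffel, mul_assoc, Finset.sum_mul, ← Finset.mul_sum]
  rw [Finset.sum_comm]
  congr 1
  have h : ∀ l, ∑ r, invMetric g e r l x * ((pd i (comp₂ g e k l) x + pd k (comp₂ g e i l) x -
      pd l (comp₂ g e i k) x) * comp₂ g e r j x) = (pd i (comp₂ g e k l) x +
      pd k (comp₂ g e i l) x - pd l (comp₂ g e i k) x) * if j = l then 1 else 0 := fun l => by
    rw [← hK.sum_metric_mul_invMetric he hx, Finset.mul_sum]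
    refine Finset.sum_congr rfl fun r _ => ?_
    rw [hK.comp₂_symm j r]
    ring
  simp [h]

lemma IsKahler.covDeriv_metric (hK : IsKahler g J) (he : e ∈ charts m M)
    (hx : x ∈ e.target) (i j k : Fin m) : covDeriv₂ g g e i j k x = 0 := by
  have h : ∑ r, christoffel g e r j k x * comp₂ g e i r x =
      ∑ r, christoffel g e r j k x * comp₂ g e r i x := by simp only [hK.comp₂_symm i]
  rw [covDeriv₂, h, hK.sum_christoffel_mul_metric he hx, hK.sum_christoffel_mul_metric he hx,
    hK.comp₂_symm k j, hK.comp₂_symm k i, hK.comp₂_symm j i]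
  ring

lemma IsKahler.contDiffOn_christoffel (hK : IsKahler g J) (he : e ∈ charts m M) (k i j : Fin m) :
    ContDiffOn ℝ ∞ (christoffel g e k i j) e.target := by
  have hpd := fun i j k => contDiffOn_pd e.open_target (hK.smooth_metric e he i j) k
  refine contDiffOn_const.mul (ContDiffOn.sum fun l _ => ContDiffOn.mul ?_ ?_)
  · exact contDiffOn_matrix_inv (hK.smooth_metric e he) (fun x hx => hK.det_ne_zero he hx) k l
  · exact ((hpd _ _ _).add (hpd _ _ _)).sub (hpd _ _ _)

lemma IsKahler.contDiffOn_chartConnection (hK : IsKahler g J) (he : e ∈ charts m M) :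
    ContDiffOn ℝ ∞ (chartConnection g e) e.target :=
  ContDiffOn.sum fun k _ => ContDiffOn.sum fun i _ => ContDiffOn.sum fun j _ =>
    (hK.contDiffOn_christoffel he k i j).smul contDiffOn_const

lemma fderiv_chartForm_basisVec {a : BilinField m M} (ha : SmoothBilin a) (he : e ∈ charts m M)
    (hx : x ∈ e.target) (k i j : Fin m) :
    fderiv ℝ (chartForm a e) x (basisVec k) (basisVec i) (basisVec j) =
      pd k (comp₂ a e i j) x := by
  have h := (((differentiableAt_of_smooth e.open_target (contDiffOn_chartForm ha he)
    hx).hasFDerivAt.clm_apply (hasFDerivAt_const (basisVec i) x)).clm_apply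
      (hasFDerivAt_const (basisVec j) x)).fderiv
  have h' : (fun y => chartForm a e y (basisVec i) (basisVec j)) = comp₂ a e i j :=
    funext fun y => chartForm_basisVec a i j
  rw [h'] at h
  simp [pd, h]

lemma fderiv_chartCovector_basisVec {l : CovectorField m M} (hl : SmoothCovector l)
    (he : e ∈ charts m M) (hx : x ∈ e.target) (k i : Fin m) :
    fderiv ℝ (chartCovector l e) x (basisVec k) (basisVec i) = pd k (comp₁ l e i) x := by
  have h := ((differentiableAt_of_smooth e.open_target (contDiffOn_chartCovector hl he)
    hx).hasFDerivAt.clm_apply (hasFDerivAt_const (basisVec i) x)).fderiv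
  have h' : (fun y => chartCovector l e y (basisVec i)) = comp₁ l e i :=
    funext fun y => chartCovector_basisVec l i
  rw [h'] at h
  simp [pd, h]

lemma chartEndo_basisVec_apply (i j : Fin m) :
    chartEndo J e x (basisVec j) i = compEndo J e i j x := by
  simp [chartEndo_basisVec, Pi.single_apply]

lemma chartConnection_basisVec_apply (k i j : Fin m) :
    chartConnection g e x (basisVec i) (basisVec j) k = christoffel g e k i j x := by
  simp [chartConnection_basisVec, Pi.single_apply]

lemma fderiv_chartEndo_basisVec (hJ : SmoothEndo J) (he : e ∈ charts m M) (hx : x ∈ e.target)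
    (k j i : Fin m) :
    fderiv ℝ (chartEndo J e) x (basisVec k) (basisVec j) i = pd k (compEndo J e i j) x := by
  have h := ((EuclideanSpace.proj i : EuclideanSpace ℝ (Fin m) →L[ℝ] ℝ).hasFDerivAt.comp x
    ((differentiableAt_of_smooth e.open_target (contDiffOn_chartEndo hJ he)
    hx).hasFDerivAt.clm_apply (hasFDerivAt_const (basisVec j) x))).fderiv
  have h' : (EuclideanSpace.proj i : EuclideanSpace ℝ (Fin m) →L[ℝ] ℝ) ∘
      (fun y => chartEndo J e y (basisVec j)) = compEndo J e i j :=
    funext fun y => chartEndo_basisVec_apply i j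
  rw [h'] at h
  simp [pd, h]

lemma IsKahler.fderiv_chartConnection_basisVec (hK : IsKahler g J) (he : e ∈ charts m M)
    (hx : x ∈ e.target) (l i j k : Fin m) :
    fderiv ℝ (chartConnection g e) x (basisVec l) (basisVec i) (basisVec j) k =
      pd l (christoffel g e k i j) x := by
  have h := ((EuclideanSpace.proj k : EuclideanSpace ℝ (Fin m) →L[ℝ] ℝ).hasFDerivAt.comp x
    (((differentiableAt_of_smooth e.open_target (hK.contDiffOn_chartConnection he)
    hx).hasFDerivAt.clm_apply (hasFDerivAt_const (basisVec i) x)).clm_apply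
      (hasFDerivAt_const (basisVec j) x))).fderiv
  have h' : (EuclideanSpace.proj k : EuclideanSpace ℝ (Fin m) →L[ℝ] ℝ) ∘
      (fun y => chartConnection g e y (basisVec i) (basisVec j)) = christoffel g e k i j :=
    funext fun y => chartConnection_basisVec_apply k i j
  rw [h'] at h
  simp [pd, h]

lemma IsKahler.covDerivForm_basisVec (hK : IsKahler g J) {a : BilinField m M} (ha : SmoothBilin a)
    (he : e ∈ charts m M) (hx : x ∈ e.target) (i j k : Fin m) :
    covDerivForm (chartConnection g e) (chartForm a e) x (basisVec k) (basisVec i) (basisVec j) =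
      covDeriv₂ g a e i j k x := by
  rw [covDerivForm, covDeriv₂, fderiv_chartForm_basisVec ha he hx, chartConnection_basisVec,
    chartConnection_basisVec]
  simp only [map_sum, map_smul, sum_apply, smul_apply, chartForm_basisVec, smul_eq_mul,
    hK.christoffel_symm _ k]

/-- The indices change places: `hessianForm` takes the direction of differentiation first,
`covDeriv₁` has it last. -/
lemma IsKahler.hessianForm_basisVec (hK : IsKahler g J) {l : CovectorField m M}
    (hl : SmoothCovector l) (he : e ∈ charts m M) (hx : x ∈ e.target) (i j : Fin m) :
    hessianForm (chartConnection g e) (chartCovector l e) x (basisVec j) (basisVec i) =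
      covDeriv₁ g l e i j x := by
  rw [hessianForm_apply, covDeriv₁, fderiv_chartCovector_basisVec hl he hx,
    chartConnection_basisVec]
  simp only [map_sum, map_smul, chartCovector_basisVec, smul_eq_mul, hK.christoffel_symm _ j]

lemma IsKahler.localKahler (hK : IsKahler g J) (he : e ∈ charts m M) :
    LocalKahler e.target (chartForm g e) (chartEndo J e) (chartConnection g e) where
  isOpen := e.open_target
  smooth_metric := contDiffOn_chartForm hK.smooth_metric he
  smooth_complex := contDiffOn_chartEndo hK.smooth_complex he
  smooth_connection := hK.contDiffOn_chartConnection he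
  hermitian x hx := hK.pseudoHermitian he hx
  torsion_free x hx u v := by
    rw [← sub_eq_zero]
    refine eq_zero_of_basisVec₂ (f := fun u v => chartConnection g e x u v -
      chartConnection g e x v u) (fun v => ⟨?_, ?_⟩) (fun u => ⟨?_, ?_⟩) (fun i j => ?_) u v
    · intros; simp; abel
    · intros; simp [smul_sub]
    · intros; simp; abel
    · intros; simp [smul_sub]
    · simp only [chartConnection_basisVec, hK.christoffel_symm _ j i, sub_self]
  metric x hx w u v := by
    refine eq_zero_of_basisVec₃ (f := covDerivForm (chartConnection g e) (chartForm g e) x)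
      (fun u v => ⟨?_, ?_⟩) (fun w v => ⟨?_, ?_⟩) (fun w u => ⟨?_, ?_⟩) (fun k i j => ?_) w u v
    · intros; simp [covDerivForm]; ring
    · intros; simp [covDerivForm]; ring
    · intros; simp [covDerivForm]; ring
    · intros; simp [covDerivForm]; ring
    · intros; simp [covDerivForm]; ring
    · intros; simp [covDerivForm]; ring
    · rw [hK.covDerivForm_basisVec hK.smooth_metric he hx, hK.covDeriv_metric he hx]
  parallel x hx w u := by
    rw [← sub_eq_zero]
    refine eq_zero_of_basisVec₂ (f := fun w u => fderiv ℝ (chartEndo J e) x w u -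
      (chartEndo J e x (chartConnection g e x w u) - chartConnection g e x w (chartEndo J e x u)))
      (fun v => ⟨?_, ?_⟩) (fun u => ⟨?_, ?_⟩) (fun k j => ?_) w u
    · intros; simp; abel
    · intros; simp [smul_sub]
    · intros; simp; abel
    · intros; simp [smul_sub]
    · ext i
      have h := hK.parallel e he x hx i j k
      simp only [PiLp.sub_apply, fderiv_chartEndo_basisVec hK.smooth_complex he hx,
        chartConnection_basisVec, chartEndo_basisVec, map_sum, map_smul]
      simp only [covDerivEndo, hK.christoffel_symm _ _ k] at h
      simp [Pi.single_apply, Finset.sum_apply, mul_comm (compEndo J e _ j x)]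
      linarith

lemma mobilityTensor_basisVec (l : CovectorField m M) (he : e ∈ charts m M)
    (hx : x ∈ e.target) (i j k : Fin m) :
    mobilityTensor (chartForm g e x) (chartEndo J e x) (chartCovector l e x) (basisVec i)
      (basisVec j) (basisVec k) = comp₁ l e i x * comp₂ g e j k x + comp₁ l e j x * comp₂ g e i k x
        - comp₁ (barCovector J l) e i x * comp₂ (kahlerForm g J) e j k x
        - comp₁ (barCovector J l) e j x * comp₂ (kahlerForm g J) e i k x := by
  have h1 : ∀ i, comp₁ (barCovector J l) e i x =
      chartCovector l e x (chartEndo J e x (basisVec i)) := fun i => by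
    rw [chartCovector_apply, chartEndo_apply, chartDeriv_chartDerivInv he hx]
    rfl
  have h2 : ∀ i j, comp₂ (kahlerForm g J) e i j x =
      chartForm g e x (basisVec i) (chartEndo J e x (basisVec j)) := fun i j => by
    rw [chartForm_apply, chartEndo_apply, chartDeriv_chartDerivInv he hx]
    rfl
  simp only [mobilityTensor, h1, h2, ← chartForm_basisVec, ← chartCovector_basisVec]

lemma IsSolution.localSolution {a : BilinField m M} {l : CovectorField m M}
    (h : IsSolution g J a l) (hK : IsKahler g J) (he : e ∈ charts m M) :
    LocalSolution e.target (chartForm g e) (chartEndo J e) (chartConnection g e) (chartForm a e)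
      (chartCovector l e) where
  smooth_form := contDiffOn_chartForm h.smooth_bilin he
  smooth_covector := contDiffOn_chartCovector h.smooth_covector he
  symm x hx u v := by rw [chartForm_apply, chartForm_apply, h.symm]
  hermitian x hx u v := by
    rw [chartForm_apply, chartEndo_apply, chartEndo_apply, chartDeriv_chartDerivInv he hx,
      chartDeriv_chartDerivInv he hx, h.hermitian, chartForm_apply]
  equation x hx w u v := by
    rw [← sub_eq_zero]
    refine eq_zero_of_basisVec₃ (f := fun w u v =>
      covDerivForm (chartConnection g e) (chartForm a e) x w u v -
      mobilityTensor (chartForm g e x) (chartEndo J e x) (chartCovector l e x) u v w)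
      (fun u v => ⟨?_, ?_⟩) (fun w v => ⟨?_, ?_⟩) (fun w u => ⟨?_, ?_⟩) (fun k i j => ?_) w u v
    · intros; simp [covDerivForm, mobilityTensor]; ring
    · intros; simp [covDerivForm, mobilityTensor]; ring
    · intros; simp [covDerivForm, mobilityTensor]; ring
    · intros; simp [covDerivForm, mobilityTensor]; ring
    · intros; simp [covDerivForm, mobilityTensor]; ring
    · intros; simp [covDerivForm, mobilityTensor]; ring
    · rw [hK.covDerivForm_basisVec h.smooth_bilin he hx, h.equation e he x hx,
        mobilityTensor_basisVec l he hx, sub_self]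

lemma IsKahler.metric_isSolution (hK : IsKahler g J) : IsSolution g J g 0 where
  smooth_bilin := hK.smooth_metric
  smooth_covector _ _ _ := contDiffOn_const (c := (0 : ℝ))
  symm := hK.symm
  hermitian := hK.hermitian
  equation e he x hx i j k := by
    have h' : ∀ i, comp₁ (0 : CovectorField m M) e i = fun _ => 0 := fun _ => rfl
    have h'' : ∀ i, comp₁ (barCovector J 0) e i = fun _ => 0 := fun _ => rfl
    simp [hK.covDeriv_metric he hx, h', h'']

end BridgeStructures

/-! ### Independence of the chart -/

section Transition

open ContinuousLinearMap Topology

set_option maxSynthPendingDepth 3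

section Local

variable {E : Type*} [NormedAddCommGroup E] [NormedSpace ℝ E] {φ : E → E} {x : E}

lemma fderiv_pullback_form {G G' : E → E →L[ℝ] E →L[ℝ] ℝ}
    (hφ : DifferentiableAt ℝ φ x) (hφ' : DifferentiableAt ℝ (fderiv ℝ φ) x)
    (hG : DifferentiableAt ℝ G x) (hG' : DifferentiableAt ℝ G' (φ x))
    (h : ∀ᶠ y in 𝓝 x, ∀ u v, G y u v = G' (φ y) (fderiv ℝ φ y u) (fderiv ℝ φ y v)) (w u v : E) :
    fderiv ℝ G x w u v =
      fderiv ℝ G' (φ x) (fderiv ℝ φ x w) (fderiv ℝ φ x u) (fderiv ℝ φ x v) +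
      G' (φ x) (fderiv ℝ (fderiv ℝ φ) x w u) (fderiv ℝ φ x v) +
      G' (φ x) (fderiv ℝ φ x u) (fderiv ℝ (fderiv ℝ φ) x w v) := by
  have h1 := ((hG.hasFDerivAt.clm_apply (hasFDerivAt_const u x)).clm_apply
      (hasFDerivAt_const v x))
  have hD := fun u => hφ'.hasFDerivAt.clm_apply (hasFDerivAt_const u x)
  have h2 := ((hG'.hasFDerivAt.comp x hφ.hasFDerivAt).clm_apply (hD u)).clm_apply (hD v)
  have h3 := h1.unique (h2.congr_of_eventuallyEq (h.mono fun y hy => hy u v))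
  have h4 := congrArg (fun A : E →L[ℝ] ℝ => A w) h3
  simp at h4
  rw [h4]
  ring

lemma fderiv_pullback_covector {l l' : E → E →L[ℝ] ℝ}
    (hφ : DifferentiableAt ℝ φ x) (hφ' : DifferentiableAt ℝ (fderiv ℝ φ) x)
    (hl : DifferentiableAt ℝ l x) (hl' : DifferentiableAt ℝ l' (φ x))
    (h : ∀ᶠ y in 𝓝 x, ∀ u, l y u = l' (φ y) (fderiv ℝ φ y u)) (w u : E) :
    fderiv ℝ l x w u = fderiv ℝ l' (φ x) (fderiv ℝ φ x w) (fderiv ℝ φ x u) +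
      l' (φ x) (fderiv ℝ (fderiv ℝ φ) x w u) := by
  have h1 := hl.hasFDerivAt.clm_apply (hasFDerivAt_const u x)
  have h2 := (hl'.hasFDerivAt.comp x hφ.hasFDerivAt).clm_apply
    (hφ'.hasFDerivAt.clm_apply (hasFDerivAt_const u x))
  have h3 := h1.unique (h2.congr_of_eventuallyEq (h.mono fun y hy => hy u))
  have h4 := congrArg (fun A : E →L[ℝ] ℝ => A w) h3
  simp at h4
  rw [h4]
  ring

/-- The transformation law of the Levi-Civita connection. -/
lemma connection_transition {S S' : Set E} {G G' : E → E →L[ℝ] E →L[ℝ] ℝ} {J J' : E → E →L[ℝ] E}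
    {Γ Γ' : E → E →L[ℝ] E →L[ℝ] E} (K : LocalKahler S G J Γ) (K' : LocalKahler S' G' J' Γ')
    (hx : x ∈ S) (hx' : φ x ∈ S') (hφ : ContDiffAt ℝ ∞ φ x)
    (hsurj : Function.Surjective (fderiv ℝ φ x))
    (h : ∀ᶠ y in 𝓝 x, ∀ u v, G y u v = G' (φ y) (fderiv ℝ φ y u) (fderiv ℝ φ y v)) (w u : E) :
    fderiv ℝ φ x (Γ x w u) =
      Γ' (φ x) (fderiv ℝ φ x w) (fderiv ℝ φ x u) + fderiv ℝ (fderiv ℝ φ) x w u := by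
  have dφ : DifferentiableAt ℝ φ x := hφ.differentiableAt (by simp)
  have dφ' : DifferentiableAt ℝ (fderiv ℝ φ) x :=
    (hφ.fderiv_right (m := ∞) (by simp)).differentiableAt (by simp)
  have hs : ∀ w u, fderiv ℝ (fderiv ℝ φ) x w u = fderiv ℝ (fderiv ℝ φ) x u w :=
    fun w u => (hφ.isSymmSndFDerivAt (by simpa using ENat.LEInfty.out)) w u
  set D := fderiv ℝ φ x with hDdef
  -- The defect of the transformation law, with the index lowered. It is symmetric in its first two
  -- arguments (no torsion) and skew in the last two (metric connections), hence zero, as in the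
  -- uniqueness of the Levi-Civita connection.
  let T : E → E → E → ℝ := fun w u v => G' (φ x)
    (Γ' (φ x) (D w) (D u) + fderiv ℝ (fderiv ℝ φ) x w u - D (Γ x w u)) (D v)
  have hsymm : ∀ w u v, T w u v = T u w v := fun w u v => by
    simp only [T, hs w u, K.torsion_free x hx w u, K'.torsion_free _ hx' (D w)]
  have hskew : ∀ w u v, T w u v + T w v u = 0 := fun w u v => by
    have e1 := fderiv_pullback_form dφ dφ'
      (differentiableAt_of_smooth K.isOpen K.smooth_metric hx)
      (differentiableAt_of_smooth K'.isOpen K'.smooth_metric hx') h w u v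
    have e2 := K.metric x hx w u v
    have e3 := K'.metric _ hx' (D w) (D u) (D v)
    simp only [covDerivForm, h.self_of_nhds, ← hDdef] at e1 e2 e3
    have sG := (K'.hermitian _ hx').symm
    simp only [T, map_add, map_sub, add_apply, sub_apply]
    rw [sG (Γ' (φ x) (D w) (D v)), sG (fderiv ℝ (fderiv ℝ φ) x w v), sG (D (Γ x w v))]
    linarith
  have hT : ∀ w u v, T w u v = 0 := fun w u v => by
    linarith [hskew w u v, hskew u v w, hskew v w u, hsymm w u v, hsymm u v w, hsymm v w u]
  refine (sub_eq_zero.mp ((K'.hermitian _ hx').nondegenerate _ fun v => ?_)).symm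
  obtain ⟨v, rfl⟩ := hsurj v
  exact hT w u v

/-- The covariant derivative of a covector field is a tensor. -/
lemma hessianForm_transition {S S' : Set E} {G G' : E → E →L[ℝ] E →L[ℝ] ℝ}
    {J J' : E → E →L[ℝ] E} {Γ Γ' : E → E →L[ℝ] E →L[ℝ] E} (K : LocalKahler S G J Γ)
    (K' : LocalKahler S' G' J' Γ') (hx : x ∈ S) (hx' : φ x ∈ S') (hφ : ContDiffAt ℝ ∞ φ x)
    (hsurj : Function.Surjective (fderiv ℝ φ x))
    (h : ∀ᶠ y in 𝓝 x, ∀ u v, G y u v = G' (φ y) (fderiv ℝ φ y u) (fderiv ℝ φ y v))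
    {l l' : E → E →L[ℝ] ℝ} (hl : ContDiffOn ℝ ∞ l S) (hl' : ContDiffOn ℝ ∞ l' S')
    (hll' : ∀ᶠ y in 𝓝 x, ∀ u, l y u = l' (φ y) (fderiv ℝ φ y u)) (w u : E) :
    hessianForm Γ l x w u = hessianForm Γ' l' (φ x) (fderiv ℝ φ x w) (fderiv ℝ φ x u) := by
  rw [hessianForm_apply, hessianForm_apply, hll'.self_of_nhds,
    connection_transition K K' hx hx' hφ hsurj h,
    fderiv_pullback_covector (hφ.differentiableAt (by simp))
      ((hφ.fderiv_right (m := ∞) (by simp)).differentiableAt (by simp))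
      (differentiableAt_of_smooth K.isOpen hl hx)
      (differentiableAt_of_smooth K'.isOpen hl' hx') hll', map_add]
  ring

end Local

variable {m : ℕ} {M : Type*} [TopologicalSpace M] [ChartedSpace (EuclideanSpace ℝ (Fin m)) M]
  {e e' : OpenPartialHomeomorph M (EuclideanSpace ℝ (Fin m))} {x : EuclideanSpace ℝ (Fin m)}

lemma contDiffAt_transition (he : e ∈ charts m M) (he' : e' ∈ charts m M) (hx : x ∈ e.target)
    (hx' : e.symm x ∈ e'.source) : ContDiffAt ℝ ∞ (e' ∘ e.symm) x := by
  have h1 := (contMDiffOn_symm_of_mem_maximalAtlas he).contMDiffAt (e.open_target.mem_nhds hx)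
  have h2 := (contMDiffOn_of_mem_maximalAtlas he').contMDiffAt (e'.open_source.mem_nhds hx')
  exact contMDiffAt_iff_contDiffAt.mp (h2.comp x h1)

lemma chartDeriv_transition (he : e ∈ charts m M) (he' : e' ∈ charts m M) (hx : x ∈ e.target)
    (hx' : e.symm x ∈ e'.source) (u : EuclideanSpace ℝ (Fin m)) :
    (chartDeriv e x u : EuclideanSpace ℝ (Fin m)) =
      chartDeriv e' (e' (e.symm x)) (fderiv ℝ (e' ∘ e.symm) x u) := by
  have hφ := contDiffAt_transition he he' hx hx'
  have h0 : e.symm =ᶠ[𝓝 x] e'.symm ∘ (e' ∘ e.symm) := by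
    have : ∀ᶠ y in 𝓝 x, e.symm y ∈ e'.source :=
      (e.continuousAt_symm hx).eventually_mem (e'.open_source.mem_nhds hx')
    exact this.mono fun y hy => (e'.left_inv hy).symm
  have h1 : HasMFDerivAt (𝓡 m) (𝓡 m) (e' ∘ e.symm) x (fderiv ℝ (e' ∘ e.symm) x) :=
    (hφ.differentiableAt (by simp)).hasFDerivAt.hasMFDerivAt
  have h2 : HasMFDerivAt (𝓡 m) (𝓡 m) e'.symm ((e' ∘ e.symm) x)
      (chartDeriv e' (e' (e.symm x))) :=
    ((mdifferentiable_of_mem_charts he').mdifferentiableAt_symm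
      (e'.map_source hx')).hasMFDerivAt
  have h3 := (h2.comp x h1).congr_of_eventuallyEq h0
  have h4 : HasMFDerivAt (𝓡 m) (𝓡 m) e.symm x (chartDeriv e x) :=
    ((mdifferentiable_of_mem_charts he).mdifferentiableAt_symm hx).hasMFDerivAt
  exact congrArg (fun A : EuclideanSpace ℝ (Fin m) →L[ℝ] EuclideanSpace ℝ (Fin m) => A u)
    (hasMFDerivAt_unique h4 h3)

lemma chartForm_transition (a : BilinField m M) (he : e ∈ charts m M) (he' : e' ∈ charts m M)
    (hx : x ∈ e.target) (hx' : e.symm x ∈ e'.source) (u v : EuclideanSpace ℝ (Fin m)) :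
    chartForm a e x u v = chartForm a e' (e' (e.symm x)) (fderiv ℝ (e' ∘ e.symm) x u)
      (fderiv ℝ (e' ∘ e.symm) x v) := by
  -- The base points `e.symm x` and `e'.symm (e' (e.symm x))` are only propositionally equal. All
  -- tangent spaces unfold to the same model space, so the form can be transported along this
  -- equality without a cast.
  have h : ∀ q q' : M, q = q' → ∀ u v : EuclideanSpace ℝ (Fin m), a q u v = a q' u v := by
    rintro q _ rfl u v
    rfl
  rw [chartForm_apply, chartForm_apply]
  refine (h _ _ (e'.left_inv hx').symm _ _).trans ?_
  rw [chartDeriv_transition he he' hx hx', chartDeriv_transition he he' hx hx']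

lemma chartCovector_transition (l : CovectorField m M) (he : e ∈ charts m M)
    (he' : e' ∈ charts m M) (hx : x ∈ e.target) (hx' : e.symm x ∈ e'.source)
    (u : EuclideanSpace ℝ (Fin m)) :
    chartCovector l e x u =
      chartCovector l e' (e' (e.symm x)) (fderiv ℝ (e' ∘ e.symm) x u) := by
  have h : ∀ q q' : M, q = q' → ∀ u : EuclideanSpace ℝ (Fin m), l q u = l q' u := by
    rintro q _ rfl u
    rfl
  rw [chartCovector_apply, chartCovector_apply]
  refine (h _ _ (e'.left_inv hx').symm _).trans ?_
  rw [chartDeriv_transition he he' hx hx']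

lemma surjective_transition (he : e ∈ charts m M) (he' : e' ∈ charts m M) (hx : x ∈ e.target)
    (hx' : e.symm x ∈ e'.source) : Function.Surjective (fderiv ℝ (e' ∘ e.symm) x) := by
  refine LinearMap.surjective_of_injective (f := (fderiv ℝ (e' ∘ e.symm) x).toLinearMap) ?_
  intro u v huv
  have huv' : fderiv ℝ (e' ∘ e.symm) x u = fderiv ℝ (e' ∘ e.symm) x v := huv
  have h : (chartDeriv e x u : EuclideanSpace ℝ (Fin m)) = chartDeriv e x v := by
    rw [chartDeriv_transition he he' hx hx', chartDeriv_transition he he' hx hx', huv']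
  rw [← chartDerivInv_chartDeriv he hx u, ← chartDerivInv_chartDeriv he hx v]
  exact congrArg (chartDerivInv e x) h

/-- The covariant derivative of a covector field does not depend on the chart. -/
lemma IsKahler.hessianForm_transition {g : BilinField m M} {J : EndoField m M}
    (hK : IsKahler g J) {l : CovectorField m M} (hl : SmoothCovector l) (he : e ∈ charts m M)
    (he' : e' ∈ charts m M) (hx : x ∈ e.target) (hx' : e.symm x ∈ e'.source)
    (w u : EuclideanSpace ℝ (Fin m)) :
    hessianForm (chartConnection g e) (chartCovector l e) x w u =
      hessianForm (chartConnection g e') (chartCovector l e') (e' (e.symm x))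
        (fderiv ℝ (e' ∘ e.symm) x w) (fderiv ℝ (e' ∘ e.symm) x u) := by
  have ev : ∀ᶠ y in 𝓝 x, y ∈ e.target ∧ e.symm y ∈ e'.source :=
    (e.open_target.eventually_mem hx).and
      ((e.continuousAt_symm hx).eventually_mem (e'.open_source.mem_nhds hx'))
  exact KahlerMobility.hessianForm_transition (φ := e' ∘ e.symm) (hK.localKahler he)
    (hK.localKahler he') hx (e'.map_source hx') (contDiffAt_transition he he' hx hx')
    (surjective_transition he he' hx hx')
    (ev.mono fun y hy => chartForm_transition g he he' hy.1 hy.2)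
    (contDiffOn_chartCovector hl he) (contDiffOn_chartCovector hl he')
    (ev.mono fun y hy => chartCovector_transition l he he' hy.1 hy.2) w u

end Transition

/-! ### Holomorphic sectional curvature in coordinates -/

section Curvature

open ContinuousLinearMap Topology

set_option maxSynthPendingDepth 3

variable {m : ℕ} {M : Type*} [TopologicalSpace M] [ChartedSpace (EuclideanSpace ℝ (Fin m)) M]
  {e : OpenPartialHomeomorph M (EuclideanSpace ℝ (Fin m))} {x : EuclideanSpace ℝ (Fin m)}
  {g : BilinField m M} {J : EndoField m M}

lemma IsKahler.curvatureForm_basisVec_apply (hK : IsKahler g J) (he : e ∈ charts m M)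
    (hx : x ∈ e.target) (i j k l : Fin m) :
    curvatureForm (chartConnection g e) x (basisVec k) (basisVec l) (basisVec j) i =
      curvature g e i j k l x := by
  rw [curvatureForm_apply, curvature, chartConnection_basisVec g l j,
    chartConnection_basisVec g k j]
  simp only [map_sum, map_smul, PiLp.sub_apply, PiLp.add_apply,
    hK.fderiv_chartConnection_basisVec he hx, WithLp.ofLp_sum, Finset.sum_apply, PiLp.smul_apply,
    chartConnection_basisVec_apply, smul_eq_mul]
  simp only [mul_comm]

lemma IsKahler.curvatureForm_apply_coord (hK : IsKahler g J) (he : e ∈ charts m M)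
    (hx : x ∈ e.target) (i : Fin m) (z w u : EuclideanSpace ℝ (Fin m)) :
    curvatureForm (chartConnection g e) x z w u i =
      ∑ j, ∑ k, ∑ l, curvature g e i j k l x * u j * z k * w l := by
  rw [← sub_eq_zero]
  refine eq_zero_of_basisVec₃ (f := fun z w u => curvatureForm (chartConnection g e) x z w u i -
      ∑ j, ∑ k, ∑ l, curvature g e i j k l x * u j * z k * w l)
      (fun u v => ⟨?_, ?_⟩) (fun w v => ⟨?_, ?_⟩) (fun w u => ⟨?_, ?_⟩) (fun k l j => ?_) z w u
  · intros; simp [mul_add, add_mul, Finset.sum_add_distrib]; ring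
  · intros
    simp only [map_smul, smul_apply, PiLp.smul_apply, smul_eq_mul, mul_sub, Finset.mul_sum]
    simp only [mul_assoc, mul_left_comm]
  · intros; simp [mul_add, Finset.sum_add_distrib]; ring
  · intros
    simp only [map_smul, smul_apply, PiLp.smul_apply, smul_eq_mul, mul_sub, Finset.mul_sum]
    simp only [mul_assoc, mul_left_comm]
  · intros; simp [mul_add, add_mul, Finset.sum_add_distrib]; ring
  · intros
    simp only [map_smul, PiLp.smul_apply, smul_eq_mul, mul_sub, Finset.mul_sum]
    simp only [mul_assoc, mul_left_comm]
  · rw [hK.curvatureForm_basisVec_apply he hx]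
    simp

lemma chartForm_apply_coord (a : BilinField m M) (u v : EuclideanSpace ℝ (Fin m)) :
    chartForm a e x u v = ∑ i, ∑ j, comp₂ a e i j x * u i * v j := by
  simp [chartForm, sum_apply, mul_assoc]

lemma normSq_eq (ξ : Fin m → ℝ) :
    normSq g e x ξ = chartForm g e x (WithLp.toLp 2 ξ) (WithLp.toLp 2 ξ) := by
  simp [chartForm_apply_coord, normSq]

lemma rotate_eq (ξ : Fin m → ℝ) : rotate J e x ξ = chartEndo J e x (WithLp.toLp 2 ξ) := by
  funext i
  simp [rotate, chartEndo, sum_apply, Pi.single_apply]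

/-- For the arguments `X, JX, JX` paired with `X`, the terms of the model tensor contribute 1, 0, 0,
1 and 2 times `g(X, X)²`, up to the order in which they are written. -/
lemma IsKahler.holSectionalCurvature_eq (hK : IsKahler g J) (he : e ∈ charts m M)
    (hx : x ∈ e.target) {B : ℝ} (hR : ∀ z w u, curvatureForm (chartConnection g e) x z w u =
      -B • modelCurvature (chartForm g e x) (chartEndo J e x) z w u) {ξ : Fin m → ℝ}
    (hξ : normSq g e x ξ ≠ 0) : holSectionalCurvature g J e x ξ = -4 * B := by
  have hP := hK.pseudoHermitian he hx
  set X : EuclideanSpace ℝ (Fin m) := WithLp.toLp 2 ξ with hX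
  set G := chartForm g e x with hG
  set j := chartEndo J e x with hj
  have hnum : (∑ s, ∑ i, ∑ j, ∑ k, ∑ l, comp₂ g e s i x * ξ s *
      (curvature g e i j k l x * rotate J e x ξ j * ξ k * rotate J e x ξ l)) =
      G X (curvatureForm (chartConnection g e) x X (j X) (j X)) := by
    rw [hG, chartForm_apply_coord]
    simp only [hK.curvatureForm_apply_coord he hx, Finset.mul_sum, rotate_eq]
    rfl
  have h1 : G (j (j X)) X = - G X X := by rw [hP.sq_eq_neg]; simp
  have h2 : G X (j (j X)) = - G X X := by rw [hP.sq_eq_neg]; simp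
  have h3 := hP.apply_J_self X
  have h4 := hP.hermitian X X
  have h5 : G (j X) X = 0 := by rw [hP.symm, h3]
  rw [holSectionalCurvature, hnum, hR, normSq_eq, map_smul, hP.symm, modelCurvature_apply]
  rw [normSq_eq] at hξ
  simp only [h1, h2, h3, h4, h5, smul_eq_mul]
  rw [div_eq_iff (pow_ne_zero 2 hξ)]
  ring

end Curvature

/-! ### Linear relations on the manifold and in a chart -/

section Pointwise

open ContinuousLinearMap Topology

set_option maxSynthPendingDepth 3

variable {m : ℕ} {M : Type*} [TopologicalSpace M] [ChartedSpace (EuclideanSpace ℝ (Fin m)) M]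
  {e : OpenPartialHomeomorph M (EuclideanSpace ℝ (Fin m))} {x : EuclideanSpace ℝ (Fin m)} {p : M}

lemma chartForm_combination (c₀ c₁ c₂ : ℝ) (b₀ b₁ b₂ : BilinField m M) :
    chartForm (c₀ • b₀ + c₁ • b₁ + c₂ • b₂) e x =
      c₀ • chartForm b₀ e x + c₁ • chartForm b₁ e x + c₂ • chartForm b₂ e x := by
  ext u v
  simp only [add_apply, smul_apply, chartForm_apply]
  rfl

lemma chartCovector_combination (c₁ c₂ : ℝ) (l₁ l₂ : CovectorField m M) :
    chartCovector (c₁ • l₁ + c₂ • l₂) e x =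
      c₁ • chartCovector l₁ e x + c₂ • chartCovector l₂ e x := by
  ext u
  simp only [add_apply, smul_apply, chartCovector_apply]
  rfl

lemma chartForm_eq_zero_iff (he : e ∈ charts m M) (hx : x ∈ e.target) (b : BilinField m M) :
    chartForm b e x = 0 ↔ b (e.symm x) = 0 := by
  constructor
  · intro h
    ext u v
    rw [← chartDeriv_chartDerivInv he hx u, ← chartDeriv_chartDerivInv he hx v,
      ← chartForm_apply, h]
    rfl
  · intro h
    ext u v
    rw [chartForm_apply, h]
    rfl

lemma chartCovector_eq_zero_iff (he : e ∈ charts m M) (hx : x ∈ e.target) (l : CovectorField m M) :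
    chartCovector l e x = 0 ↔ l (e.symm x) = 0 := by
  constructor
  · intro h
    ext u
    rw [← chartDeriv_chartDerivInv he hx u, ← chartCovector_apply, h]
    rfl
  · intro h
    ext u
    rw [chartCovector_apply, h]
    rfl

lemma linearIndependent_chartForm_iff (he : e ∈ charts m M) (hp : p ∈ e.source)
    (b₀ b₁ b₂ : BilinField m M) :
    LinearIndependent ℝ ![chartForm b₀ e (e p), chartForm b₁ e (e p), chartForm b₂ e (e p)] ↔
      LinearIndependent ℝ ![b₀ p, b₁ p, b₂ p] := by
  rw [linearIndependent_triple_iff (W := EuclideanSpace ℝ (Fin m) →L[ℝ]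
    EuclideanSpace ℝ (Fin m) →L[ℝ] ℝ), linearIndependent_triple_iff]
  refine forall_congr' fun c₀ => forall_congr' fun c₁ => forall_congr' fun c₂ => ?_
  rw [← chartForm_combination, chartForm_eq_zero_iff he (e.map_source hp), e.left_inv hp]
  rfl

end Pointwise

/-! ### From charts to the connected manifold -/

section Global

open ContinuousLinearMap Topology

set_option maxSynthPendingDepth 3

lemma eventually_chart_iff {M : Type*} [TopologicalSpace M]
    {e : OpenPartialHomeomorph M (EuclideanSpace ℝ (Fin 4))} {x : EuclideanSpace ℝ (Fin 4)}
    {P : M → Prop} (hx : x ∈ e.target) :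
    (∀ᶠ y in 𝓝 x, P (e.symm y)) ↔ ∀ᶠ q in 𝓝 (e.symm x), P q := by
  rw [← e.symm.map_nhds_eq (by simpa using hx), Filter.eventually_map]

variable {M : Type*} [TopologicalSpace M] [ChartedSpace (EuclideanSpace ℝ (Fin 4)) M]
  {g a a' : BilinField 4 M} {J : EndoField 4 M} {l l' : CovectorField 4 M}
  {e e' : OpenPartialHomeomorph M (EuclideanSpace ℝ (Fin 4))} {x : EuclideanSpace ℝ (Fin 4)}

lemma IsKahler.isSolution_combination (hK : IsKahler g J) (s : IsSolution g J a l)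
    (s' : IsSolution g J a' l') (c₀ c₁ c₂ : ℝ) :
    IsSolution g J (c₀ • g + c₁ • a + c₂ • a') (c₁ • l + c₂ • l') := by
  have h := ((hK.metric_isSolution.smul c₀).add (s.smul c₁)).add (s'.smul c₂)
  rwa [smul_zero, zero_add] at h

/-- A solution that vanishes near a point vanishes identically. -/
lemma IsSolution.eq_zero_of_eventually_eq_zero [IsManifold (𝓡 4) ∞ M] [ConnectedSpace M]
    (hK : IsKahler g J) (s : IsSolution g J a l) {p : M}
    (hp : ∀ᶠ q in 𝓝 p, a q = 0 ∧ l q = 0) (q : M) : a q = 0 ∧ l q = 0 := by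
  let Z : Set M := {p | ∀ᶠ q in 𝓝 p, a q = 0 ∧ l q = 0}
  have hopen : IsOpen Z := isOpen_setOfPred_eventually_nhds
  have hclosed : IsClosed Z := by
    refine isClosed_of_closure_subset fun p hpc => ?_
    set e := chartAt (EuclideanSpace ℝ (Fin 4)) p with he
    have hec : e ∈ charts 4 M := IsManifold.chart_mem_maximalAtlas p
    have hps : p ∈ e.source := mem_chart_source _ p
    -- The ball is centred at a limit point `p` of `Z`. Unique continuation may start from any point
    -- of the ball, in particular from a point `q` of `Z`.
    obtain ⟨r, hr, hrs, huc⟩ := (hK.localKahler hec).exists_ball_unique_continuation (by simp)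
      (e.map_source hps)
    have hn : e.source ∩ e ⁻¹' Metric.ball (e p) r ∈ 𝓝 p :=
      Filter.inter_mem (e.open_source.mem_nhds hps)
        ((e.continuousAt hps).preimage_mem_nhds (Metric.ball_mem_nhds _ hr))
    obtain ⟨q, ⟨hqs, hqb⟩, hqZ⟩ := mem_closure_iff_nhds.mp hpc _ hn
    have hz := huc _ _ (s.localSolution hK hec) (e q) hqb (by
      have h1 : ∀ᶠ z in 𝓝 (e q), z ∈ e.target := e.open_target.eventually_mem (e.map_source hqs)
      have h2 : ∀ᶠ z in 𝓝 (e q), a (e.symm z) = 0 ∧ l (e.symm z) = 0 :=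
        (eventually_chart_iff (P := fun q => a q = 0 ∧ l q = 0) (e.map_source hqs)).mpr
          (by rw [e.left_inv hqs]; exact hqZ)
      filter_upwards [h1, h2] with z hz1 hz2
      rwa [chartForm_eq_zero_iff hec hz1, chartCovector_eq_zero_iff hec hz1])
    filter_upwards [hn] with y ⟨hys, hyb⟩
    have := hz _ hyb
    rwa [chartForm_eq_zero_iff hec (e.map_source hys),
      chartCovector_eq_zero_iff hec (e.map_source hys), e.left_inv hys] at this
  have huniv : Z = Set.univ := IsClopen.eq_univ ⟨hclosed, hopen⟩ ⟨p, hp⟩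
  have hq : q ∈ Z := huniv ▸ Set.mem_univ q
  exact hq.self_of_nhds

/-- The points of the chart where the three solutions are independent are dense. -/
lemma chart_subset_closure_independent [IsManifold (𝓡 4) ∞ M] [ConnectedSpace M]
    (hK : IsKahler g J) (s : IsSolution g J a l) (s' : IsSolution g J a' l')
    (hli : ∀ c₀ c₁ c₂ : ℝ, c₀ • g + c₁ • a + c₂ • a' = 0 → c₁ • l + c₂ • l' = 0 →
      c₀ = 0 ∧ c₁ = 0 ∧ c₂ = 0) (he : e ∈ charts 4 M) :
    e.target ⊆ closure {x ∈ e.target |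
      LinearIndependent ℝ ![chartForm g e x, chartForm a e x, chartForm a' e x]} := by
  intro x hx
  by_contra hcl
  -- Applied to the open set that would remain outside the closure; by unique continuation the
  -- combination found there would vanish on all of `M`.
  obtain ⟨y, hy, c₀, c₁, c₂, hc, hev⟩ := exists_vanishing_combination (by simp)
    (hK.localKahler he) (s.localSolution hK he) (s'.localSolution hK he)
    (W := e.target \ closure {x ∈ e.target |
      LinearIndependent ℝ ![chartForm g e x, chartForm a e x, chartForm a' e x]})
    (e.open_target.sdiff isClosed_closure) Set.sdiff_subset ⟨x, hx, hcl⟩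
    (fun y hy hyl => hy.2 (subset_closure ⟨hy.1, hyl⟩))
  have hz : ∀ᶠ q in 𝓝 (e.symm y), (c₀ • g + c₁ • a + c₂ • a') q = 0 ∧
      (c₁ • l + c₂ • l') q = 0 := by
    rw [← eventually_chart_iff (P := fun q => (c₀ • g + c₁ • a + c₂ • a') q = 0 ∧
      (c₁ • l + c₂ • l') q = 0) hy.1]
    filter_upwards [hev, e.open_target.eventually_mem hy.1] with z hz hzt
    rwa [← chartForm_combination, ← chartCovector_combination, chartForm_eq_zero_iff he hzt,
      chartCovector_eq_zero_iff he hzt] at hz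
  have h0 := (hK.isSolution_combination s s' c₀ c₁ c₂).eq_zero_of_eventually_eq_zero hK hz
  exact hc (hli c₀ c₁ c₂ (funext fun q => (h0 q).1) (funext fun q => (h0 q).2))

/-- The curvature constant at a point does not depend on the chart. -/
lemma hasConstantAt_transition (hK : IsKahler g J) (s : IsSolution g J a l)
    (s' : IsSolution g J a' l') (he : e ∈ charts 4 M) (he' : e' ∈ charts 4 M) {p : M}
    (hp : p ∈ e.source) (hp' : p ∈ e'.source) (hli : LinearIndependent ℝ ![g p, a p, a' p]) {B : ℝ}
    (hB : HasConstantAt (chartForm g e) (chartEndo J e) (chartConnection g e) (e p) B) :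
    HasConstantAt (chartForm g e') (chartEndo J e') (chartConnection g e') (e' p) B := by
  have hli' := (linearIndependent_chartForm_iff he hp g a a').mpr hli
  -- The curvature itself need not be transformed. A constant `B'` exists in the second chart, and
  -- the two descriptions of the Hessian of `l`, which is a tensor, give `(μ - μ') g + (B - B') a =
  -- 0`.
  obtain ⟨B', hB'⟩ := (s.localSolution hK he').exists_hasConstantAt (s'.localSolution hK he')
    (hK.localKahler he') (by simp) (e'.map_source hp')
    ((linearIndependent_chartForm_iff he' hp' g a a').mpr hli)
  obtain ⟨μ, hμ⟩ := hB.2 _ _ ((s.localSolution hK he).integrability (hK.localKahler he)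
    (e.map_source hp))
  obtain ⟨μ', hμ'⟩ := hB'.2 _ _ ((s.localSolution hK he').integrability (hK.localKahler he')
    (e'.map_source hp'))
  have hps : e.symm (e p) ∈ e'.source := by rwa [e.left_inv hp]
  have hcomb : (μ - μ') • chartForm g e (e p) + (B - B') • chartForm a e (e p) +
      (0 : ℝ) • chartForm a' e (e p) = 0 := by
    ext w u
    have h1 := hK.hessianForm_transition s.smooth_covector he he' (e.map_source hp) hps w u
    have h2 := chartForm_transition g he he' (e.map_source hp) hps w u
    have h3 := chartForm_transition a he he' (e.map_source hp) hps w u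
    rw [e.left_inv hp, hμ, hμ'] at h1
    rw [e.left_inv hp] at h2 h3
    simp only [add_apply, smul_apply, smul_eq_mul, ← h2, ← h3] at h1
    simp only [add_apply, smul_apply, smul_eq_mul, zero_apply]
    linarith
  have := (linearIndependent_triple_iff (W := EuclideanSpace ℝ (Fin 4) →L[ℝ]
    EuclideanSpace ℝ (Fin 4) →L[ℝ] ℝ)).mp hli' _ _ _ hcomb
  rwa [sub_eq_zero.mp this.2.1]

/-- On a connected manifold, the curvature constant is the same at all points where the three
solutions are independent. -/
lemma exists_global_constant [IsManifold (𝓡 4) ∞ M] [ConnectedSpace M]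
    (hK : IsKahler g J) (s : IsSolution g J a l) (s' : IsSolution g J a' l')
    (hli : ∀ c₀ c₁ c₂ : ℝ, c₀ • g + c₁ • a + c₂ • a' = 0 → c₁ • l + c₂ • l' = 0 →
      c₀ = 0 ∧ c₁ = 0 ∧ c₂ = 0) :
    ∃ B : ℝ, ∀ p, LinearIndependent ℝ ![g p, a p, a' p] → ∀ e ∈ charts 4 M, p ∈ e.source →
      HasConstantAt (chartForm g e) (chartEndo J e) (chartConnection g e) (e p) B := by
  -- `Q B p` is void at points of dependence, so it determines `B` only near a point, through the
  -- density of the independent points. This is why the next two claims concern neighbourhoods.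
  let Q : ℝ → M → Prop := fun B p => LinearIndependent ℝ ![g p, a p, a' p] →
    ∀ e ∈ charts 4 M, p ∈ e.source →
      HasConstantAt (chartForm g e) (chartEndo J e) (chartConnection g e) (e p) B
  have hloc : ∀ p : M, ∃ B, ∀ᶠ q in 𝓝 p, Q B q := fun p => by
    set e := chartAt (EuclideanSpace ℝ (Fin 4)) p with he
    have hec : e ∈ charts 4 M := IsManifold.chart_mem_maximalAtlas p
    have hps : p ∈ e.source := mem_chart_source _ p
    obtain ⟨B, hB⟩ := exists_locally_constant (hK.localKahler hec) (s.localSolution hK hec)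
      (s'.localSolution hK hec) (by simp) (chart_subset_closure_independent hK s s' hli hec)
      (e.map_source hps)
    refine ⟨B, ?_⟩
    filter_upwards [(e.continuousAt hps).eventually hB, e.open_source.eventually_mem hps]
      with q hq hqs hqli e' he' hqs'
    exact hasConstantAt_transition hK s s' hec he' hqs hqs' hqli
      (hq ((linearIndependent_chartForm_iff hec hqs g a a').mpr hqli))
  have huniq : ∀ (p : M) (B B' : ℝ), (∀ᶠ q in 𝓝 p, Q B q) → (∀ᶠ q in 𝓝 p, Q B' q) →
      B = B' := fun p B B' h h' => by
    set e := chartAt (EuclideanSpace ℝ (Fin 4)) p with he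
    have hec : e ∈ charts 4 M := IsManifold.chart_mem_maximalAtlas p
    have hps : p ∈ e.source := mem_chart_source _ p
    have hev : ∀ᶠ y in 𝓝 (e p), Q B (e.symm y) ∧ Q B' (e.symm y) := by
      rw [eventually_chart_iff (P := fun q => Q B q ∧ Q B' q) (e.map_source hps),
        e.left_inv hps]
      exact h.and h'
    obtain ⟨y, hy, hyt, hyli⟩ := mem_closure_iff_nhds.mp
      (chart_subset_closure_independent hK s s' hli hec (e.map_source hps)) _ hev
    have hys := e.map_target hyt
    have hyli' : LinearIndependent ℝ ![g (e.symm y), a (e.symm y), a' (e.symm y)] := by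
      rw [← linearIndependent_chartForm_iff hec hys, e.right_inv hyt]
      exact hyli
    have h1 := hy.1 hyli' e hec hys
    have h2 := hy.2 hyli' e hec hys
    rw [e.right_inv hyt] at h1 h2
    have hi := (s.localSolution hK hec).integrability (hK.localKahler hec) hyt
    obtain ⟨μ, hμ⟩ := h1.2 _ _ hi
    obtain ⟨μ', hμ'⟩ := h2.2 _ _ hi
    have h3 := (linearIndependent_triple_iff (W := EuclideanSpace ℝ (Fin 4) →L[ℝ]
      EuclideanSpace ℝ (Fin 4) →L[ℝ] ℝ)).mp hyli (μ - μ') (B - B') 0 (by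
        rw [hμ] at hμ'
        rw [zero_smul, add_zero, sub_smul, sub_smul, sub_add_sub_comm, hμ', sub_self])
    exact sub_eq_zero.mp h3.2.1
  choose β hβ using hloc
  have hconst : IsLocallyConstant β := (IsLocallyConstant.iff_eventually_eq β).mpr fun p => by
    filter_upwards [eventually_eventually_nhds.mpr (hβ p)] with q hq
    exact huniq q _ _ (hβ q) hq
  obtain ⟨p₀⟩ : Nonempty M := inferInstance
  refine ⟨β p₀, fun p => ?_⟩
  have := hβ p
  rw [hconst.apply_eq_of_isPreconnected isPreconnected_univ (Set.mem_univ p)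
    (Set.mem_univ p₀)] at this
  exact this.self_of_nhds

lemma eq_on_of_dense {E F : Type*} [TopologicalSpace E] [TopologicalSpace F] [T2Space F]
    {S D : Set E} (hD : S ⊆ closure {x ∈ S | x ∈ D}) {f h : E → F}
    (hf : ContinuousOn f S) (hh : ContinuousOn h S) (heq : ∀ x ∈ S, x ∈ D → f x = h x) {x : E}
    (hx : x ∈ S) : f x = h x :=
  Set.EqOn.of_subset_closure (s := {x ∈ S | x ∈ D}) (fun y hy => heq y hy.1 hy.2) hf hh
    (Set.sep_subset _ _) hD hx

/-- The constant of the independence set is valid at all points. -/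
lemma constant_at_all_points [IsManifold (𝓡 4) ∞ M] [ConnectedSpace M]
    (hK : IsKahler g J) (s : IsSolution g J a l) (s' : IsSolution g J a' l')
    (hli : ∀ c₀ c₁ c₂ : ℝ, c₀ • g + c₁ • a + c₂ • a' = 0 → c₁ • l + c₂ • l' = 0 →
      c₀ = 0 ∧ c₁ = 0 ∧ c₂ = 0) {B : ℝ}
    (hB : ∀ p, LinearIndependent ℝ ![g p, a p, a' p] → ∀ e ∈ charts 4 M, p ∈ e.source →
      HasConstantAt (chartForm g e) (chartEndo J e) (chartConnection g e) (e p) B)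
    (he : e ∈ charts 4 M) (hx : x ∈ e.target) :
    (∀ z w u, curvatureForm (chartConnection g e) x z w u =
      -B • modelCurvature (chartForm g e x) (chartEndo J e x) z w u) ∧
    ∀ b n, IsSolution g J b n → ∃ μ : ℝ,
      hessianForm (chartConnection g e) (chartCovector n e) x =
        μ • chartForm g e x + B • chartForm b e x := by
  have K := hK.localKahler he
  have hdense := chart_subset_closure_independent hK s s' hli he
  have hD : ∀ y ∈ e.target,
      LinearIndependent ℝ ![chartForm g e y, chartForm a e y, chartForm a' e y] →
      HasConstantAt (chartForm g e) (chartEndo J e) (chartConnection g e) y B := by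
    intro y hy hyl
    have hys := e.map_target hy
    have h := hB (e.symm y) (by
      rw [← linearIndependent_chartForm_iff he hys, e.right_inv hy]
      exact hyl) e he hys
    rwa [e.right_inv hy] at h
  have cG := K.smooth_metric.continuousOn
  have cJ := K.smooth_complex.continuousOn
  constructor
  · intro z w u
    have cR := (contDiffOn_curvatureForm K.isOpen K.smooth_connection).continuousOn
    refine eq_on_of_dense (D := {y | LinearIndependent ℝ
      ![chartForm g e y, chartForm a e y, chartForm a' e y]}) hdense
      (f := fun y => curvatureForm (chartConnection g e) y z w u)
      (h := fun y => -B • modelCurvature (chartForm g e y) (chartEndo J e y) z w u)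
      (by fun_prop) ?_ (fun y hy hyl => (hD y hy hyl).1 z w u) hx
    unfold modelCurvature
    fun_prop
  · intro b n hs
    have hb := hs.localSolution hK he
    have cb := hb.smooth_form.continuousOn
    have cN := (contDiffOn_hessianForm K.isOpen K.smooth_connection
      hb.smooth_covector).continuousOn
    obtain ⟨e₁, e₂, F⟩ := (K.hermitian x hx).exists_adaptedFrame (by simp)
    -- The proportionality of `∇n - B b` to `g` is written with `μ` eliminated by
    -- cross-multiplication, an equation between continuous functions that passes from the dense set
    -- to `x`.
    have key : ∀ u v, (hessianForm (chartConnection g e) (chartCovector n e) x u v -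
        B * chartForm b e x u v) * chartForm g e x e₁ e₁ =
        (hessianForm (chartConnection g e) (chartCovector n e) x e₁ e₁ -
        B * chartForm b e x e₁ e₁) * chartForm g e x u v := fun u v => by
      refine eq_on_of_dense (D := {y | LinearIndependent ℝ
        ![chartForm g e y, chartForm a e y, chartForm a' e y]}) hdense
        (f := fun y => (hessianForm (chartConnection g e) (chartCovector n e) y u v -
        B * chartForm b e y u v) * chartForm g e y e₁ e₁)
        (h := fun y => (hessianForm (chartConnection g e) (chartCovector n e) y e₁ e₁ -
        B * chartForm b e y e₁ e₁) * chartForm g e y u v) (by fun_prop) (by fun_prop) ?_ hx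
      intro y hy hyl
      obtain ⟨μ, hμ⟩ := (hD y hy hyl).2 _ _ (hb.integrability K hy)
      simp only [hμ, add_apply, smul_apply, smul_eq_mul]
      ring
    refine ⟨(hessianForm (chartConnection g e) (chartCovector n e) x e₁ e₁ -
        B * chartForm b e x e₁ e₁) / chartForm g e x e₁ e₁, ?_⟩
    ext u v
    have := key u v
    simp only [add_apply, smul_apply, smul_eq_mul]
    field_simp [F.ne₁]
    linarith

end Global

/-! ### The degree of mobility and the conclusion -/

section Mobility

open ContinuousLinearMap Topology

set_option maxSynthPendingDepth 3

variable {M : Type*} [TopologicalSpace M] [ChartedSpace (EuclideanSpace ℝ (Fin 4)) M]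
  {g : BilinField 4 M} {J : EndoField 4 M}

/-- The pair `(g, 0)` is a nonzero solution, so a solution space of rank at least three contains two
more that are independent of it. Independence concerns the pairs `(a, λ)`, hence the two separate
relations. -/
lemma exists_independent_solutions [Nonempty M] (hK : IsKahler g J)
    (hD : 3 ≤ degreeOfMobility g J) :
    ∃ (a a' : BilinField 4 M) (l l' : CovectorField 4 M), IsSolution g J a l ∧
      IsSolution g J a' l' ∧ ∀ c₀ c₁ c₂ : ℝ, c₀ • g + c₁ • a + c₂ • a' = 0 →
        c₁ • l + c₂ • l' = 0 → c₀ = 0 ∧ c₁ = 0 ∧ c₂ = 0 := by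
  have hg : g ≠ 0 := by
    rintro rfl
    obtain ⟨p⟩ := ‹Nonempty M›
    have h : ∀ v : EuclideanSpace ℝ (Fin 4), v = 0 := fun v =>
      hK.nondegenerate p v fun _ => rfl
    simpa using congrArg (fun v : EuclideanSpace ℝ (Fin 4) => v 0) (h (basisVec 0))
  let s₀ : solutionSpace g J := ⟨(g, 0), hK.metric_isSolution⟩
  have hs₀ : s₀ ≠ 0 := fun h => hg (congrArg (fun s : solutionSpace g J => s.1.1) h)
  have h₁ : LinearIndependent ℝ ![s₀] := by
    rw [linearIndependent_unique_iff]
    exact hs₀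
  obtain ⟨s₁, h₂⟩ := exists_linearIndependent_cons_of_lt_rank (n := 1) h₁
    (lt_of_lt_of_le (by norm_num) hD)
  obtain ⟨s₂, h₃⟩ := exists_linearIndependent_cons_of_lt_rank (n := 2) h₂
    (lt_of_lt_of_le (by norm_num) hD)
  refine ⟨s₁.1.1, s₂.1.1, s₁.1.2, s₂.1.2, s₁.2, s₂.2, fun c₀ c₁ c₂ hc hc' => ?_⟩
  -- Each new solution was prepended to the family, so the coefficients occur in reverse order.
  have h := Fintype.linearIndependent_iff.mp h₃ ![c₂, c₁, c₀] (by
    refine Subtype.ext (Prod.ext ?_ ?_)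
    · simp [Fin.sum_univ_three, s₀]
      rw [← hc]; abel
    · simp [Fin.sum_univ_three, s₀]
      rw [← hc']; abel)
  exact ⟨h 2, h 1, h 0⟩

variable {a : BilinField 4 M} {l : CovectorField 4 M}
  {e e' : OpenPartialHomeomorph M (EuclideanSpace ℝ (Fin 4))} {p : M}

/-- The equation at `p` refers to all charts around `p`. One chart suffices because both sides are
tensors, and symmetry of `g` and `a` absorbs the different order of indices. -/
lemma IsKahler.hessianEqAt_of_chart (hK : IsKahler g J) (s : IsSolution g J a l)
    (he : e ∈ charts 4 M) (hp : p ∈ e.source) {μ B : ℝ}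
    (h : hessianForm (chartConnection g e) (chartCovector l e) (e p) =
      μ • chartForm g e (e p) + B • chartForm a e (e p)) : HessianEqAt g a l p μ B := by
  intro e' he' hp' i j
  have hps : e'.symm (e' p) ∈ e.source := by rwa [e'.left_inv hp']
  have hx := e'.map_source hp'
  have ht := hK.hessianForm_transition s.smooth_covector he' he hx hps (basisVec j) (basisVec i)
  have htg := chartForm_transition g he' he hx hps (basisVec j) (basisVec i)
  have hta := chartForm_transition a he' he hx hps (basisVec j) (basisVec i)
  rw [e'.left_inv hp', h] at ht
  rw [e'.left_inv hp'] at htg hta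
  simp only [add_apply, smul_apply, smul_eq_mul, ← htg, ← hta, chartForm_basisVec] at ht
  rw [hK.hessianForm_basisVec s.smooth_covector he' hx] at ht
  have hs : comp₂ a e' j i (e' p) = comp₂ a e' i j (e' p) := s.symm _ _ _
  rw [ht, hK.comp₂_symm j i, hs]

lemma IsKahler.hessianForm_of_hessianEqAt (hK : IsKahler g J) (s : IsSolution g J a l)
    (he : e ∈ charts 4 M) (hp : p ∈ e.source) {μ B : ℝ} (h : HessianEqAt g a l p μ B) :
    hessianForm (chartConnection g e) (chartCovector l e) (e p) =
      μ • chartForm g e (e p) + B • chartForm a e (e p) := by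
  ext w u
  rw [← sub_eq_zero]
  refine eq_zero_of_basisVec₂ (f := fun w u =>
    hessianForm (chartConnection g e) (chartCovector l e) (e p) w u -
      (μ • chartForm g e (e p) + B • chartForm a e (e p)) w u) (fun v => ⟨?_, ?_⟩)
    (fun u => ⟨?_, ?_⟩) (fun j i => ?_) w u
  · intros; simp; ring
  · intros; simp; ring
  · intros; simp; ring
  · intros; simp; ring
  · have hs : comp₂ a e j i (e p) = comp₂ a e i j (e p) := s.symm _ _ _
    simp only [add_apply, smul_apply, smul_eq_mul, chartForm_basisVec]
    rw [hK.hessianForm_basisVec s.smooth_covector he (e.map_source hp), h e he hp,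
      hK.comp₂_symm j i, hs, sub_self]

lemma IsKahler.hessianEqAt_unique (hK : IsKahler g J) [IsManifold (𝓡 4) ∞ M]
    (s : IsSolution g J a l) (ha : ∀ c : ℝ, a p ≠ c • g p) {μ B μ' B' : ℝ}
    (h : HessianEqAt g a l p μ B) (h' : HessianEqAt g a l p μ' B') : B' = B := by
  set e := chartAt (EuclideanSpace ℝ (Fin 4)) p
  have he : e ∈ charts 4 M := IsManifold.chart_mem_maximalAtlas p
  have hp : p ∈ e.source := mem_chart_source _ p
  by_contra hne
  have h0 : B' - B ≠ 0 := sub_ne_zero.mpr hne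
  have h1 := (hK.hessianForm_of_hessianEqAt s he hp h).symm.trans
    (hK.hessianForm_of_hessianEqAt s he hp h')
  -- If `B' ≠ B`, subtracting the two equations exhibits `a` as a multiple of `g` at `p`. The third
  -- summand, with coefficient zero, only serves to fit `chartForm_combination`.
  have h2 : chartForm ((-((μ - μ') / (B' - B))) • g + (1 : ℝ) • a + (0 : ℝ) • a) e (e p) = 0 := by
    rw [chartForm_combination]
    ext w u
    have h3 := congrArg (fun A : EuclideanSpace ℝ (Fin 4) →L[ℝ] EuclideanSpace ℝ (Fin 4) →L[ℝ] ℝ =>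
      A w u) h1
    simp only [add_apply, smul_apply, smul_eq_mul, zero_apply] at h3 ⊢
    field_simp
    linarith
  rw [chartForm_eq_zero_iff he (e.map_source hp), e.left_inv hp] at h2
  refine ha ((μ - μ') / (B' - B)) ?_
  have h4 : -((μ - μ') / (B' - B)) • g p + (1 : ℝ) • a p + (0 : ℝ) • a p = 0 := h2
  rw [one_smul, zero_smul, add_zero, neg_smul, neg_add_eq_zero] at h4
  exact h4.symm

end Mobility

end KahlerMobility

end

theorem lemma6 {M : Type*} [TopologicalSpace M] [ChartedSpace (EuclideanSpace ℝ (Fin 4)) M]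
    [IsManifold (𝓡 4) ∞ M] [T2Space M] [SecondCountableTopology M] [ConnectedSpace M]
    (g : KahlerMobility.BilinField 4 M) (J : KahlerMobility.EndoField 4 M)
    (hK : KahlerMobility.IsKahler g J) (hD : 3 ≤ KahlerMobility.degreeOfMobility g J) :
    ∃ B : ℝ, KahlerMobility.HasConstHolSectionalCurvature g J (-4 * B) ∧
      ∀ (a : KahlerMobility.BilinField 4 M) (l : KahlerMobility.CovectorField 4 M),
        (a, l) ∈ KahlerMobility.solutionSpace g J →
          (∃ μ : M → ℝ, ∀ p, KahlerMobility.HessianEqAt g a l p (μ p) B) ∧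
          (∀ p, (∀ c : ℝ, a p ≠ c • g p) →
            ∀ μ' B' : ℝ, KahlerMobility.HessianEqAt g a l p μ' B' → B' = B) := by
  obtain ⟨a, a', l, l', s, s', hli⟩ := KahlerMobility.exists_independent_solutions hK hD
  obtain ⟨B, hB⟩ := KahlerMobility.exists_global_constant hK s s' hli
  refine ⟨B, fun e he x hx ξ hξ => hK.holSectionalCurvature_eq he hx
    (KahlerMobility.constant_at_all_points hK s s' hli hB he hx).1 hξ, fun b n hb => ?_⟩
  have hμ : ∀ p, ∃ μ, KahlerMobility.HessianEqAt g b n p μ B := fun p => by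
    have he := IsManifold.chart_mem_maximalAtlas (I := 𝓡 4) (n := ∞) p
    have hp := mem_chart_source (EuclideanSpace ℝ (Fin 4)) p
    obtain ⟨μ, h⟩ := (KahlerMobility.constant_at_all_points hK s s' hli hB he
      (OpenPartialHomeomorph.map_source _ hp)).2 b n hb
    exact ⟨μ, hK.hessianEqAt_of_chart hb he hp h⟩
  choose μ hμ using hμ
  exact ⟨⟨μ, hμ⟩, fun p hp μ' B' h' => hK.hessianEqAt_unique hb hp (hμ p) h'⟩
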